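/- **Theorem (parametric regularity of the pullback Poisson solution).** Let $d\in\{1,2,3\}$, let $D\subset\mathbb R^d$ be a bounded, non-empty open set (for instance a bounded Lipschitz domain), and let $U=[-\frac12,\frac12]^{\mathbb N}$. Let $\mathscr F$ be the set of finitely supported multi-indices $\nu\in\mathbb N_0^{\mathbb N}$, with $|\nu|=\sum_j\nu_j$, $b^\nu=\prod_j b_j^{\nu_j}$ (where $0^0=1$) and $\partial_y^\nu=\prod_j\partial^{\nu_j}/\partial y_j^{\nu_j}$ (derivatives are one-sided where $y_j=\pm\frac12$). Let $V:\overline D\times U\to\mathbb R^d$, let $J(x,y)$ be the Jacobian matrix of $V(\cdot,y)$ at $x$, and let $\mathcal D=\bigcup_{y\in U}V(D,y)$. Let $0<\sigma_{\min}\le1\le\sigma_{\max}<\infty$, $C\ge1$, $\beta\ge1$, $C_f>0$, $b_j\ge0$ $(j\ge1)$ and $\rho_j\ge0$ $(1\le j\le d)$. Assume: * (A1) For every $y\in U$ the map $V(\cdot,y)$ is injective on $\overline D$ and of class $\mathcal C^2(\overline D)$, its inverse is of class $\mathcal C^2(\overline{V(D,y)})$, and the $\mathcal C^2$-norms of both are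 bounded uniformly in $y\in U$. * (A2) All singular values of $J(x,y)$ lie in $[\sigma_{\min},\sigma_{\max}]$, for all $x\in D$, $y\in U$. * (A3) All derivatives $\partial_y^\nu V$ exist, and $\|\partial_y^\nu V(\cdot,y)\|_{W^{1,\infty}(D)}\le C(|\nu|!)^\beta b^\nu$ for all $\nu\in\mathscr F$, $y\in U$. Here $\|v\|_{W^{1,\infty}(D)}$ is the maximum of the essential suprema over $D$ of the Euclidean norm of $v$ and of the spectral norm of its Jacobian. * (A4) $f:\mathcal D\to\mathbb R$ is infinitely differentiable and $\|\partial_x^\mu f\|_{L^\infty(\mathcal D)}\le C_f(|\mu|!)^\beta\rho^\mu$ for all $\mu\in\mathbb N_0^d$. Let $H_0^1(D)$ be the closure of $C_c^\infty(D)$ in $H^1(D)$, with norm $\|v\|_{H_0^1(D)}=\|\nabla v\|_{L^2(D)}$, and let $C_D$ be the Poincaré constant of $D$, i.e. the least constant with $\|v\|_{L^2(D)}\le C_D\|\nabla v\|_{L^2(D)}$ for all $v\in H_0^1(D)$. Put $A=(J^{\rm T}J)^{-1}\det J$ and $f_{\rm ref}(x,y)=f(V(x,y))\det J(x,y)$.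 Then for every $y\in U$ there is exactly one $\widehat u(\cdot,y)\in H_0^1(D)$ such that $$\int_D (A(x,y)\nabla\widehat u(x,y))\cdot\nabla v(x)\,dx=\int_D f_{\rm ref}(x,y)\,v(x)\,dx\qquad\text{for all }v\in H_0^1(D),$$ all derivatives $\partial_y^\nu\widehat u$, $\nu\in\mathscr F$, exist as derivatives of the $H_0^1(D)$-valued map $y\mapsto\widehat u(\cdot,y)$ on $U$, and for all $y\in U$ $$\|\partial_y^\nu\widehat u(\cdot,y)\|_{H_0^1(D)}\le C_{\widehat u,1}\,C_{\widehat u,2}^{|\nu|}\,(|\nu|!)^\beta\,b^\nu\qquad\text{for all }\nu\in\mathscr F\setminus\{0\},$$ $$\|\widehat u(\cdot,y)\|_{H_0^1(D)}\le 1+\frac{\sigma_{\max}^2}{\sigma_{\min}^d}|D|^{1/2}C_D\,\sigma_{\max}^d C_f .$$ The constants are $$C_{\widehat u,1}=1+\frac{\sigma_{\max}^2}{\sigma_{\min}^d}|D|^{1/2}C_D\,C_{f_{\rm ref},1},\qquad C_{\widehat u,2}=\max\{c_0,c_1,\widetilde c_0,\widetilde c_1\}^2\,((d^2)!)^\beta\,2^{\beta(d^2+1)+1},$$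 $$c_0=\frac{C_{A,1}}{\sigma_{\min}^d((d^2)!)^\beta},\quad c_1=2C_{A,2},\quad \widetilde c_0=\frac{|D|^{1/2}C_DC_{f_{\rm ref},1}}{\sigma_{\min}^d((d^2)!)^\beta},\quad \widetilde c_1=C_{f_{\rm ref},2}\max\{1,\|\rho\|_{\ell^{1/\beta}}\},$$ $$C_{A,1}=\sigma_{\max}^d\sigma_{\min}^{-2},\quad C_{A,2}=C_{\det J}\,\sigma_{\min}^{-2}C^2\,4^\beta,\quad C_{\det J}=\frac{2^\beta C}{\sigma_{\min}},\quad C_{f_{\rm ref},1}=\sigma_{\max}^d2^{-\beta}C_f,\quad C_{f_{\rm ref},2}=\frac{2^\beta C^2}{\sigma_{\min}}2^\beta,$$ and $\|\rho\|_{\ell^{1/\beta}}=\big(\sum_{j=1}^d\rho_j^{1/\beta}\big)^\beta$. -/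

import Mathlib

open MeasureTheory Set Topology
open scoped ContDiff

noncomputable section

namespace DomainUQ

/-- The parameter set `U = [-1/2, 1/2]^ℕ`. -/
def paramSet : Set (ℕ → ℝ) := {y | ∀ j, y j ∈ Icc (-(1 / 2) : ℝ) (1 / 2)}

/-- `b^ν = ∏ⱼ bⱼ^{νⱼ}` for a finitely supported multi-index `ν` (with `0^0 = 1`). -/
def mpow (b : ℕ → ℝ) (ν : ℕ →₀ ℕ) : ℝ := ν.prod fun j k => b j ^ k

/-- The number `(n!)^β` for a real exponent `β`. -/
def factPow (β : ℝ) (n : ℕ) : ℝ := (Nat.factorial n : ℝ) ^ β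

/-- `G` is the family of all mixed partial derivatives `∂_y^ν F` of `F : U → X`: `G 0 = F`, and the
`j`-th partial derivative of `G ν` at every point of `U` exists and is `G (ν + e_j)` (one-sided where
`y j = ± 1/2`). In particular the derivatives do not depend on the order of differentiation, and `G`
is determined by `F` on `U`. -/
def IsParamDerivFamily {X : Type*} [NormedAddCommGroup X] [NormedSpace ℝ X]
    (F : (ℕ → ℝ) → X) (G : (ℕ →₀ ℕ) → (ℕ → ℝ) → X) : Prop :=
  (∀ y ∈ paramSet, G 0 y = F y) ∧
  ∀ (ν : ℕ →₀ ℕ) (j : ℕ), ∀ y ∈ paramSet,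
    HasDerivWithinAt (fun t : ℝ => G ν (Function.update y j t)) (G (ν + Finsupp.single j 1) y)
      (Icc (-(1 / 2) : ℝ) (1 / 2)) (y j)

/-- `d`-dimensional Euclidean space. -/
abbrev Euc (d : ℕ) : Type := EuclideanSpace ℝ (Fin d)

/-- Test functions `φ ∈ C_c^∞(D)`, as functions on the whole space. -/
def IsTestFunction {d : ℕ} (D : Set (Euc d)) (φ : Euc d → ℝ) : Prop :=
  ContDiff ℝ ∞ φ ∧ HasCompactSupport φ ∧ tsupport φ ⊆ D

/-- `M` is the weak Jacobian of the vector field `v` on the open set `D`. -/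
def IsWeakJacobian {d : ℕ} (D : Set (Euc d)) (v : Euc d → Euc d)
    (M : Euc d → Euc d →L[ℝ] Euc d) : Prop :=
  ∀ φ : Euc d → ℝ, IsTestFunction D φ → ∀ w : Euc d,
    ∫ x in D, (fderiv ℝ φ x w) • v x = - ∫ x in D, φ x • M x w

/-- `v ∈ W^{1,∞}(D)` and `‖v‖_{W^{1,∞}(D)} ≤ B`, where the norm is the maximum of the essential
suprema of the Euclidean norm of `v` and of the spectral norm of its (weak) Jacobian. -/
def W1InfNormLE {d : ℕ} (D : Set (Euc d)) (v : Euc d → Euc d) (B : ℝ) : Prop :=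
  AEStronglyMeasurable v (volume.restrict D) ∧
  (∀ᵐ x ∂(volume.restrict D), ‖v x‖ ≤ B) ∧
  ∃ M : Euc d → Euc d →L[ℝ] Euc d,
    AEStronglyMeasurable M (volume.restrict D) ∧
    (∀ᵐ x ∂(volume.restrict D), ‖M x‖ ≤ B) ∧ IsWeakJacobian D v M

/-- `v ∈ C²(closure D)` (`v` is `C²` in `D`, and `v` and its derivatives up to order two extend
continuously to `closure D`), with all these derivatives bounded by `B`. -/
def C2NormLE {d : ℕ} (D : Set (Euc d)) (v : Euc d → Euc d) (B : ℝ) : Prop :=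
  ContinuousOn v (closure D) ∧ ContDiffOn ℝ 2 v D ∧
  ∀ k : ℕ, k ≤ 2 →
    (∃ g : Euc d → ContinuousMultilinearMap ℝ (fun _ : Fin k => Euc d) (Euc d),
      ContinuousOn g (closure D) ∧ EqOn g (iteratedFDeriv ℝ k v) D) ∧
    ∀ x ∈ D, ‖iteratedFDeriv ℝ k v x‖ ≤ B

/-- The maps `V(·,y) : closure D → ℝ^d` are invertible onto their images and `C²` up to the boundary
together with their inverses, with `C²`-norms bounded uniformly in `y ∈ U`. -/
def IsUniformC2Family {d : ℕ} (D : Set (Euc d)) (V : (ℕ → ℝ) → Euc d → Euc d) : Prop :=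
  (∃ B : ℝ, ∀ y ∈ paramSet, C2NormLE D (V y) B) ∧
  ∃ B' : ℝ, ∀ y ∈ paramSet, ∃ W : Euc d → Euc d,
    LeftInvOn W (V y) (closure D) ∧ C2NormLE (V y '' D) W B'

/-- All `d` singular values of the Jacobian `J(x,y)` of `V(·,y)` lie in `[σmin, σmax]`, for all
`x ∈ D` and `y ∈ U`. -/
def JacobianSingularValueBounds {d : ℕ} (D : Set (Euc d)) (V : (ℕ → ℝ) → Euc d → Euc d)
    (σmin σmax : ℝ) : Prop :=
  ∀ x ∈ D, ∀ y ∈ paramSet, ∀ i < d,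
    σmin ≤ (fderiv ℝ (V y) x : Euc d →ₗ[ℝ] Euc d).singularValues i ∧
    (fderiv ℝ (V y) x : Euc d →ₗ[ℝ] Euc d).singularValues i ≤ σmax

/-- Gevrey regularity of the perturbation field: all mixed partial derivatives `∂_y^ν V` exist, and
`‖∂_y^ν V(·,y)‖_{W^{1,∞}(D)} ≤ C (|ν|!)^β b^ν` for all `ν` and all `y ∈ U`. -/
def GevreyField {d : ℕ} (D : Set (Euc d)) (V : (ℕ → ℝ) → Euc d → Euc d)
    (C β : ℝ) (b : ℕ → ℝ) : Prop :=
  ∃ dV : (ℕ →₀ ℕ) → (ℕ → ℝ) → Euc d → Euc d,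
    (∀ x ∈ D, IsParamDerivFamily (fun y => V y x) (fun ν y => dV ν y x)) ∧
    ∀ ν : ℕ →₀ ℕ, ∀ y ∈ paramSet,
      W1InfNormLE D (dV ν y) (C * factPow β ν.degree * mpow b ν)

/-- The hold-all domain: the union of the domains `D(y) = V(D, y)`, `y ∈ U`. -/
def holdAll {d : ℕ} (D : Set (Euc d)) (V : (ℕ → ℝ) → Euc d → Euc d) : Set (Euc d) :=
  ⋃ y ∈ paramSet, V y '' D

/-- The partial derivative `∂^n f / ∂x_{k 0} ⋯ ∂x_{k (n-1)}`. -/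
def mixedPartial {d n : ℕ} (k : Fin n → Fin d) (f : Euc d → ℝ) (x : Euc d) : ℝ :=
  iteratedFDeriv ℝ n f x fun i => EuclideanSpace.single (k i) (1 : ℝ)

/-- Gevrey regularity of the source on the open set `Ω`: `f ∈ C^∞(Ω)` and
`|∂_x^μ f| ≤ Cf (|μ|!)^β ρ^μ` on `Ω` for every multi-index `μ ∈ ℕ₀^d`. A multi-index `μ` with `|μ| = n`
is given by a sequence `k` of `n` coordinate directions in which `j` occurs `μ j` times; then
`ρ^μ = ∏ᵢ ρ_{k i}`. -/
def GevreySource {d : ℕ} (Ω : Set (Euc d)) (f : Euc d → ℝ) (Cf β : ℝ) (ρ : Fin d → ℝ) : Prop :=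
  ContDiffOn ℝ ∞ f Ω ∧
  ∀ (n : ℕ) (k : Fin n → Fin d), ∀ x ∈ Ω,
    |mixedPartial k f x| ≤ Cf * factPow β n * ∏ i, ρ (k i)

/-- The Hilbert space `L²(D) × L²(D; ℝ^d)`. -/
abbrev L2Pair {d : ℕ} (D : Set (Euc d)) : Type :=
  WithLp 2 (Lp ℝ 2 (volume.restrict D) × Lp (Euc d) 2 (volume.restrict D))

/-- The Sobolev space `H_0^1(D)`, the closure of `C_c^∞(D)` in `H^1(D)`. An element `v` is represented
by the pair `(v, ∇v)` of `L²(D) × L²(D; ℝ^d)`, so that the norm of this ambient space is the norm of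
`H^1(D)`. -/
def H01 {d : ℕ} (D : Set (Euc d)) : Submodule ℝ (L2Pair D) :=
  (Submodule.span ℝ {p : L2Pair D | ∃ φ : Euc d → ℝ, IsTestFunction D φ ∧
    p.fst =ᵐ[volume.restrict D] φ ∧ p.snd =ᵐ[volume.restrict D] gradient φ}).topologicalClosure

/-- The function underlying an element of `H_0^1(D)`. -/
def h01Val {d : ℕ} {D : Set (Euc d)} (v : H01 D) : Lp ℝ 2 (volume.restrict D) :=
  (v : L2Pair D).fst

/-- The weak gradient of an element of `H_0^1(D)`. -/
def h01Grad {d : ℕ} {D : Set (Euc d)} (v : H01 D) : Lp (Euc d) 2 (volume.restrict D) :=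
  (v : L2Pair D).snd

/-- The norm `‖v‖_{H_0^1(D)} = ‖∇v‖_{L²(D)}`. -/
def h01Norm {d : ℕ} {D : Set (Euc d)} (v : H01 D) : ℝ := ‖h01Grad v‖

/-- The Poincaré constant of `D`: the least `c ≥ 0` such that `‖v‖_{L²(D)} ≤ c ‖∇v‖_{L²(D)}` for all
`v ∈ H_0^1(D)`. -/
def poincareConst {d : ℕ} (D : Set (Euc d)) : ℝ :=
  sInf {c : ℝ | 0 ≤ c ∧ ∀ v : H01 D, ‖h01Val v‖ ≤ c * h01Norm v}

/-- `A(x,y) = (J(x,y)ᵀ J(x,y))⁻¹ det J(x,y)`, where `J(·,y)` is the Jacobian of `Vy = V(·,y)`. -/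
def pullbackCoeff {d : ℕ} (Vy : Euc d → Euc d) (x : Euc d) : Euc d →L[ℝ] Euc d :=
  (fderiv ℝ Vy x).det •
    ((ContinuousLinearMap.adjoint (fderiv ℝ Vy x)).comp (fderiv ℝ Vy x)).inverse

/-- `f_ref(x,y) = f(V(x,y)) det J(x,y)`. -/
def pullbackSource {d : ℕ} (f : Euc d → ℝ) (Vy : Euc d → Euc d) (x : Euc d) : ℝ :=
  f (Vy x) * (fderiv ℝ Vy x).det

/-- `u ∈ H_0^1(D)` solves the pullback weak formulation
`∫_D (A ∇u) · ∇v = ∫_D f_ref v` for all `v ∈ H_0^1(D)`. -/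
def IsPullbackSolution {d : ℕ} (D : Set (Euc d)) (f : Euc d → ℝ) (Vy : Euc d → Euc d)
    (u : H01 D) : Prop :=
  ∀ v : H01 D,
    ∫ x in D, inner ℝ (pullbackCoeff Vy x (h01Grad u x)) (h01Grad v x) =
      ∫ x in D, pullbackSource f Vy x * h01Val v x

/-! Constants. -/

/-- `‖ρ‖_{ℓ^{1/β}}`. -/
def rhoNorm {d : ℕ} (β : ℝ) (ρ : Fin d → ℝ) : ℝ := (∑ j, ρ j ^ (1 / β)) ^ β

/-- `C_{det J} = 2^β C / σmin`. -/
def CdetJ (σmin β C : ℝ) : ℝ := 2 ^ β * C / σmin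

/-- `C_{A,1} = σmax^d σmin^{-2}`. -/
def CA1 (d : ℕ) (σmin σmax : ℝ) : ℝ := σmax ^ d / σmin ^ 2

/-- `C_{A,2} = C_{det J} σmin^{-2} C² 4^β`. -/
def CA2 (σmin β C : ℝ) : ℝ := CdetJ σmin β C / σmin ^ 2 * C ^ 2 * 4 ^ β

/-- `C_{f_ref,1} = σmax^d 2^{-β} Cf`. -/
def Cfref1 (d : ℕ) (σmax β Cf : ℝ) : ℝ := σmax ^ d * 2 ^ (-β) * Cf

/-- `C_{f_ref,2} = (2^β C² / σmin) 2^β`. -/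
def Cfref2 (σmin β C : ℝ) : ℝ := 2 ^ β * C ^ 2 / σmin * 2 ^ β

/-- `C_{û,1} = 1 + (σmax² / σmin^d) |D|^{1/2} C_D C_{f_ref,1}`. -/
def Cu1 {d : ℕ} (D : Set (Euc d)) (σmin σmax β Cf : ℝ) : ℝ :=
  1 + σmax ^ 2 / σmin ^ d * √(volume.real D) * poincareConst D * Cfref1 d σmax β Cf

/-- `c₀ = C_{A,1} / (σmin^d ((d²)!)^β)`. -/
def cZero (d : ℕ) (σmin σmax β : ℝ) : ℝ := CA1 d σmin σmax / (σmin ^ d * factPow β (d ^ 2))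

/-- `c₁ = 2 C_{A,2}`. -/
def cOne (σmin β C : ℝ) : ℝ := 2 * CA2 σmin β C

/-- `c̃₀ = |D|^{1/2} C_D C_{f_ref,1} / (σmin^d ((d²)!)^β)`. -/
def cTildeZero {d : ℕ} (D : Set (Euc d)) (σmin σmax β Cf : ℝ) : ℝ :=
  √(volume.real D) * poincareConst D * Cfref1 d σmax β Cf / (σmin ^ d * factPow β (d ^ 2))

/-- `c̃₁ = C_{f_ref,2} max{1, ‖ρ‖_{ℓ^{1/β}}}`. -/
def cTildeOne {d : ℕ} (σmin β C : ℝ) (ρ : Fin d → ℝ) : ℝ :=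
  Cfref2 σmin β C * max 1 (rhoNorm β ρ)

/-- `C_{û,2} = max{c₀, c₁, c̃₀, c̃₁}² ((d²)!)^β 2^{β(d²+1)+1}`. -/
def Cu2 {d : ℕ} (D : Set (Euc d)) (σmin σmax β C Cf : ℝ) (ρ : Fin d → ℝ) : ℝ :=
  (max (max (cZero d σmin σmax β) (cOne σmin β C))
      (max (cTildeZero D σmin σmax β Cf) (cTildeOne σmin β C ρ))) ^ 2 *
    factPow β (d ^ 2) * (2 : ℝ) ^ (β * ((d : ℝ) ^ 2 + 1) + 1)

end DomainUQ

end

/-!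
The pulled-back Poisson problem is a linear equation `T(y) u = F(y)` in the space of weak gradients
of `H_0^1(D)`, and its solution inherits the Gevrey regularity of `T` and `F` in the parameter `y`.

*Calculus in the parameter.* `IsGevrey b β K q F` says that all mixed partial derivatives of `F` exist
and that `‖∂^ν F‖ ≤ K q^{|ν|} (|ν|!)^β b^ν`. Since `β ≥ 1`, the Leibniz formula shows that this class
is stable under bounded bilinear maps (`IsGevrey.bilin`), under composition with Gevrey functions
(`IsGevrey.comp`) and, by differentiating `T(y) u(y) = F(y)`, under solving uniformly well-posed linear
equations (`IsGevrey.solve`).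

*Pointwise bounds.* The hypothesis on the field bounds the parameter derivatives in `W^{1,∞}`, that is
with weak Jacobians which need not be continuous. Testing difference quotients with test functions
shows that the parameter derivatives are in fact `C¹` in space and that the two kinds of derivatives
commute (`GevreyField.isGevrey`). Then `J`, `J⁻¹`, `det J`, the coefficient `A` and the source `f_ref`
are Gevrey regular at every point of `D`, with explicit constants (`isGevrey_pullbackCoeff`,
`isGevrey_pullbackSource`). As the constants do not depend on the point, a second order Taylor
expansion gives regularity with values in `L^∞(D)` (`exists_isGevrey_lp_top`).

*The operator.* By the Poincaré inequality the weak gradients of `H_0^1(D)` form a closed subspace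
`GradSpace D` of `L²(D; ℝ^d)`, and `T(y)` is the compression to it of the multiplication by `A(·,y)`.
The domain need not be connected and `det J(·,y)` may change its sign from one component to another,
so `T(y)` need not be positive. But the sign is locally constant on `D`, and multiplication by a
locally constant function maps `H_0^1(D)` into itself
(`exists_h01Grad_eq_locallyConst_smul`). Testing with the gradient multiplied by this sign gives
`‖g‖ ≤ α ‖T(y) g‖` and surjectivity (`coeffCLM_norm_le_and_surjective`), where
`α = min(σmax, C)² / σmin^d`.

*Constants.* Solving yields the leading constant `α |D|^{1/2} C_D Cf σmax^d` and a rate `Q` with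
`2^β Q ≤ Cu2` (`two_rpow_mul_rate_le`). For `|ν| ≥ 1` the spare factor `2^{-β}` turns the leading
constant into `Cu1` (`mul_pow_le_of_two_rpow_mul_le`).
-/

namespace DomainUQ

/-! ### Families of partial derivatives in the parameter -/

/-- `F'` is the partial derivative of `F` with respect to the `j`-th parameter, at every point of
the parameter set (one-sided on its faces). -/
def HasParamDeriv {X : Type*} [NormedAddCommGroup X] [NormedSpace ℝ X]
    (F : (ℕ → ℝ) → X) (j : ℕ) (F' : (ℕ → ℝ) → X) : Prop :=
  ∀ y ∈ paramSet, HasDerivWithinAt (fun t : ℝ => F (Function.update y j t)) (F' y)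
    (Icc (-(1 / 2) : ℝ) (1 / 2)) (y j)

/-- `G` is a family of mixed partial derivatives of `F` up to order `n`. -/
def IsParamDerivFamilyUpTo {X : Type*} [NormedAddCommGroup X] [NormedSpace ℝ X] (n : ℕ)
    (F : (ℕ → ℝ) → X) (G : (ℕ →₀ ℕ) → (ℕ → ℝ) → X) : Prop :=
  (∀ y ∈ paramSet, G 0 y = F y) ∧
  ∀ ν : ℕ →₀ ℕ, ν.degree < n → ∀ j, HasParamDeriv (G ν) j (G (ν + Finsupp.single j 1))

/-- All mixed partial derivatives of `F` up to order `n` exist and are symmetric. -/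
def ParamDiff {X : Type*} [NormedAddCommGroup X] [NormedSpace ℝ X] (n : ℕ)
    (F : (ℕ → ℝ) → X) : Prop :=
  ∃ G, IsParamDerivFamilyUpTo n F G

lemma update_mem_paramSet {y : ℕ → ℝ} (hy : y ∈ paramSet) (j : ℕ) {t : ℝ}
    (ht : t ∈ Icc (-(1 / 2) : ℝ) (1 / 2)) : Function.update y j t ∈ paramSet := by
  intro i
  by_cases h : i = j
  · subst h; simpa using ht
  · simpa [Function.update_of_ne h] using hy i

lemma exists_eq_add_single {ν : ℕ →₀ ℕ} (h : ν ≠ 0) :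
    ∃ (j : ℕ) (μ : ℕ →₀ ℕ), ν = μ + Finsupp.single j 1 := by
  obtain ⟨j, hj⟩ := Finsupp.ne_iff.1 h
  refine ⟨j, ν - Finsupp.single j 1, ?_⟩
  rw [tsub_add_cancel_of_le]
  simpa [Nat.one_le_iff_ne_zero] using hj

lemma degree_add_single (ν : ℕ →₀ ℕ) (j : ℕ) :
    (ν + Finsupp.single j 1).degree = ν.degree + 1 := by
  simp [Finsupp.degree_single]

section Basic

variable {X Y Z : Type*} [NormedAddCommGroup X] [NormedSpace ℝ X]
  [NormedAddCommGroup Y] [NormedSpace ℝ Y] [NormedAddCommGroup Z] [NormedSpace ℝ Z]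

lemma HasParamDeriv.congr {F F₁ F' F₁' : (ℕ → ℝ) → X} {j : ℕ} (h : HasParamDeriv F j F')
    (hF : EqOn F₁ F paramSet) (hF' : EqOn F₁' F' paramSet) : HasParamDeriv F₁ j F₁' := by
  intro y hy
  rw [hF' hy]
  refine (h y hy).congr (fun t ht => hF (update_mem_paramSet hy j ht)) ?_
  simpa using hF hy

lemma HasParamDeriv.unique {F F₁' F₂' : (ℕ → ℝ) → X} {j : ℕ} (h₁ : HasParamDeriv F j F₁')
    (h₂ : HasParamDeriv F j F₂') : EqOn F₁' F₂' paramSet := by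
  intro y hy
  exact (uniqueDiffOn_Icc (by norm_num) _ (hy j)).eq_deriv _ (h₁ y hy) (h₂ y hy)

lemma HasParamDeriv.add {F G F' G' : (ℕ → ℝ) → X} {j : ℕ} (hF : HasParamDeriv F j F')
    (hG : HasParamDeriv G j G') : HasParamDeriv (fun y => F y + G y) j (fun y => F' y + G' y) :=
  fun y hy => (hF y hy).add (hG y hy)

lemma HasParamDeriv.sub {F G F' G' : (ℕ → ℝ) → X} {j : ℕ} (hF : HasParamDeriv F j F')
    (hG : HasParamDeriv G j G') : HasParamDeriv (fun y => F y - G y) j (fun y => F' y - G' y) :=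
  fun y hy => (hF y hy).sub (hG y hy)

lemma HasParamDeriv.sum {ι : Type*} {s : Finset ι} {F F' : ι → (ℕ → ℝ) → X} {j : ℕ}
    (h : ∀ i ∈ s, HasParamDeriv (F i) j (F' i)) :
    HasParamDeriv (fun y => ∑ i ∈ s, F i y) j (fun y => ∑ i ∈ s, F' i y) :=
  fun y hy => HasDerivWithinAt.fun_sum fun i hi => h i hi y hy

lemma HasParamDeriv.clm {F F' : (ℕ → ℝ) → X} {j : ℕ} (L : X →L[ℝ] Y)
    (hF : HasParamDeriv F j F') : HasParamDeriv (fun y => L (F y)) j (fun y => L (F' y)) :=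
  fun y hy => L.hasFDerivAt.comp_hasDerivWithinAt _ (hF y hy)

lemma HasParamDeriv.bilin (B : X →L[ℝ] Y →L[ℝ] Z) {F F' : (ℕ → ℝ) → X} {G G' : (ℕ → ℝ) → Y}
    {j : ℕ} (hF : HasParamDeriv F j F') (hG : HasParamDeriv G j G') :
    HasParamDeriv (fun y => B (F y) (G y)) j (fun y => B (F' y) (G y) + B (F y) (G' y)) := by
  intro y hy
  have h := B.hasDerivWithinAt_of_bilinear (hF y hy) (hG y hy)
  simp only [Function.update_eq_self] at h
  rw [add_comm] at h
  exact h

lemma IsParamDerivFamilyUpTo.eqOn {n : ℕ} {F₁ F₂ : (ℕ → ℝ) → X}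
    {G₁ G₂ : (ℕ →₀ ℕ) → (ℕ → ℝ) → X} (h₁ : IsParamDerivFamilyUpTo n F₁ G₁)
    (h₂ : IsParamDerivFamilyUpTo n F₂ G₂) (h : EqOn F₁ F₂ paramSet) {ν : ℕ →₀ ℕ}
    (hν : ν.degree ≤ n) : EqOn (G₁ ν) (G₂ ν) paramSet := by
  induction hk : ν.degree generalizing ν with
  | zero =>
    obtain rfl : ν = 0 := (Finsupp.degree_eq_zero_iff ν).1 hk
    intro y hy
    rw [h₁.1 y hy, h₂.1 y hy, h hy]
  | succ k ih =>
    obtain ⟨j, μ, rfl⟩ := exists_eq_add_single (ν := ν) (by rintro rfl; simp at hk)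
    rw [degree_add_single] at hk hν
    have e := ih (ν := μ) (by omega) (by omega)
    exact (h₁.2 μ (by omega) j).unique ((h₂.2 μ (by omega) j).congr e fun _ _ => rfl)

lemma IsParamDerivFamilyUpTo.mono {m n : ℕ} (hmn : m ≤ n) {F : (ℕ → ℝ) → X}
    {G : (ℕ →₀ ℕ) → (ℕ → ℝ) → X} (h : IsParamDerivFamilyUpTo n F G) :
    IsParamDerivFamilyUpTo m F G :=
  ⟨h.1, fun ν hν => h.2 ν (hν.trans_le hmn)⟩

lemma ParamDiff.mono {m n : ℕ} (hmn : m ≤ n) {F : (ℕ → ℝ) → X} (h : ParamDiff n F) :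
    ParamDiff m F :=
  h.imp fun _ hG => hG.mono hmn

lemma IsParamDerivFamilyUpTo.shift {n : ℕ} {F : (ℕ → ℝ) → X} {G : (ℕ →₀ ℕ) → (ℕ → ℝ) → X}
    (h : IsParamDerivFamilyUpTo (n + 1) F G) (j : ℕ) :
    IsParamDerivFamilyUpTo n (G (Finsupp.single j 1)) (fun ν => G (ν + Finsupp.single j 1)) := by
  refine ⟨fun y _ => by simp, fun ν hν i => ?_⟩
  have := h.2 (ν + Finsupp.single j 1) (by rw [degree_add_single]; omega) i
  rwa [add_right_comm] at this

lemma IsParamDerivFamilyUpTo.hasParamDeriv {n : ℕ} {F : (ℕ → ℝ) → X}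
    {G : (ℕ →₀ ℕ) → (ℕ → ℝ) → X} (h : IsParamDerivFamilyUpTo (n + 1) F G) (j : ℕ) :
    HasParamDeriv F j (G (Finsupp.single j 1)) := by
  have := h.2 0 (by simp) j
  rw [zero_add] at this
  exact this.congr (fun y hy => (h.1 y hy).symm) fun _ _ => rfl

/-- Partial derivatives that are themselves differentiable to order `n`, with symmetric second
derivatives, can be glued to a derivative family of order `n + 1`. -/
lemma ParamDiff.glue {n : ℕ} {F : (ℕ → ℝ) → X} {F' : ℕ → (ℕ → ℝ) → X}
    (h : ∀ j, HasParamDeriv F j (F' j)) (h' : ∀ j, ParamDiff n (F' j))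
    (hsymm : 0 < n → ∃ F'' : ℕ → ℕ → (ℕ → ℝ) → X, (∀ i j, HasParamDeriv (F' j) i (F'' i j)) ∧
      ∀ i j, EqOn (F'' i j) (F'' j i) paramSet) :
    ParamDiff (n + 1) F := by
  classical
  choose G hG using h'
  have key : ∀ (μ : ℕ →₀ ℕ) (i j : ℕ), μ.degree < n →
      EqOn (G j (μ + Finsupp.single i 1)) (G i (μ + Finsupp.single j 1)) paramSet := by
    intro μ i j hμ
    obtain ⟨m, rfl⟩ : ∃ m, n = m + 1 := ⟨n - 1, by omega⟩
    obtain ⟨F'', hF'', hs⟩ := hsymm (by omega)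
    have e1 : EqOn (G j (Finsupp.single i 1)) (F'' i j) paramSet :=
      ((hG j).hasParamDeriv i).unique (hF'' i j)
    have e2 : EqOn (G i (Finsupp.single j 1)) (F'' j i) paramSet :=
      ((hG i).hasParamDeriv j).unique (hF'' j i)
    exact ((hG j).shift i).eqOn ((hG i).shift j) (e1.trans ((hs i j).trans e2.symm)) (by omega)
  let H : (ℕ →₀ ℕ) → (ℕ → ℝ) → X := fun ν =>
    if h0 : ν = 0 then F else
      G (exists_eq_add_single h0).choose (exists_eq_add_single h0).choose_spec.choose
  have hH : ∀ (μ : ℕ →₀ ℕ) (j : ℕ), μ.degree ≤ n →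
      EqOn (H (μ + Finsupp.single j 1)) (G j μ) paramSet := by
    intro μ j hμ
    have h0 : μ + Finsupp.single j 1 ≠ 0 := by
      intro h; have := degree_add_single μ j; rw [h] at this; simp at this
    set i := (exists_eq_add_single h0).choose with hi
    set κ := (exists_eq_add_single h0).choose_spec.choose with hκ
    have e : μ + Finsupp.single j 1 = κ + Finsupp.single i 1 :=
      (exists_eq_add_single h0).choose_spec.choose_spec
    have hHe : H (μ + Finsupp.single j 1) = G i κ := by simp only [H, dif_neg h0, ← hi, ← hκ]
    rw [hHe]
    by_cases hij : i = j
    · rw [hij] at e ⊢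
      rw [add_right_cancel e]
      exact fun _ _ => rfl
    · have hle : Finsupp.single i 1 ≤ μ := by
        have := DFunLike.congr_fun e i
        simp [hij] at this
        have h3 : (1 : ℕ) ≤ μ i := by omega
        simpa using h3
      obtain ⟨η, hη⟩ := exists_add_of_le hle
      rw [hη] at e hμ ⊢
      have e3 : κ = η + Finsupp.single j 1 := by
        apply add_right_cancel (b := Finsupp.single i 1)
        rw [← e]; abel
      rw [e3, add_comm (Finsupp.single i 1) η]
      rw [add_comm, degree_add_single] at hμ
      exact key η j i (by omega)
  refine ⟨H, fun y _ => by simp [H], fun ν hν j => ?_⟩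
  by_cases h0 : ν = 0
  · subst h0
    have hH0 := hH 0 j (by simp)
    refine (h j).congr (fun y _ => by simp [H]) fun y hy => ?_
    rw [hH0 hy, (hG j).1 y hy]
  · obtain ⟨i, μ, rfl⟩ := exists_eq_add_single h0
    rw [degree_add_single] at hν
    have := (hG i).2 μ (by omega) j
    refine this.congr (hH μ i (by omega)) ?_
    rw [add_right_comm]
    exact hH _ i (by rw [degree_add_single]; omega)

lemma ParamDiff.exists_deriv {n : ℕ} {F : (ℕ → ℝ) → X} (h : ParamDiff (n + 1) F) :
    ∃ F' : ℕ → (ℕ → ℝ) → X, (∀ j, HasParamDeriv F j (F' j)) ∧ (∀ j, ParamDiff n (F' j)) ∧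
      (0 < n → ∃ F'' : ℕ → ℕ → (ℕ → ℝ) → X, (∀ i j, HasParamDeriv (F' j) i (F'' i j)) ∧
      ∀ i j, F'' i j = F'' j i) := by
  obtain ⟨G, hG⟩ := h
  refine ⟨fun j => G (Finsupp.single j 1), hG.hasParamDeriv, fun j => ⟨_, hG.shift j⟩, fun hn =>
    ⟨fun i j => G (Finsupp.single j 1 + Finsupp.single i 1), fun i j => ?_, fun i j => ?_⟩⟩
  · exact hG.2 _ (by simp [Finsupp.degree_single]; omega) i
  · simp only [add_comm]

lemma paramDiff_zero (F : (ℕ → ℝ) → X) : ParamDiff 0 F :=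
  ⟨fun _ => F, fun _ _ => rfl, fun _ h => absurd h (Nat.not_lt_zero _)⟩

lemma ParamDiff.add {n : ℕ} {F G : (ℕ → ℝ) → X} (hF : ParamDiff n F) (hG : ParamDiff n G) :
    ParamDiff n (fun y => F y + G y) := by
  obtain ⟨F', hF⟩ := hF
  obtain ⟨G', hG⟩ := hG
  exact ⟨fun ν y => F' ν y + G' ν y, fun y hy => by simp only [hF.1 y hy, hG.1 y hy],
    fun ν hν j => (hF.2 ν hν j).add (hG.2 ν hν j)⟩

lemma ParamDiff.sub {n : ℕ} {F G : (ℕ → ℝ) → X} (hF : ParamDiff n F) (hG : ParamDiff n G) :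
    ParamDiff n (fun y => F y - G y) := by
  obtain ⟨F', hF⟩ := hF
  obtain ⟨G', hG⟩ := hG
  exact ⟨fun ν y => F' ν y - G' ν y, fun y hy => by simp only [hF.1 y hy, hG.1 y hy],
    fun ν hν j => (hF.2 ν hν j).sub (hG.2 ν hν j)⟩

lemma ParamDiff.bilin (B : X →L[ℝ] Y →L[ℝ] Z) {n : ℕ} {F : (ℕ → ℝ) → X} {G : (ℕ → ℝ) → Y}
    (hF : ParamDiff n F) (hG : ParamDiff n G) : ParamDiff n (fun y => B (F y) (G y)) := by
  induction n generalizing F G with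
  | zero => exact paramDiff_zero _
  | succ n ih =>
    obtain ⟨F', hF1, hF2, hF3⟩ := hF.exists_deriv
    obtain ⟨G', hG1, hG2, hG3⟩ := hG.exists_deriv
    refine ParamDiff.glue (fun j => (hF1 j).bilin B (hG1 j)) (fun j =>
      (ih (hF2 j) (hG.mono n.le_succ)).add (ih (hF.mono n.le_succ) (hG2 j))) fun hn => ?_
    obtain ⟨F'', hF4, hF5⟩ := hF3 hn
    obtain ⟨G'', hG4, hG5⟩ := hG3 hn
    refine ⟨_, fun i j => ((hF4 i j).bilin B (hG1 i)).add ((hF1 i).bilin B (hG4 i j)),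
      fun i j y hy => ?_⟩
    simp only [hF5 i j, hG5 i j]
    abel

/-- The derivative of the solution of a linear equation `T(y) u(y) = F(y)`, where `T(y)` is
uniformly bounded below. -/
lemma HasParamDeriv.solve {T T' : (ℕ → ℝ) → X →L[ℝ] Z} {F F' : (ℕ → ℝ) → Z} {j : ℕ}
    {u u' : (ℕ → ℝ) → X} {τ : ℝ} (hτ : ∀ y ∈ paramSet, ∀ x, ‖x‖ ≤ τ * ‖T y x‖)
    (hT : HasParamDeriv T j T') (hF : HasParamDeriv F j F')
    (hu : ∀ y ∈ paramSet, T y (u y) = F y)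
    (hu' : ∀ y ∈ paramSet, T y (u' y) = F' y - T' y (u y)) : HasParamDeriv u j u' := by
  intro y hy
  have hTy := hT y hy
  have hFy := hF y hy
  have hcont : Filter.Tendsto (fun t => T (Function.update y j t) - T y)
      (𝓝[Icc (-(1 / 2) : ℝ) (1 / 2)] (y j)) (𝓝 0) := by
    have := hTy.continuousWithinAt.tendsto
    simp only [Function.update_eq_self] at this
    simpa using this.sub_const (T y)
  rw [hasDerivWithinAt_iff_isLittleO] at hTy hFy ⊢
  simp only [Function.update_eq_self] at hTy hFy ⊢
  have h1 : (fun t => (T (Function.update y j t) - T y - (t - y j) • T' y) (u y)) =o[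
      𝓝[Icc (-(1 / 2) : ℝ) (1 / 2)] (y j)] fun t => t - y j :=
    ((ContinuousLinearMap.apply ℝ Z (u y)).isBigO_comp _ _).trans_isLittleO hTy
  have h2 : (fun t => (t - y j) • (T (Function.update y j t) - T y) (u' y)) =o[
      𝓝[Icc (-(1 / 2) : ℝ) (1 / 2)] (y j)] fun t => t - y j := by
    have h3 : (fun t => (T (Function.update y j t) - T y) (u' y)) =o[
      𝓝[Icc (-(1 / 2) : ℝ) (1 / 2)] (y j)] fun _ => (1 : ℝ) := by
      rw [Asymptotics.isLittleO_one_iff]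
      have h4 := ((ContinuousLinearMap.apply ℝ Z (u' y)).continuous.tendsto 0).comp hcont
      rw [map_zero] at h4
      exact h4
    simpa using (Asymptotics.isBigO_refl (fun t : ℝ => t - y j) _).smul_isLittleO h3
  refine Asymptotics.IsBigO.trans_isLittleO ?_ ((hFy.sub h1).sub h2)
  refine Asymptotics.IsBigO.of_bound τ ?_
  filter_upwards [self_mem_nhdsWithin] with t ht
  have hm := update_mem_paramSet hy j ht
  refine (hτ _ hm _).trans (le_of_eq ?_)
  congr 2
  simp only [map_sub, map_smul, sub_apply, smul_apply,
    hu _ hm, hu _ hy, hu' _ hy, smul_sub]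
  abel

/-- The derivative of the solution solves an equation with the same operator and a right-hand side
that is as differentiable as required, so that induction on the order applies. -/
lemma ParamDiff.solve {T : (ℕ → ℝ) → X →L[ℝ] Z} {τ : ℝ}
    (hτ : ∀ y ∈ paramSet, ∀ x, ‖x‖ ≤ τ * ‖T y x‖)
    (hsurj : ∀ y ∈ paramSet, Function.Surjective (T y)) {n : ℕ} (hT : ParamDiff n T)
    {F : (ℕ → ℝ) → Z} (hF : ParamDiff n F) {u : (ℕ → ℝ) → X}
    (hu : ∀ y ∈ paramSet, T y (u y) = F y) : ParamDiff n u := by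
  classical
  have hS : ∀ R : (ℕ → ℝ) → Z, ∃ v : (ℕ → ℝ) → X, ∀ y ∈ paramSet, T y (v y) = R y := by
    intro R
    refine ⟨fun y => if h : y ∈ paramSet then (hsurj y h (R y)).choose else 0, fun y hy => ?_⟩
    simpa [dif_pos hy] using (hsurj y hy (R y)).choose_spec
  have hinj : ∀ y ∈ paramSet, ∀ x x', T y x = T y x' → x = x' := by
    intro y hy x x' h
    have := hτ y hy (x - x')
    rw [map_sub, h, sub_self, norm_zero, mul_zero] at this
    exact sub_eq_zero.1 (norm_le_zero_iff.1 this)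
  induction n generalizing F u with
  | zero => exact paramDiff_zero _
  | succ n ih =>
    obtain ⟨F', hF1, hF2, hF3⟩ := hF.exists_deriv
    obtain ⟨T', hT1, hT2, hT3⟩ := hT.exists_deriv
    have hun : ParamDiff n u := ih (hT.mono n.le_succ) (hF.mono n.le_succ) hu
    choose u' hu' using fun j => hS fun y => F' j y - T' j y (u y)
    have hd : ∀ j, HasParamDeriv u j (u' j) := fun j =>
      HasParamDeriv.solve hτ (hT1 j) (hF1 j) hu (hu' j)
    have hap : ∀ {T₁ T₁' : (ℕ → ℝ) → X →L[ℝ] Z} {v v' : (ℕ → ℝ) → X} {i : ℕ},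
        HasParamDeriv T₁ i T₁' → HasParamDeriv v i v' →
        HasParamDeriv (fun y => T₁ y (v y)) i (fun y => T₁' y (v y) + T₁ y (v' y)) :=
      fun h1 h2 => h1.bilin (ContinuousLinearMap.id ℝ (X →L[ℝ] Z)) h2
    refine ParamDiff.glue hd (fun j => ih (hT.mono n.le_succ) ?_ (hu' j)) fun hn => ?_
    · exact (hF2 j).sub ((hT2 j).bilin (ContinuousLinearMap.id ℝ (X →L[ℝ] Z)) hun)
    · obtain ⟨F'', hF4, hF5⟩ := hF3 hn
      obtain ⟨T'', hT4, hT5⟩ := hT3 hn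
      choose u'' hu'' using fun i j => hS fun y =>
        F'' i j y - (T'' i j y (u y) + T' j y (u' i y)) - T' i y (u' j y)
      refine ⟨u'', fun i j => HasParamDeriv.solve hτ (hT1 i)
        ((hF4 i j).sub (hap (hT4 i j) (hd i))) (hu' j) (hu'' i j), fun i j y hy => ?_⟩
      -- both second derivatives solve the same equation, which determines them
      apply hinj y hy
      rw [hu'' i j y hy, hu'' j i y hy, hF5 i j, hT5 i j]
      abel

/-- Derivatives of all finite orders form a single derivative family. -/
lemma exists_isParamDerivFamily {F : (ℕ → ℝ) → X} (h : ∀ n, ParamDiff n F) :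
    ∃ G, IsParamDerivFamily F G := by
  choose G hG using h
  refine ⟨fun ν => G (ν.degree + 1) ν, fun y hy => (hG _).1 y hy, fun ν j y hy => ?_⟩
  have h1 := (hG (ν.degree + 1)).2 ν (by omega) j
  refine (h1.congr (fun _ _ => rfl) ?_) y hy
  exact ((hG _).mono (by rw [degree_add_single]; omega)).eqOn (hG (ν.degree + 1))
    (fun _ _ => rfl) (by rw [degree_add_single])

end Basic

/-- The composition of a smooth map with a parametric map is as differentiable as the latter. -/
lemma ParamDiff.comp {E : Type} [NormedAddCommGroup E] [NormedSpace ℝ E] {Ω : Set E}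
    (hΩ : IsOpen Ω) {v : (ℕ → ℝ) → E} (hv : ∀ y ∈ paramSet, v y ∈ Ω) {n : ℕ}
    (hvn : ParamDiff n v) : ∀ {Y : Type} [NormedAddCommGroup Y] [NormedSpace ℝ Y] {f : E → Y},
    ContDiffOn ℝ ∞ f Ω → ParamDiff n (fun y => f (v y)) := by
  induction n with
  | zero => exact fun _ => paramDiff_zero _
  | succ n ih =>
    intro Y _ _ f hf
    obtain ⟨v', h1, h2, h3⟩ := hvn.exists_deriv
    have hcomp : ∀ {W : Type} [NormedAddCommGroup W] [NormedSpace ℝ W] {g : E → W},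
        ContDiffOn ℝ ∞ g Ω → ∀ j, HasParamDeriv (fun y => g (v y)) j
          (fun y => fderiv ℝ g (v y) (v' j y)) := by
      intro W _ _ g hg j y hy
      have hd : HasFDerivAt g (fderiv ℝ g (v y)) (v (Function.update y j (y j))) := by
        rw [Function.update_eq_self]
        exact ((hg.contDiffAt (hΩ.mem_nhds (hv y hy))).differentiableAt (by simp)).hasFDerivAt
      exact hd.comp_hasDerivWithinAt _ (h1 j y hy)
    have hf' : ContDiffOn ℝ ∞ (fderiv ℝ f) Ω := hf.fderiv_of_isOpen hΩ (by simp)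
    have hfn := ih (hvn.mono n.le_succ) hf'
    refine ParamDiff.glue (hcomp hf) (fun j => ?_) fun hn => ?_
    · exact hfn.bilin (ContinuousLinearMap.id ℝ (E →L[ℝ] Y)) (h2 j)
    · obtain ⟨v'', h4, h5⟩ := h3 hn
      refine ⟨_, fun i j => (hcomp hf' i).bilin (ContinuousLinearMap.id ℝ (E →L[ℝ] Y)) (h4 i j),
        fun i j y hy => ?_⟩
      have hs : IsSymmSndFDerivAt ℝ f (v y) :=
        (hf.contDiffAt (hΩ.mem_nhds (hv y hy))).isSymmSndFDerivAt
          (by simp only [minSmoothness_of_isRCLikeNormedField]; exact WithTop.coe_le_coe.2 le_top)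
      simp only [ContinuousLinearMap.coe_id', id_eq, h5 i j, hs.eq (v' i y) (v' j y)]

/-! ### The Leibniz formula and Gevrey bounds -/

/-- The multi-index of the partial derivative `∏_{i ∈ S} ∂_{w i}`. -/
noncomputable def wordIdx (w : ℕ → ℕ) (S : Finset ℕ) : ℕ →₀ ℕ := ∑ i ∈ S, Finsupp.single (w i) 1

lemma wordIdx_insert {w : ℕ → ℕ} {S : Finset ℕ} {a : ℕ} (ha : a ∉ S) :
    wordIdx w (insert a S) = wordIdx w S + Finsupp.single (w a) 1 := by
  rw [wordIdx, Finset.sum_insert ha, add_comm, wordIdx]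

lemma degree_wordIdx (w : ℕ → ℕ) (S : Finset ℕ) : (wordIdx w S).degree = S.card := by
  induction S using Finset.induction_on with
  | empty => simp [wordIdx]
  | insert a S ha ih => rw [wordIdx_insert ha, degree_add_single, ih, Finset.card_insert_of_notMem ha]

/-- Writing `∂^ν` as a product over a set of `|ν|` single differentiations replaces the multinomial
coefficients of the Leibniz formula by a sum over subsets. -/
lemma exists_eq_wordIdx (ν : ℕ →₀ ℕ) : ∃ w S, ν = wordIdx w S := by
  suffices h : ∀ n, ∀ ν : ℕ →₀ ℕ, ν.degree = n → ∃ w, ν = wordIdx w (Finset.range n) by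
    obtain ⟨w, hw⟩ := h _ ν rfl
    exact ⟨w, _, hw⟩
  intro n
  induction n with
  | zero => exact fun ν hν => ⟨id, by simpa [wordIdx] using (Finsupp.degree_eq_zero_iff ν).1 hν⟩
  | succ n ih =>
    intro ν hν
    obtain ⟨j, μ, rfl⟩ := exists_eq_add_single (ν := ν) (by rintro rfl; simp at hν)
    rw [degree_add_single] at hν
    obtain ⟨w, hw⟩ := ih μ (by omega)
    refine ⟨Function.update w n j, ?_⟩
    rw [Finset.range_add_one, wordIdx_insert (by simp), Function.update_self, hw]
    congr 1
    refine Finset.sum_congr rfl fun i hi => ?_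
    rw [Function.update_of_ne (by simp at hi; omega)]

lemma mpow_add (b : ℕ → ℝ) (μ ν : ℕ →₀ ℕ) : mpow b (μ + ν) = mpow b μ * mpow b ν :=
  Finsupp.prod_add_index' (by simp) (by simp [pow_add])

lemma mpow_nonneg {b : ℕ → ℝ} (hb : ∀ j, 0 ≤ b j) (ν : ℕ →₀ ℕ) : 0 ≤ mpow b ν :=
  Finset.prod_nonneg fun j _ => pow_nonneg (hb j) _

lemma wordIdx_add_sdiff (w : ℕ → ℕ) {S T : Finset ℕ} (h : T ⊆ S) :
    wordIdx w T + wordIdx w (S \ T) = wordIdx w S := by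
  rw [add_comm]
  exact Finset.sum_sdiff h

lemma factPow_pos (β : ℝ) (n : ℕ) : 0 < factPow β n :=
  Real.rpow_pos_of_pos (by exact_mod_cast n.factorial_pos) _

lemma factPow_nonneg (β : ℝ) (n : ℕ) : 0 ≤ factPow β n := (factPow_pos β n).le

lemma factPow_zero (β : ℝ) : factPow β 0 = 1 := by simp [factPow]

/-- Powers `β ≥ 1` of the factorial still absorb the binomial coefficients, which are at least
`1`. -/
lemma choose_mul_factPow_le {β : ℝ} (hβ : 1 ≤ β) {n k : ℕ} (hk : k ≤ n) :
    (n.choose k : ℝ) * (factPow β k * factPow β (n - k)) ≤ factPow β n := by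
  unfold factPow
  have h := Nat.choose_mul_factorial_mul_factorial hk
  have hc : (1 : ℝ) ≤ n.choose k := by exact_mod_cast Nat.choose_pos hk
  rw [← h, mul_assoc]
  push_cast
  rw [← Real.mul_rpow (by positivity) (by positivity),
    Real.mul_rpow (x := (n.choose k : ℝ)) (by positivity) (by positivity)]
  exact mul_le_mul_of_nonneg_right (Real.self_le_rpow_of_one_le hc hβ) (by positivity)

lemma succ_factorial_mul_succ_factorial_le (p r : ℕ) :
    (p + 1).factorial * (r + 1).factorial ≤ (p + r + 1).factorial := by
  induction r with
  | zero => simp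
  | succ r ih =>
    rw [Nat.factorial_succ (r + 1), show p + (r + 1) + 1 = (p + r + 1) + 1 by ring,
      Nat.factorial_succ (p + r + 1)]
    calc _ = (r + 1 + 1) * ((p + 1).factorial * (r + 1).factorial) := by ring
      _ ≤ _ := Nat.mul_le_mul (by omega) ih

lemma factorial_mul_factorial_add_le (l r a : ℕ) :
    (l + r).factorial * (l + a).factorial ≤ l.factorial * (l + r + a).factorial := by
  induction r with
  | zero => simp
  | succ r ih =>
    rw [show l + (r + 1) = (l + r) + 1 by ring, Nat.factorial_succ,
      show l + r + 1 + a = (l + r + a) + 1 by ring, Nat.factorial_succ (l + r + a)]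
    calc _ = (l + r + 1) * ((l + r).factorial * (l + a).factorial) := by ring
      _ ≤ (l + r + a + 1) * (l.factorial * (l + r + a).factorial) :=
        Nat.mul_le_mul (by omega) ih
      _ = _ := by ring

/-- Absorption of the binomial coefficient when one factor carries an additional derivative; the
loss is only the factor `n - l + 1`. -/
lemma choose_mul_factPow_succ_le {β : ℝ} (hβ : 1 ≤ β) {n l : ℕ} (a : ℕ) (hl : l ≤ n) :
    (n.choose l : ℝ) * (factPow β (l + (a + 1)) * factPow β (n - l + 1)) ≤
      ((n - l + 1 : ℕ) : ℝ) * factPow β (n + (a + 1)) := by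
  unfold factPow
  obtain ⟨r, rfl⟩ := Nat.exists_eq_add_of_le hl
  rw [Nat.add_sub_cancel_left, ← Real.mul_rpow (by positivity) (by positivity)]
  set A : ℝ := ((l + (a + 1)).factorial : ℝ) * ((r + 1).factorial : ℝ) with hA
  set N : ℝ := ((l + r + (a + 1)).factorial : ℝ) with hN
  have hA0 : 0 < A := by positivity
  have hN0 : 0 < N := by positivity
  have hAN : A ≤ N := by
    have := succ_factorial_mul_succ_factorial_le (l + a) r
    rw [hA, hN, show l + r + (a + 1) = l + a + r + 1 by ring]
    exact_mod_cast this
  have hcA : ((l + r).choose l : ℝ) * A ≤ ((r + 1 : ℕ) : ℝ) * N := by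
    have h1 := Nat.choose_mul_factorial_mul_factorial (Nat.le_add_right l r)
    rw [Nat.add_sub_cancel_left] at h1
    have h2 := factorial_mul_factorial_add_le l r (a + 1)
    rw [hA, hN]
    norm_cast
    refine Nat.le_of_mul_le_mul_left ?_ l.factorial_pos
    calc l.factorial * ((l + r).choose l * ((l + (a + 1)).factorial * (r + 1).factorial))
        = (r + 1) * (((l + r).choose l * l.factorial * r.factorial) * (l + (a + 1)).factorial) := by
          rw [Nat.factorial_succ r]; ring
      _ ≤ (r + 1) * (l.factorial * (l + r + (a + 1)).factorial) := by
          rw [h1]; exact Nat.mul_le_mul_left _ h2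
      _ = _ := by ring
  have e1 : A ^ β = A * A ^ (β - 1) := by
    rw [Real.rpow_sub_one hA0.ne']; field_simp
  have e2 : N ^ β = N * N ^ (β - 1) := by
    rw [Real.rpow_sub_one hN0.ne']; field_simp
  rw [e1, e2, ← mul_assoc ((l + r).choose l : ℝ), ← mul_assoc ((r + 1 : ℕ) : ℝ)]
  exact mul_le_mul hcA (Real.rpow_le_rpow hA0.le hAN (by linarith)) (by positivity) (by positivity)

lemma sq_mul_sum_arith_geom (q : ℝ) (n : ℕ) :
    (q - 1) ^ 2 * ∑ l ∈ Finset.range (n + 1), ((n - l + 1 : ℕ) : ℝ) * q ^ l =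
      q ^ (n + 2) - (n + 2) * q + (n + 1) := by
  induction n with
  | zero => simp; ring
  | succ n ih =>
    rw [Finset.sum_range_succ']
    have : ∑ k ∈ Finset.range (n + 1), ((n + 1 - (k + 1) + 1 : ℕ) : ℝ) * q ^ (k + 1) =
        q * ∑ l ∈ Finset.range (n + 1), ((n - l + 1 : ℕ) : ℝ) * q ^ l := by
      rw [Finset.mul_sum]
      refine Finset.sum_congr rfl fun k _ => ?_
      rw [Nat.add_sub_add_right]; ring
    rw [this, mul_add, mul_left_comm, ih]
    push_cast
    ring

/-- The recursion for the rate `R + 2` of a composition, where `R` is the product of the two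
rates. -/
lemma mul_sum_arith_geom_le {R : ℝ} (hR : 0 ≤ R) (n : ℕ) :
    R * ∑ l ∈ Finset.range (n + 1), ((n - l + 1 : ℕ) : ℝ) * (R + 2) ^ l ≤ (R + 2) ^ (n + 1) := by
  set s := ∑ l ∈ Finset.range (n + 1), ((n - l + 1 : ℕ) : ℝ) * (R + 2) ^ l with hs
  have h0 : 0 ≤ s := Finset.sum_nonneg fun _ _ => by positivity
  have h := sq_mul_sum_arith_geom (R + 2) n
  rw [← hs] at h
  refine le_of_mul_le_mul_left (a := R + 2) ?_ (by positivity)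
  have h1 : (R + 2) * (R * s) ≤ (R + 2 - 1) ^ 2 * s := by nlinarith
  refine h1.trans (h.le.trans ?_)
  rw [← pow_succ']
  have h2 : 0 ≤ (n : ℝ) * R := by positivity
  have h3 : (0 : ℝ) ≤ n := by positivity
  nlinarith

section

variable {X Y Z : Type*} [NormedAddCommGroup X] [NormedSpace ℝ X]
  [NormedAddCommGroup Y] [NormedSpace ℝ Y] [NormedAddCommGroup Z] [NormedSpace ℝ Z]

lemma IsParamDerivFamily.upTo {F : (ℕ → ℝ) → X} {G : (ℕ →₀ ℕ) → (ℕ → ℝ) → X}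
    (h : IsParamDerivFamily F G) (n : ℕ) : IsParamDerivFamilyUpTo n F G :=
  ⟨h.1, fun ν _ j => h.2 ν j⟩

lemma IsParamDerivFamily.shift {F : (ℕ → ℝ) → X} {G : (ℕ →₀ ℕ) → (ℕ → ℝ) → X}
    (h : IsParamDerivFamily F G) (j : ℕ) :
    IsParamDerivFamily (G (Finsupp.single j 1)) (fun ν => G (ν + Finsupp.single j 1)) :=
  ⟨((h.upTo 1).shift j).1, fun ν => ((h.upTo (ν.degree + 2)).shift j).2 ν (by omega)⟩

lemma IsParamDerivFamily.congr {F F₁ : (ℕ → ℝ) → X} {G : (ℕ →₀ ℕ) → (ℕ → ℝ) → X}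
    (h : IsParamDerivFamily F G) (hF : EqOn F₁ F paramSet) : IsParamDerivFamily F₁ G :=
  ⟨fun y hy => (h.1 y hy).trans (hF hy).symm, h.2⟩

lemma IsParamDerivFamily.clm {F : (ℕ → ℝ) → X} {G : (ℕ →₀ ℕ) → (ℕ → ℝ) → X}
    (L : X →L[ℝ] Y) (h : IsParamDerivFamily F G) :
    IsParamDerivFamily (fun y => L (F y)) (fun ν y => L (G ν y)) :=
  ⟨fun y hy => by simp only [h.1 y hy], fun ν j => HasParamDeriv.clm L (h.2 ν j)⟩

/-- The Leibniz formula, with the derivatives distributed over the two factors by the subsets of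
the set of differentiations. -/
lemma IsParamDerivFamily.leibniz (B : X →L[ℝ] Y →L[ℝ] Z) {F : (ℕ → ℝ) → X} {G : (ℕ → ℝ) → Y}
    {F' : (ℕ →₀ ℕ) → (ℕ → ℝ) → X} {G' : (ℕ →₀ ℕ) → (ℕ → ℝ) → Y} {H' : (ℕ →₀ ℕ) → (ℕ → ℝ) → Z}
    (hF : IsParamDerivFamily F F') (hG : IsParamDerivFamily G G')
    (hH : IsParamDerivFamily (fun y => B (F y) (G y)) H') (w : ℕ → ℕ) (S : Finset ℕ) :
    EqOn (H' (wordIdx w S))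
      (fun y => ∑ T ∈ S.powerset, B (F' (wordIdx w T) y) (G' (wordIdx w (S \ T)) y)) paramSet := by
  induction S using Finset.induction_on with
  | empty =>
    intro y hy
    simp [wordIdx, hF.1 y hy, hG.1 y hy, hH.1 y hy]
  | insert a S ha ih =>
    have h1 : HasParamDeriv (H' (wordIdx w S)) (w a) (H' (wordIdx w (insert a S))) := by
      rw [wordIdx_insert ha]
      exact hH.2 (wordIdx w S) (w a)
    have h2 := HasParamDeriv.sum (s := S.powerset) (j := w a) fun T _ =>
      HasParamDeriv.bilin B (hF.2 (wordIdx w T) (w a)) (hG.2 (wordIdx w (S \ T)) (w a))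
    have h3 := h1.unique (h2.congr ih (fun _ _ => rfl))
    intro y hy
    rw [h3 hy]
    simp only
    rw [Finset.sum_powerset_insert ha, Finset.sum_add_distrib, add_comm]
    congr 1
    · refine Finset.sum_congr rfl fun T hT => ?_
      have haT : a ∉ T := fun h => ha (Finset.mem_powerset.1 hT h)
      rw [Finset.insert_sdiff_of_notMem _ haT, wordIdx_insert (by simp [ha])]
    · refine Finset.sum_congr rfl fun T hT => ?_
      have haT : a ∉ T := fun h => ha (Finset.mem_powerset.1 hT h)
      rw [wordIdx_insert haT, Finset.insert_sdiff_insert, Finset.sdiff_insert_of_notMem ha]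

/-- Bound on the terms of the Leibniz formula in which the first factor is differentiated. Only
derivatives of the second factor of order less than `|ν|` occur. -/
lemma IsParamDerivFamily.norm_leibniz_sub_le {b : ℕ → ℝ} (B : X →L[ℝ] Y →L[ℝ] Z)
    (hB : ∀ x x', ‖B x x'‖ ≤ ‖x‖ * ‖x'‖) {F : (ℕ → ℝ) → X} {G : (ℕ → ℝ) → Y}
    {F' : (ℕ →₀ ℕ) → (ℕ → ℝ) → X} {G' : (ℕ →₀ ℕ) → (ℕ → ℝ) → Y} {H' : (ℕ →₀ ℕ) → (ℕ → ℝ) → Z}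
    (hF : IsParamDerivFamily F F') (hG : IsParamDerivFamily G G')
    (hH : IsParamDerivFamily (fun y => B (F y) (G y)) H') {P Q : ℕ → ℝ} {ν : ℕ →₀ ℕ}
    {y : ℕ → ℝ} (hy : y ∈ paramSet) (hP : ∀ μ, μ.degree ≤ ν.degree → ‖F' μ y‖ ≤ P μ.degree * mpow b μ)
    (hQ : ∀ μ, μ.degree < ν.degree → ‖G' μ y‖ ≤ Q μ.degree * mpow b μ) :
    ‖H' ν y - B (F' 0 y) (G' ν y)‖ ≤ (∑ k ∈ Finset.range ν.degree,
      (ν.degree.choose (k + 1) : ℝ) * (P (k + 1) * Q (ν.degree - (k + 1)))) * mpow b ν := by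
  classical
  obtain ⟨w, S, rfl⟩ := exists_eq_wordIdx ν
  rw [hF.leibniz B hG hH w S hy]
  simp only
  rw [← Finset.add_sum_erase _ _ (Finset.empty_mem_powerset S)]
  have h0 : wordIdx w ∅ = 0 := by simp [wordIdx]
  rw [h0, Finset.sdiff_empty, add_sub_cancel_left]
  set n := (wordIdx w S).degree with hn
  have hnS : n = S.card := degree_wordIdx w S
  let f : ℕ → ℝ := fun k => if k = 0 then 0 else P k * Q (n - k)
  have hle : ‖∑ T ∈ S.powerset.erase ∅, B (F' (wordIdx w T) y) (G' (wordIdx w (S \ T)) y)‖ ≤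
      ∑ T ∈ S.powerset.erase ∅, f T.card * mpow b (wordIdx w S) := by
    refine norm_sum_le_of_le _ fun T hT => ?_
    obtain ⟨hT0, hTS⟩ := Finset.mem_erase.1 hT
    rw [Finset.mem_powerset] at hTS
    have hTc : T.card ≠ 0 := by simpa using hT0
    have hTle := Finset.card_le_card hTS
    have hST : (wordIdx w (S \ T)).degree = n - T.card := by
      rw [degree_wordIdx, Finset.card_sdiff_of_subset hTS, hnS]
    have h1 := hP (wordIdx w T) (by rw [degree_wordIdx, hnS]; exact hTle)
    have h2 := hQ (wordIdx w (S \ T)) (by rw [hST]; omega)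
    rw [degree_wordIdx] at h1
    rw [hST] at h2
    simp only [f, if_neg hTc]
    calc _ ≤ _ := hB _ _
      _ ≤ _ := mul_le_mul h1 h2 (norm_nonneg _) ((norm_nonneg _).trans h1)
      _ = _ := by rw [← wordIdx_add_sdiff w hTS, mpow_add]; ring
  refine hle.trans (le_of_eq ?_)
  rw [← Finset.sum_mul]
  congr 1
  have h1 : ∑ T ∈ S.powerset.erase ∅, f T.card = ∑ T ∈ S.powerset, f T.card := by
    rw [← Finset.add_sum_erase _ _ (Finset.empty_mem_powerset S)]
    simp [f]
  rw [h1, Finset.sum_powerset_apply_card, Finset.sum_range_succ', ← hnS]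
  simp [f]

lemma IsParamDerivFamily.norm_leibniz_le {b : ℕ → ℝ} (B : X →L[ℝ] Y →L[ℝ] Z)
    (hB : ∀ x x', ‖B x x'‖ ≤ ‖x‖ * ‖x'‖) {F : (ℕ → ℝ) → X} {G : (ℕ → ℝ) → Y}
    {F' : (ℕ →₀ ℕ) → (ℕ → ℝ) → X} {G' : (ℕ →₀ ℕ) → (ℕ → ℝ) → Y} {H' : (ℕ →₀ ℕ) → (ℕ → ℝ) → Z}
    (hF : IsParamDerivFamily F F') (hG : IsParamDerivFamily G G')
    (hH : IsParamDerivFamily (fun y => B (F y) (G y)) H') {P Q : ℕ → ℝ} {ν : ℕ →₀ ℕ}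
    {y : ℕ → ℝ} (hy : y ∈ paramSet) (hP : ∀ μ, μ.degree ≤ ν.degree → ‖F' μ y‖ ≤ P μ.degree * mpow b μ)
    (hQ : ∀ μ, μ.degree ≤ ν.degree → ‖G' μ y‖ ≤ Q μ.degree * mpow b μ) :
    ‖H' ν y‖ ≤ (∑ k ∈ Finset.range (ν.degree + 1),
      (ν.degree.choose k : ℝ) * (P k * Q (ν.degree - k))) * mpow b ν := by
  have h1 := hF.norm_leibniz_sub_le B hB hG hH hy hP fun μ hμ => hQ μ hμ.le
  have h2 : ‖B (F' 0 y) (G' ν y)‖ ≤ P 0 * Q ν.degree * mpow b ν := by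
    have h3 := hP 0 (by simp)
    simp only [map_zero, mpow, Finsupp.prod_zero_index, mul_one] at h3
    calc _ ≤ _ := hB _ _
      _ ≤ _ := mul_le_mul h3 (hQ ν le_rfl) (norm_nonneg _) ((norm_nonneg _).trans h3)
      _ = _ := by ring
  rw [Finset.sum_range_succ', add_mul]
  have h4 := norm_add_le (H' ν y - B (F' 0 y) (G' ν y)) (B (F' 0 y) (G' ν y))
  rw [sub_add_cancel] at h4
  refine h4.trans (add_le_add h1 (h2.trans (le_of_eq ?_)))
  simp

/-- `F` is Gevrey regular of order `β` in the parameter, with constants `K` and `q`: all mixed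
partial derivatives exist and `‖∂_y^ν F‖ ≤ K q^|ν| (|ν|!)^β b^ν` on the parameter set. -/
def IsGevrey (b : ℕ → ℝ) (β K q : ℝ) (F : (ℕ → ℝ) → X) : Prop :=
  ∃ G, IsParamDerivFamily F G ∧ ∀ ν, ∀ y ∈ paramSet,
    ‖G ν y‖ ≤ K * q ^ ν.degree * factPow β ν.degree * mpow b ν

lemma IsGevrey.paramDiff {b : ℕ → ℝ} {β K q : ℝ} {F : (ℕ → ℝ) → X} (h : IsGevrey b β K q F)
    (n : ℕ) : ParamDiff n F := by
  obtain ⟨G, hG, -⟩ := h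
  exact ⟨G, hG.upTo n⟩

lemma sum_mul_pow_le {p q : ℝ} (hp : 0 ≤ p) (hq : 0 ≤ q) (n : ℕ) :
    ∑ k ∈ Finset.range (n + 1), p ^ k * q ^ (n - k) ≤ (p + q) ^ n := by
  rw [add_pow]
  refine Finset.sum_le_sum fun k hk => le_mul_of_one_le_right (by positivity) ?_
  exact_mod_cast Nat.choose_pos (by simp at hk; omega)

lemma IsGevrey.bilin {b : ℕ → ℝ} (hb : ∀ j, 0 ≤ b j) {β : ℝ} (hβ : 1 ≤ β)
    (B : X →L[ℝ] Y →L[ℝ] Z) (hB : ∀ x x', ‖B x x'‖ ≤ ‖x‖ * ‖x'‖) {F : (ℕ → ℝ) → X}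
    {G : (ℕ → ℝ) → Y} {K₁ K₂ q₁ q₂ : ℝ} (hK₁ : 0 ≤ K₁) (hK₂ : 0 ≤ K₂) (hq₁ : 0 ≤ q₁)
    (hq₂ : 0 ≤ q₂) (hF : IsGevrey b β K₁ q₁ F) (hG : IsGevrey b β K₂ q₂ G) :
    IsGevrey b β (K₁ * K₂) (q₁ + q₂) (fun y => B (F y) (G y)) := by
  obtain ⟨H', hH⟩ := exists_isParamDerivFamily fun n => (hF.paramDiff n).bilin B (hG.paramDiff n)
  obtain ⟨F', hF, hFb⟩ := hF
  obtain ⟨G', hG, hGb⟩ := hG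
  refine ⟨H', hH, fun ν y hy => ?_⟩
  refine (hF.norm_leibniz_le B hB hG hH hy
    (P := fun k => K₁ * q₁ ^ k * factPow β k) (Q := fun k => K₂ * q₂ ^ k * factPow β k)
    (fun μ _ => hFb μ y hy) (fun μ _ => hGb μ y hy)).trans ?_
  refine mul_le_mul_of_nonneg_right ?_ (mpow_nonneg hb ν)
  set n := ν.degree
  calc _ ≤ ∑ k ∈ Finset.range (n + 1), K₁ * K₂ * (q₁ ^ k * q₂ ^ (n - k)) * factPow β n := by
        refine Finset.sum_le_sum fun k hk => ?_
        have h := choose_mul_factPow_le hβ (n := n) (k := k) (by simp at hk; omega)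
        have h0 : 0 ≤ K₁ * K₂ * (q₁ ^ k * q₂ ^ (n - k)) := by positivity
        calc _ = K₁ * K₂ * (q₁ ^ k * q₂ ^ (n - k)) *
              (n.choose k * (factPow β k * factPow β (n - k))) := by ring
          _ ≤ _ := mul_le_mul_of_nonneg_left h h0
    _ = K₁ * K₂ * (∑ k ∈ Finset.range (n + 1), q₁ ^ k * q₂ ^ (n - k)) * factPow β n := by
        rw [Finset.mul_sum, Finset.sum_mul]
    _ ≤ _ := by
        have := sum_mul_pow_le hq₁ hq₂ n
        have h0 := factPow_nonneg β n
        gcongr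

lemma IsGevrey.clm {b : ℕ → ℝ} {β K q : ℝ}
    {F : (ℕ → ℝ) → X} (L : X →L[ℝ] Y) {c : ℝ} (hL : ∀ x, ‖L x‖ ≤ c * ‖x‖) (hc : 0 ≤ c)
    (h : IsGevrey b β K q F) : IsGevrey b β (c * K) q (fun y => L (F y)) := by
  obtain ⟨G, hG, hGb⟩ := h
  refine ⟨_, hG.clm L, fun ν y hy => (hL _).trans ?_⟩
  rw [mul_assoc c, mul_assoc c, mul_assoc c]
  exact mul_le_mul_of_nonneg_left (hGb ν y hy) hc

lemma IsGevrey.congr {b : ℕ → ℝ} {β K q : ℝ} {F F₁ : (ℕ → ℝ) → X} (h : IsGevrey b β K q F)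
    (hF : EqOn F₁ F paramSet) : IsGevrey b β K q F₁ := by
  obtain ⟨G, hG, hGb⟩ := h
  exact ⟨G, hG.congr hF, hGb⟩

/-- The recursion for the bounds on the derivatives of the solution of a linear equation. -/
lemma pow_add_sum_le {q s S : ℝ} (hq : 0 ≤ q) (hs : 0 ≤ s) (hS : 0 ≤ S) (n : ℕ) :
    s ^ n + S * ∑ k ∈ Finset.range n, q ^ (k + 1) * (s + (1 + S) * q) ^ (n - (k + 1)) ≤
      (s + (1 + S) * q) ^ n := by
  set Q := s + (1 + S) * q with hQ
  have hQ0 : 0 ≤ Q := by positivity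
  have hsQ : s ≤ Q := by rw [hQ]; have : 0 ≤ (1 + S) * q := by positivity
                         linarith
  induction n with
  | zero => simp
  | succ n ih =>
    rw [Finset.sum_range_succ']
    have e : ∑ k ∈ Finset.range n, q ^ (k + 1 + 1) * Q ^ (n + 1 - (k + 1 + 1)) =
        q * ∑ k ∈ Finset.range n, q ^ (k + 1) * Q ^ (n - (k + 1)) := by
      rw [Finset.mul_sum]
      refine Finset.sum_congr rfl fun k _ => ?_
      rw [Nat.add_sub_add_right]; ring
    rw [e]
    set E := ∑ k ∈ Finset.range n, q ^ (k + 1) * Q ^ (n - (k + 1)) with hE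
    have hE0 : 0 ≤ E := Finset.sum_nonneg fun _ _ => by positivity
    have h1 : s ^ n ≤ Q ^ n := pow_le_pow_left₀ hs hsQ n
    have h2 : S * E ≤ Q ^ n := by have : 0 ≤ s ^ n := by positivity
                                  linarith
    have h3 := mul_le_mul_of_nonneg_left h1 hs
    have h4 := mul_le_mul_of_nonneg_left h2 hq
    have h5 : Q ^ (n + 1) = s * Q ^ n + q * Q ^ n + q * S * Q ^ n := by rw [pow_succ', hQ]; ring
    rw [h5]
    simp only [zero_add, pow_one, Nat.add_sub_cancel]
    rw [pow_succ']
    linarith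

/-- Gevrey regularity of the solution of a linear equation `T(y) u(y) = F(y)` with Gevrey regular
data. -/
lemma IsGevrey.solve {b : ℕ → ℝ} (hb : ∀ j, 0 ≤ b j) {β : ℝ} (hβ : 1 ≤ β)
    {T : (ℕ → ℝ) → X →L[ℝ] Z} {τ : ℝ} (hτ0 : 0 ≤ τ)
    (hτ : ∀ y ∈ paramSet, ∀ x, ‖x‖ ≤ τ * ‖T y x‖)
    (hsurj : ∀ y ∈ paramSet, Function.Surjective (T y)) {F : (ℕ → ℝ) → Z} {u : (ℕ → ℝ) → X}
    (hu : ∀ y ∈ paramSet, T y (u y) = F y) {a g q s : ℝ} (ha : 0 ≤ a) (hg : 0 ≤ g) (hq : 0 ≤ q)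
    (hs : 0 ≤ s) (hT : IsGevrey b β a q T) (hF : IsGevrey b β g s F) :
    IsGevrey b β (τ * g) (s + (1 + τ * a) * q) u := by
  obtain ⟨u', hu'⟩ := exists_isParamDerivFamily fun n =>
    ParamDiff.solve hτ hsurj (hT.paramDiff n) (hF.paramDiff n) hu
  obtain ⟨T', hT', hTb⟩ := hT
  obtain ⟨F', hF', hFb⟩ := hF
  refine ⟨u', hu', fun ν y hy => ?_⟩
  induction hn : ν.degree using Nat.strong_induction_on generalizing ν with
  | _ n ih =>
    set Q := s + (1 + τ * a) * q with hQ
    have hQ0 : 0 ≤ Q := by positivity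
    -- the Leibniz formula for `T(y) u(y) = F(y)`, with the term `T(y) ∂^ν u(y)` isolated
    have hH : IsParamDerivFamily (fun y => ContinuousLinearMap.id ℝ (X →L[ℝ] Z) (T y) (u y)) F' :=
      hF'.congr fun y hy => hu y hy
    have h1 := hT'.norm_leibniz_sub_le (b := b) (ContinuousLinearMap.id ℝ (X →L[ℝ] Z))
      (fun A x => A.le_opNorm x) hu' hH (ν := ν) hy
      (P := fun k => a * q ^ k * factPow β k) (Q := fun k => τ * g * Q ^ k * factPow β k)
      (fun μ _ => hTb μ y hy) (fun μ hμ => ih μ.degree (hn ▸ hμ) μ rfl)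
    rw [hn] at h1
    simp only [ContinuousLinearMap.coe_id', id_eq, hT'.1 y hy] at h1
    have h2 := hFb ν y hy
    rw [hn] at h2
    have h3 : ‖T y (u' ν y)‖ ≤ ‖F' ν y‖ + ‖F' ν y - T y (u' ν y)‖ := by
      have := norm_sub_le (F' ν y) (F' ν y - T y (u' ν y))
      rwa [sub_sub_cancel] at this
    have hsum : ∑ k ∈ Finset.range n, (n.choose (k + 1) : ℝ) *
        (a * q ^ (k + 1) * factPow β (k + 1) *
          (τ * g * Q ^ (n - (k + 1)) * factPow β (n - (k + 1)))) ≤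
        g * (τ * a * ∑ k ∈ Finset.range n, q ^ (k + 1) * Q ^ (n - (k + 1))) * factPow β n := by
      rw [Finset.mul_sum, Finset.mul_sum, Finset.sum_mul]
      refine Finset.sum_le_sum fun k hk => ?_
      have h := choose_mul_factPow_le hβ (n := n) (k := k + 1) (by simp at hk; omega)
      have h0 : 0 ≤ g * (τ * a * (q ^ (k + 1) * Q ^ (n - (k + 1)))) := by positivity
      calc _ = g * (τ * a * (q ^ (k + 1) * Q ^ (n - (k + 1)))) *
            (n.choose (k + 1) * (factPow β (k + 1) * factPow β (n - (k + 1)))) := by ring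
        _ ≤ _ := mul_le_mul_of_nonneg_left h h0
    have h4 := mul_le_mul_of_nonneg_right hsum (mpow_nonneg hb ν)
    have h5 := pow_add_sum_le hq hs (mul_nonneg hτ0 ha) n
    rw [← hQ] at h5
    have h6 : 0 ≤ g * factPow β n * mpow b ν :=
      mul_nonneg (mul_nonneg hg (factPow_nonneg _ _)) (mpow_nonneg hb ν)
    have h7 := mul_le_mul_of_nonneg_left h5 h6
    calc ‖u' ν y‖ ≤ τ * ‖T y (u' ν y)‖ := hτ y hy _
      _ ≤ τ * (g * factPow β n * mpow b ν * Q ^ n) := by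
        refine mul_le_mul_of_nonneg_left ?_ hτ0
        linarith
      _ = _ := by ring

end

/-- Gevrey bounds for a composition `f ∘ v`, from factorial bounds for the derivatives of `f`. The
offset `a` in the hypothesis makes the induction over the order of differentiation possible, as
`∂_j (f ∘ v) = (Df ∘ v) ∂_j v`. -/
lemma norm_comp_family_le {E : Type} [NormedAddCommGroup E] [NormedSpace ℝ E] {Ω : Set E}
    (hΩ : IsOpen Ω) {b : ℕ → ℝ} (hb : ∀ j, 0 ≤ b j) {β : ℝ} (hβ : 1 ≤ β) {v : (ℕ → ℝ) → E}
    {v' : (ℕ →₀ ℕ) → (ℕ → ℝ) → E} (hv : ∀ y ∈ paramSet, v y ∈ Ω) (hv' : IsParamDerivFamily v v')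
    {C ϱ : ℝ} (hC : 0 ≤ C) (hϱ : 0 ≤ ϱ)
    (hvb : ∀ ν, ∀ y ∈ paramSet, ‖v' ν y‖ ≤ C * factPow β ν.degree * mpow b ν) (n : ℕ) :
    ∀ {Y : Type} [NormedAddCommGroup Y] [NormedSpace ℝ Y] {f : E → Y} {K : ℝ} {a : ℕ}
      {H : (ℕ →₀ ℕ) → (ℕ → ℝ) → Y}, ContDiffOn ℝ ∞ f Ω → 0 ≤ K →
      (∀ y ∈ paramSet, ∀ m, ‖iteratedFDeriv ℝ m f (v y)‖ ≤ K * factPow β (m + a) * ϱ ^ m) →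
      IsParamDerivFamily (fun y => f (v y)) H → ∀ ν : ℕ →₀ ℕ, ν.degree = n → ∀ y ∈ paramSet,
      ‖H ν y‖ ≤ K * factPow β (n + a) * (C * ϱ + 2) ^ n * mpow b ν := by
  induction n using Nat.strong_induction_on with
  | _ n ih =>
    intro Y _ _ f K a H hf hK hfb hH ν hν y hy
    rcases n with _ | n
    · obtain rfl : ν = 0 := (Finsupp.degree_eq_zero_iff ν).1 hν
      rw [hH.1 y hy]
      simpa [mpow] using hfb y hy 0
    · obtain ⟨j, μ, rfl⟩ := exists_eq_add_single (ν := ν) (by rintro rfl; simp at hν)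
      rw [degree_add_single] at hν
      have hμ : μ.degree = n := by omega
      have hf' : ContDiffOn ℝ ∞ (fderiv ℝ f) Ω := hf.fderiv_of_isOpen hΩ (by simp)
      obtain ⟨W, hW⟩ := exists_isParamDerivFamily fun m =>
        ParamDiff.comp hΩ hv (n := m) ⟨v', hv'.upTo m⟩ hf'
      have hfb' : ∀ y ∈ paramSet, ∀ m, ‖iteratedFDeriv ℝ m (fderiv ℝ f) (v y)‖ ≤
          K * ϱ * factPow β (m + (a + 1)) * ϱ ^ m := by
        intro y hy m
        rw [norm_iteratedFDeriv_fderiv]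
        refine (hfb y hy (m + 1)).trans (le_of_eq ?_)
        rw [add_assoc, add_comm 1 a, pow_succ]; ring
      -- the chain rule for one derivative; the remaining `n` fall on the product
      have hHj : IsParamDerivFamily
          (fun y => ContinuousLinearMap.id ℝ (E →L[ℝ] Y) (fderiv ℝ f (v y))
            (v' (Finsupp.single j 1) y)) (fun ν => H (ν + Finsupp.single j 1)) := by
        refine (hH.shift j).congr ?_
        have h1 : HasParamDeriv (fun y => f (v y)) j
            (fun y => fderiv ℝ f (v y) (v' (Finsupp.single j 1) y)) := by
          intro y hy
          have hd : HasFDerivAt f (fderiv ℝ f (v y)) (v (Function.update y j (y j))) := by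
            rw [Function.update_eq_self]
            exact ((hf.contDiffAt (hΩ.mem_nhds (hv y hy))).differentiableAt (by simp)).hasFDerivAt
          exact hd.comp_hasDerivWithinAt _ ((hv'.upTo 1).hasParamDeriv j y hy)
        exact h1.unique ((hH.upTo 1).hasParamDeriv j)
      set q := C * ϱ + 2 with hq
      have hq0 : 0 ≤ q := by positivity
      -- the derivatives of `Df ∘ v` of order at most `n` are bounded by induction
      have h2 := hW.norm_leibniz_le (b := b) (ContinuousLinearMap.id ℝ (E →L[ℝ] Y))
        (fun A x => A.le_opNorm x) (hv'.shift j) hHj (ν := μ) hy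
        (P := fun k => K * ϱ * factPow β (k + (a + 1)) * q ^ k)
        (Q := fun k => C * factPow β (k + 1) * b j)
        (fun κ hκ => ih κ.degree (by omega) hf' (by positivity) hfb' hW κ rfl y hy)
        (fun κ _ => by
          refine (hvb _ y hy).trans (le_of_eq ?_)
          rw [degree_add_single, mpow_add]
          rw [show mpow b (Finsupp.single j 1) = b j by simp [mpow]]
          ring)
      rw [hμ] at h2
      refine h2.trans ?_
      rw [mpow_add, ← mul_assoc, mul_right_comm]
      refine mul_le_mul_of_nonneg_right ?_ (mpow_nonneg hb μ)
      have hbj : mpow b (Finsupp.single j 1) = b j := by simp [mpow]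
      have h3 := mul_sum_arith_geom_le (mul_nonneg hC hϱ) n
      rw [← hq] at h3
      have h0 : 0 ≤ K * factPow β (n + (a + 1)) * b j :=
        mul_nonneg (mul_nonneg hK (factPow_nonneg _ _)) (hb j)
      calc _ ≤ ∑ k ∈ Finset.range (n + 1), K * factPow β (n + (a + 1)) * b j *
            (C * ϱ * (((n - k + 1 : ℕ) : ℝ) * q ^ k)) := by
            refine Finset.sum_le_sum fun k hk => ?_
            have h := choose_mul_factPow_succ_le hβ a (n := n) (l := k) (by simp at hk; omega)
            have h4 : 0 ≤ K * b j * (C * ϱ * q ^ k) :=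
              mul_nonneg (mul_nonneg hK (hb j)) (by positivity)
            calc _ = K * b j * (C * ϱ * q ^ k) * ((n.choose k : ℝ) *
                  (factPow β (k + (a + 1)) * factPow β (n - k + 1))) := by ring
              _ ≤ _ := mul_le_mul_of_nonneg_left h h4
              _ = _ := by ring
        _ = K * factPow β (n + (a + 1)) * b j *
            (C * ϱ * ∑ k ∈ Finset.range (n + 1), ((n - k + 1 : ℕ) : ℝ) * q ^ k) := by
            rw [Finset.mul_sum, Finset.mul_sum]
        _ ≤ K * factPow β (n + (a + 1)) * b j * q ^ (n + 1) := mul_le_mul_of_nonneg_left h3 h0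
        _ = _ := by rw [hbj, show n + 1 + a = n + (a + 1) by ring]; ring

/-- A smooth map whose derivatives satisfy factorial bounds preserves Gevrey regularity. -/
lemma IsGevrey.comp {E : Type} [NormedAddCommGroup E] [NormedSpace ℝ E] {Ω : Set E}
    (hΩ : IsOpen Ω) {b : ℕ → ℝ} (hb : ∀ j, 0 ≤ b j) {β : ℝ} (hβ : 1 ≤ β) {v : (ℕ → ℝ) → E}
    (hv : ∀ y ∈ paramSet, v y ∈ Ω) {C ϱ : ℝ} (hC : 0 ≤ C) (hϱ : 0 ≤ ϱ)
    (hvg : IsGevrey b β C 1 v) {Y : Type} [NormedAddCommGroup Y] [NormedSpace ℝ Y] {f : E → Y}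
    {K : ℝ} (hf : ContDiffOn ℝ ∞ f Ω) (hK : 0 ≤ K)
    (hfb : ∀ y ∈ paramSet, ∀ m, ‖iteratedFDeriv ℝ m f (v y)‖ ≤ K * factPow β m * ϱ ^ m) :
    IsGevrey b β K (C * ϱ + 2) (fun y => f (v y)) := by
  obtain ⟨H, hH⟩ := exists_isParamDerivFamily fun n => ParamDiff.comp hΩ hv (hvg.paramDiff n) hf
  obtain ⟨v', hv', hvb⟩ := hvg
  refine ⟨H, hH, fun ν y hy => ?_⟩
  refine (norm_comp_family_le hΩ hb hβ hv hv' hC hϱ (fun ν y hy => ?_) _ (a := 0) hf hK hfb hH ν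
    rfl y hy).trans (le_of_eq (by rw [add_zero]; ring))
  simpa using hvb ν y hy

lemma IsGevrey.const {X : Type*} [NormedAddCommGroup X] [NormedSpace ℝ X] {b : ℕ → ℝ} (β : ℝ)
    {K : ℝ} {x : X} (hx : ‖x‖ ≤ K) : IsGevrey b β K 0 (fun _ => x) := by
  refine ⟨fun ν _ => if ν = 0 then x else 0, ⟨fun y _ => by simp, fun ν j y _ => ?_⟩, fun ν y _ => ?_⟩
  · have h0 : ν + Finsupp.single j 1 ≠ 0 := by
      intro h; have := degree_add_single ν j; rw [h] at this; simp at this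
    simpa [h0] using hasDerivWithinAt_const _ _ _
  · by_cases h : ν = 0
    · subst h; simpa [factPow, mpow] using hx
    · have : ν.degree ≠ 0 := by rwa [Ne, Finsupp.degree_eq_zero_iff]
      simp [h, this]

/-! ### Spatial regularity of the parameter derivatives of the field -/

lemma norm_taylor_two_le {E : Type*} [NormedAddCommGroup E] [NormedSpace ℝ E] {l r : ℝ}
    {g g' g'' : ℝ → E} {K : ℝ}
    (h : ∀ t ∈ Icc l r, HasDerivWithinAt g (g' t) (Icc l r) t)
    (h' : ∀ t ∈ Icc l r, HasDerivWithinAt g' (g'' t) (Icc l r) t)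
    (hK : ∀ t ∈ Icc l r, ‖g'' t‖ ≤ K) {s t : ℝ} (hs : s ∈ Icc l r) (ht : t ∈ Icc l r) :
    ‖g t - g s - (t - s) • g' s‖ ≤ K * |t - s| ^ 2 := by
  have hsub : uIcc s t ⊆ Icc l r := uIcc_subset_Icc hs ht
  have hd : ∀ x ∈ uIcc s t, HasDerivWithinAt (fun x => g x - (x - s) • g' s) (g' x - g' s)
      (uIcc s t) x := by
    intro x hx
    have h1 := (h x (hsub hx)).mono hsub
    have h2 : HasDerivWithinAt (fun x : ℝ => (x - s) • g' s) ((1 : ℝ) • g' s) (uIcc s t) x :=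
      ((hasDerivWithinAt_id x _).sub_const s).smul_const _
    rw [one_smul] at h2
    exact h1.sub h2
  have hb : ∀ x ∈ uIcc s t, ‖g' x - g' s‖ ≤ K * |t - s| := by
    intro x hx
    have h1 := (convex_Icc l r).norm_image_sub_le_of_norm_hasDerivWithin_le h' hK hs (hsub hx)
    refine h1.trans ?_
    have hK0 : 0 ≤ K := (norm_nonneg _).trans (hK s hs)
    rw [Real.norm_eq_abs]
    exact mul_le_mul_of_nonneg_left (abs_sub_left_of_mem_uIcc hx) hK0
  have h3 := (convex_uIcc s t).norm_image_sub_le_of_norm_hasDerivWithin_le hd hb left_mem_uIcc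
    right_mem_uIcc
  rw [Real.norm_eq_abs] at h3
  calc ‖g t - g s - (t - s) • g' s‖ = ‖g t - (t - s) • g' s - (g s - (s - s) • g' s)‖ := by
        congr 1; rw [sub_self, zero_smul]; abel
    _ ≤ _ := h3
    _ = _ := by ring

lemma ae_forall_mem_Icc_norm_le {α E : Type*} [MeasurableSpace α] {μ : Measure α}
    [NormedAddCommGroup E] {l r B : ℝ} {g : ℝ → α → E}
    (hB : ∀ t ∈ Icc l r, ∀ᵐ x ∂μ, ‖g t x‖ ≤ B)
    (hc : ∀ᵐ x ∂μ, ContinuousOn (fun t => g t x) (Icc l r)) :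
    ∀ᵐ x ∂μ, ∀ t ∈ Icc l r, ‖g t x‖ ≤ B := by
  obtain ⟨s, hsI, hsc, hsd⟩ :=
    (TopologicalSpace.IsSeparable.of_separableSpace (Icc l r)).exists_countable_dense_subset
  have h1 : ∀ᵐ x ∂μ, ∀ t ∈ s, ‖g t x‖ ≤ B := (ae_ball_iff hsc).2 fun t ht => hB t (hsI ht)
  filter_upwards [h1, hc] with x hx hcx t ht
  have hne : (𝓝[s] t).NeBot := mem_closure_iff_nhdsWithin_neBot.1 (hsd ht)
  exact le_of_tendsto ((hcx t ht).mono hsI).norm.tendsto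
    (Filter.eventually_of_mem self_mem_nhdsWithin hx)

/-- Differentiation under the integral sign, one-sided at the end points of an interval. -/
lemma hasDerivWithinAt_integral_Icc {α : Type*} [MeasurableSpace α] {μ : Measure α} {l r : ℝ}
    {g g' : ℝ → α → ℝ} {bound : α → ℝ} (hint : ∀ t ∈ Icc l r, Integrable (g t) μ)
    (hder : ∀ᵐ x ∂μ, ∀ t ∈ Icc l r, HasDerivWithinAt (fun t => g t x) (g' t x) (Icc l r) t)
    (hb : ∀ᵐ x ∂μ, ∀ t ∈ Icc l r, ‖g' t x‖ ≤ bound x) (hbi : Integrable bound μ) {s : ℝ}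
    (hs : s ∈ Icc l r) :
    HasDerivWithinAt (fun t => ∫ x, g t x ∂μ) (∫ x, g' s x ∂μ) (Icc l r) s := by
  rw [hasDerivWithinAt_iff_tendsto_slope]
  have hslope : ∀ t ∈ Icc l r \ {s}, ∫ x, slope (fun t => g t x) s t ∂μ =
      slope (fun t => ∫ x, g t x ∂μ) s t := by
    intro t ht
    simp only [slope_def_field]
    rw [integral_div, integral_sub (hint t ht.1) (hint s hs)]
  refine Filter.Tendsto.congr' (Filter.eventually_of_mem self_mem_nhdsWithin hslope) ?_
  refine tendsto_integral_filter_of_dominated_convergence bound ?_ ?_ hbi ?_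
  · refine Filter.eventually_of_mem self_mem_nhdsWithin fun t ht => ?_
    simp only [slope_def_field]
    exact (((hint t ht.1).sub (hint s hs)).div_const _).aestronglyMeasurable
  · refine Filter.eventually_of_mem self_mem_nhdsWithin fun t ht => ?_
    filter_upwards [hder, hb] with x hx hbx
    have h1 := (convex_Icc l r).norm_image_sub_le_of_norm_hasDerivWithin_le hx hbx hs ht.1
    have h2 : 0 < ‖t - s‖ := norm_pos_iff.2 (sub_ne_zero.2 ht.2)
    rw [slope_def_field, norm_div, div_le_iff₀ h2]
    exact h1
  · filter_upwards [hder] with x hx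
    exact hasDerivWithinAt_iff_tendsto_slope.1 (hx s hs)

section

variable {d : ℕ} {D : Set (Euc d)}

/-- The weak Jacobian of `g` is bounded by `B`, expressed by duality. -/
def WeakJacobianBound (D : Set (Euc d)) (g : Euc d → Euc d) (B : ℝ) : Prop :=
  ∀ φ, IsTestFunction D φ → ∀ w z : Euc d,
    |∫ x in D, fderiv ℝ φ x w * inner ℝ (g x) z| ≤ B * ‖w‖ * ‖z‖ * ∫ x in D, |φ x|

lemma IsTestFunction.continuous_fderiv {φ : Euc d → ℝ} (hφ : IsTestFunction D φ) (w : Euc d) :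
    Continuous fun x => fderiv ℝ φ x w :=
  (hφ.1.continuous_fderiv (by simp)).clm_apply continuous_const

lemma IsTestFunction.exists_bound_fderiv {φ : Euc d → ℝ} (hφ : IsTestFunction D φ) (w : Euc d) :
    ∃ c, 0 ≤ c ∧ ∀ x, |fderiv ℝ φ x w| ≤ c := by
  obtain ⟨c, hc⟩ := (hφ.2.1.fderiv_apply (𝕜 := ℝ) w).exists_bound_of_continuous
    (hφ.continuous_fderiv w)
  exact ⟨c, (norm_nonneg _).trans (hc 0), hc⟩

lemma IsTestFunction.exists_bound {φ : Euc d → ℝ} (hφ : IsTestFunction D φ) :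
    ∃ c, 0 ≤ c ∧ ∀ x, |φ x| ≤ c := by
  obtain ⟨c, hc⟩ := hφ.2.1.exists_bound_of_continuous hφ.1.continuous
  exact ⟨c, (norm_nonneg _).trans (hc 0), hc⟩

lemma IsTestFunction.integrable_abs {φ : Euc d → ℝ} (hφ : IsTestFunction D φ) :
    IntegrableOn (fun x => |φ x|) D :=
  (hφ.1.continuous.integrable_of_hasCompactSupport hφ.2.1).abs.integrableOn

lemma isFiniteMeasure_restrict (hDb : Bornology.IsBounded D) :
    IsFiniteMeasure (volume.restrict D) :=
  ⟨by simpa using hDb.measure_lt_top⟩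

lemma W1InfNormLE.weakJacobianBound (hDb : Bornology.IsBounded D) {v : Euc d → Euc d} {B : ℝ}
    (h : W1InfNormLE D v B) : WeakJacobianBound D v B := by
  intro φ hφ w z
  have := isFiniteMeasure_restrict hDb
  obtain ⟨hvm, hvb, M, hMm, hMb, hM⟩ := h
  obtain ⟨c, hc0, hc⟩ := hφ.exists_bound_fderiv w
  obtain ⟨c', hc0', hc'⟩ := hφ.exists_bound
  have hi1 : Integrable (fun x => (fderiv ℝ φ x w) • v x) (volume.restrict D) := by
    refine Integrable.of_bound ((hφ.continuous_fderiv w).aestronglyMeasurable.smul hvm) (c * B) ?_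
    filter_upwards [hvb] with x hx
    rw [norm_smul]
    exact mul_le_mul (hc x) hx (norm_nonneg _) hc0
  have hMw : AEStronglyMeasurable (fun x => M x w) (volume.restrict D) :=
    (ContinuousLinearMap.apply ℝ (Euc d) w).continuous.comp_aestronglyMeasurable hMm
  have hi2 : Integrable (fun x => φ x • M x w) (volume.restrict D) := by
    refine Integrable.of_bound (hφ.1.continuous.aestronglyMeasurable.smul hMw) (c' * (B * ‖w‖)) ?_
    filter_upwards [hMb] with x hx
    rw [norm_smul]
    exact mul_le_mul (hc' x) ((M x).le_of_opNorm_le hx w) (norm_nonneg _) hc0'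
  have e : ∫ x in D, fderiv ℝ φ x w * inner ℝ (v x) z = - ∫ x in D, φ x * inner ℝ (M x w) z := by
    have e1 := integral_inner (𝕜 := ℝ) hi1 z
    have e2 := integral_inner (𝕜 := ℝ) hi2 z
    rw [hM φ hφ w, inner_neg_right, ← e2] at e1
    simp only [inner_smul_right] at e1
    simp only [real_inner_comm z] at e1 ⊢
    exact e1
  rw [e, abs_neg, ← integral_const_mul]
  refine (abs_integral_le_integral_abs).trans (integral_mono_ae ?_ ?_ ?_)
  · have := (hi2.inner_const (𝕜 := ℝ) z).abs
    simpa [inner_smul_left] using this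
  · exact hφ.integrable_abs.const_mul _
  · filter_upwards [hMb] with x hx
    rw [abs_mul, mul_comm]
    refine mul_le_mul_of_nonneg_right ?_ (abs_nonneg _)
    exact (abs_real_inner_le_norm _ _).trans
      (mul_le_mul_of_nonneg_right ((M x).le_of_opNorm_le hx w) (norm_nonneg _))

lemma integral_fderiv_apply_eq_zero {ψ : Euc d → ℝ} (hψ : ContDiff ℝ 1 ψ)
    (hc : HasCompactSupport ψ) (w : Euc d) : ∫ x, fderiv ℝ ψ x w = 0 := by
  have hcont : Continuous fun x => fderiv ℝ ψ x w :=
    (hψ.continuous_fderiv (by simp)).clm_apply continuous_const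
  have h1 : Integrable fun x => fderiv ℝ ψ x w :=
    hcont.integrable_of_hasCompactSupport (hc.fderiv_apply (𝕜 := ℝ) w)
  have h2 : Integrable ψ := hψ.continuous.integrable_of_hasCompactSupport hc
  have h := integral_mul_fderiv_eq_neg_fderiv_mul_of_integrable (μ := (volume : Measure (Euc d)))
    (f := fun _ => (1 : ℝ)) (g := ψ) (v := w) (by simp) (by simpa using h1)
    (by simpa using h2) (fun x _ => by fun_prop) (fun x _ => hψ.differentiable (by simp) x)
  simpa using h

/-- A product of a test function on `D` with a function that is `C^n` on `D` is `C^n`. -/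
lemma IsTestFunction.contDiff_mul (hD : IsOpen D) {φ : Euc d → ℝ} (hφ : IsTestFunction D φ)
    {h : Euc d → ℝ} {n : ℕ∞} (hh : ContDiffOn ℝ n h D) : ContDiff ℝ n fun x => φ x * h x := by
  rw [contDiff_iff_contDiffAt]
  intro x
  by_cases hx : x ∈ tsupport φ
  · exact (hφ.1.of_le (by exact_mod_cast le_top)).contDiffAt.mul
      (hh.contDiffAt (hD.mem_nhds (hφ.2.2 hx)))
  · refine (contDiffAt_const (c := (0 : ℝ))).congr_of_eventuallyEq ?_
    filter_upwards [(isClosed_tsupport φ).isOpen_compl.mem_nhds hx] with x' hx'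
    rw [image_eq_zero_of_notMem_tsupport hx', zero_mul]

lemma integral_fderiv_mul_eq_neg (hD : IsOpen D) {φ : Euc d → ℝ} (hφ : IsTestFunction D φ)
    {h : Euc d → ℝ} (hh : ContDiffOn ℝ 1 h D) (w : Euc d) :
    ∫ x in D, fderiv ℝ φ x w * h x = - ∫ x in D, φ x * fderiv ℝ h x w := by
  have hψ : ContDiff ℝ 1 fun x => φ x * h x := hφ.contDiff_mul hD (n := 1) hh
  have h0 := integral_fderiv_apply_eq_zero hψ hφ.2.1.mul_right w
  have hsub : ∀ x, x ∉ D → fderiv ℝ (fun x => φ x * h x) x w = 0 := by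
    intro x hx
    have : x ∉ tsupport fun x => φ x * h x := fun h1 => hx (hφ.2.2 (tsupport_mul_subset_left h1))
    rw [fderiv_of_notMem_tsupport (𝕜 := ℝ) this]; simp
  rw [← setIntegral_eq_integral_of_forall_compl_eq_zero hsub] at h0
  have hon : ∀ x ∈ D, fderiv ℝ (fun x => φ x * h x) x w =
      φ x * fderiv ℝ h x w + fderiv ℝ φ x w * h x := by
    intro x hx
    have h1 : DifferentiableAt ℝ φ x := hφ.1.differentiable (by simp) x
    have h2 : DifferentiableAt ℝ h x := (hh.contDiffAt (hD.mem_nhds hx)).differentiableAt (by simp)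
    rw [fderiv_fun_mul h1 h2]
    simp [mul_comm]
  have hh' : ContDiffOn ℝ 0 (fun x => fderiv ℝ h x w) D :=
    (hh.fderiv_of_isOpen hD (m := 0) (by simp)).clm_apply contDiffOn_const
  have hi1 : Integrable fun x => φ x * fderiv ℝ h x w :=
    (hφ.contDiff_mul hD (n := 0) hh').continuous.integrable_of_hasCompactSupport hφ.2.1.mul_right
  have hi3 : Integrable (fun x => fderiv ℝ (fun x => φ x * h x) x w) :=
    ((hψ.continuous_fderiv (by simp)).clm_apply continuous_const).integrable_of_hasCompactSupport
      (hφ.2.1.mul_right.fderiv_apply (𝕜 := ℝ) w)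
  have hi2 : IntegrableOn (fun x => fderiv ℝ φ x w * h x) D := by
    refine (hi3.sub hi1).integrableOn.congr_fun (fun x hx => ?_) hD.measurableSet
    simp [hon x hx]
  rw [setIntegral_congr_fun hD.measurableSet hon, integral_add hi1.integrableOn hi2] at h0
  linarith

/-- For a `C¹` field, a weak bound for the Jacobian is a pointwise bound. -/
lemma WeakJacobianBound.norm_fderiv_le (hD : IsOpen D) {g : Euc d → Euc d} {B : ℝ}
    (h : WeakJacobianBound D g B) (hB : 0 ≤ B) (hg : ContDiffOn ℝ 1 g D) {x : Euc d} (hx : x ∈ D) :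
    ‖fderiv ℝ g x‖ ≤ B := by
  have key : ∀ w z : Euc d, inner ℝ (fderiv ℝ g x w) z ≤ B * ‖w‖ * ‖z‖ := by
    intro w z
    by_contra! hlt
    set c := B * ‖w‖ * ‖z‖ with hc
    have hh : ContDiffOn ℝ 1 (fun x => inner ℝ (g x) z) D := hg.inner ℝ contDiffOn_const
    have hfd : ∀ x ∈ D, fderiv ℝ (fun x => inner ℝ (g x) z) x w = inner ℝ (fderiv ℝ g x w) z := by
      intro x hx
      have hd : DifferentiableAt ℝ g x := (hg.contDiffAt (hD.mem_nhds hx)).differentiableAt (by simp)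
      rw [fderiv_inner_apply ℝ hd (differentiableAt_const z)]
      simp
    have hcont : ContinuousOn (fun x => fderiv ℝ (fun x => inner ℝ (g x) z) x w) D :=
      (hh.continuousOn_fderiv_of_isOpen hD (by simp)).clm_apply continuousOn_const
    obtain ⟨c', hc1, hc2⟩ := exists_between hlt
    have hev : ∀ᶠ x' in 𝓝 x, x' ∈ D ∧ c' < fderiv ℝ (fun x => inner ℝ (g x) z) x' w := by
      refine (hD.eventually_mem hx).and ?_
      refine (hcont.continuousAt (hD.mem_nhds hx)).eventually (lt_mem_nhds ?_)
      simpa only [hfd x hx] using hc2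
    obtain ⟨ε, hε, hball⟩ := Metric.eventually_nhds_iff_ball.1 hev
    let φ : ContDiffBump x := ⟨ε / 4, ε / 2, by positivity, by linarith⟩
    have hts : tsupport φ ⊆ Metric.ball x ε := by
      rw [φ.tsupport_eq]
      exact Metric.closedBall_subset_ball (by simp [φ]; linarith)
    have hφ : IsTestFunction D φ :=
      ⟨φ.contDiff, φ.hasCompactSupport, fun x' hx' => (hball x' (hts hx')).1⟩
    have h1 := h φ hφ w z
    rw [integral_fderiv_mul_eq_neg hD hφ hh w, abs_neg] at h1
    have hh' : ContDiffOn ℝ 0 (fun x' => fderiv ℝ (fun x => inner ℝ (g x) z) x' w) D := by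
      simpa using hcont
    have hi1 : IntegrableOn (fun x' => φ x' * fderiv ℝ (fun x => inner ℝ (g x) z) x' w) D :=
      ((hφ.contDiff_mul hD (n := 0) hh').continuous.integrable_of_hasCompactSupport
        hφ.2.1.mul_right).integrableOn
    have hi2 : IntegrableOn (fun x' => φ x') D := (φ.continuous.integrable_of_hasCompactSupport
      φ.hasCompactSupport).integrableOn
    have h2 : c' * ∫ x' in D, φ x' ≤
        ∫ x' in D, φ x' * fderiv ℝ (fun x => inner ℝ (g x) z) x' w := by
      rw [← integral_const_mul]
      refine setIntegral_mono_on (hi2.const_mul _) hi1 hD.measurableSet fun x' _ => ?_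
      by_cases hx' : x' ∈ tsupport φ
      · rw [mul_comm]
        exact mul_le_mul_of_nonneg_left (hball x' (hts hx')).2.le φ.nonneg
      · rw [image_eq_zero_of_notMem_tsupport hx']; simp
    have h3 : ∫ x' in D, |φ x'| = ∫ x' in D, φ x' := by
      simp only [abs_of_nonneg φ.nonneg]
    have h4 : 0 < ∫ x' in D, φ x' := by
      rw [setIntegral_eq_integral_of_forall_compl_eq_zero]
      · exact φ.integral_pos
      · intro x' hx'
        exact image_eq_zero_of_notMem_tsupport fun h => hx' (hφ.2.2 h)
    rw [h3] at h1
    have h5 := (le_abs_self _).trans h1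
    nlinarith
  refine ContinuousLinearMap.opNorm_le_bound _ hB fun w => ?_
  have h1 := key w (fderiv ℝ g x w)
  rw [real_inner_self_eq_norm_sq] at h1
  rcases (norm_nonneg (fderiv ℝ g x w)).eq_or_lt with h0 | h0
  · rw [← h0]; positivity
  · nlinarith

/-- A pointwise almost everywhere bound is a pointwise bound for continuous functions on an open
set. -/
lemma norm_le_of_ae_of_continuousOn (hD : IsOpen D) {E : Type*} [NormedAddCommGroup E]
    {g : Euc d → E} {B : ℝ} (hg : ContinuousOn g D)
    (h : ∀ᵐ x ∂(volume.restrict D), ‖g x‖ ≤ B) {x : Euc d} (hx : x ∈ D) : ‖g x‖ ≤ B := by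
  by_contra! hlt
  have hev : ∀ᶠ x' in 𝓝 x, x' ∈ D ∧ B < ‖g x'‖ :=
    (hD.eventually_mem hx).and ((hg.continuousAt (hD.mem_nhds hx)).norm.eventually
      (lt_mem_nhds hlt))
  obtain ⟨ε, hε, hball⟩ := Metric.eventually_nhds_iff_ball.1 hev
  have h0 : volume (Metric.ball x ε) = 0 := by
    rw [ae_restrict_iff' hD.measurableSet] at h
    refine measure_mono_null (fun x' hx' => ?_) h
    have := hball x' hx'
    simp [this.1, this.2]
  exact (Metric.measure_ball_pos volume x hε).ne' h0

/-- The partial derivative in the parameter of a family of fields with uniformly bounded weak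
Jacobians is again `C¹` in space, and its spatial derivative is the parameter derivative of the
spatial derivatives. -/
lemma contDiffOn_paramDeriv (hD : IsOpen D) (hDb : Bornology.IsBounded D) {l r : ℝ}
    {g₀ g₁ g₂ : ℝ → Euc d → Euc d} {B : ℝ} (hB : 0 ≤ B)
    (h₀₁ : ∀ x ∈ D, ∀ t ∈ Icc l r, HasDerivWithinAt (fun t => g₀ t x) (g₁ t x) (Icc l r) t)
    (h₁₂ : ∀ x ∈ D, ∀ t ∈ Icc l r, HasDerivWithinAt (fun t => g₁ t x) (g₂ t x) (Icc l r) t)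
    (hg₀ : ∀ t ∈ Icc l r, ContDiffOn ℝ 1 (g₀ t) D)
    (hm₁ : ∀ t ∈ Icc l r, AEStronglyMeasurable (g₁ t) (volume.restrict D))
    (hb₀ : ∀ t ∈ Icc l r, ∀ᵐ x ∂(volume.restrict D), ‖g₀ t x‖ ≤ B)
    (hb₁ : ∀ t ∈ Icc l r, ∀ᵐ x ∂(volume.restrict D), ‖g₁ t x‖ ≤ B)
    (hb₂ : ∀ t ∈ Icc l r, ∀ᵐ x ∂(volume.restrict D), ‖g₂ t x‖ ≤ B)
    (hc₂ : ∀ x ∈ D, ContinuousOn (fun t => g₂ t x) (Icc l r))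
    (hw₂ : ∀ t ∈ Icc l r, WeakJacobianBound D (g₂ t) B) {s : ℝ} (hs : s ∈ Icc l r)
    (hlr : l < r) :
    ContDiffOn ℝ 1 (g₁ s) D ∧ ∀ x ∈ D,
      HasDerivWithinAt (fun t => fderiv ℝ (g₀ t) x) (fderiv ℝ (g₁ s) x) (Icc l r) s := by
  have hfin := isFiniteMeasure_restrict hDb
  have hmem : ∀ᵐ x ∂(volume.restrict D), x ∈ D := ae_restrict_mem hD.measurableSet
  have hm₀ : ∀ t ∈ Icc l r, AEStronglyMeasurable (g₀ t) (volume.restrict D) := fun t ht =>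
    (hg₀ t ht).continuousOn.aestronglyMeasurable hD.measurableSet
  -- second order Taylor expansion of the weak derivative, tested with `φ`
  have htaylor : ∀ φ, IsTestFunction D φ → ∀ w z : Euc d, ∀ t ∈ Icc l r,
      |(∫ x in D, fderiv ℝ φ x w * inner ℝ (g₀ t x) z) -
        (∫ x in D, fderiv ℝ φ x w * inner ℝ (g₀ s x) z) -
        (t - s) * ∫ x in D, fderiv ℝ φ x w * inner ℝ (g₁ s x) z| ≤
        (B * ‖w‖ * ‖z‖ * ∫ x in D, |φ x|) * |t - s| ^ 2 := by
    intro φ hφ w z t ht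
    obtain ⟨c, hc0, hc⟩ := hφ.exists_bound_fderiv w
    have hbd : ∀ v : Euc d, ‖v‖ ≤ B → ∀ x, ‖fderiv ℝ φ x w * inner ℝ v z‖ ≤ c * (B * ‖z‖) := by
      intro v hv x
      rw [norm_mul]
      refine mul_le_mul (hc x) ?_ (norm_nonneg _) hc0
      exact (norm_inner_le_norm v z).trans (mul_le_mul_of_nonneg_right hv (norm_nonneg _))
    have hint : ∀ g : Euc d → Euc d, AEStronglyMeasurable g (volume.restrict D) →
        (∀ᵐ x ∂(volume.restrict D), ‖g x‖ ≤ B) →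
        Integrable (fun x => fderiv ℝ φ x w * inner ℝ (g x) z) (volume.restrict D) := by
      intro g hg hgb
      refine Integrable.of_bound ((hφ.continuous_fderiv w).aestronglyMeasurable.mul
        (hg.inner aestronglyMeasurable_const)) (c * (B * ‖z‖)) ?_
      filter_upwards [hgb] with x hx using hbd _ hx x
    have hder : ∀ v v' : ℝ → Euc d, ∀ x, ∀ t ∈ Icc l r, HasDerivWithinAt v (v' t) (Icc l r) t →
        HasDerivWithinAt (fun t => fderiv ℝ φ x w * inner ℝ (v t) z)
          (fderiv ℝ φ x w * inner ℝ (v' t) z) (Icc l r) t := by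
      intro v v' x t _ hv
      have h1 := (hv.inner ℝ (hasDerivWithinAt_const t (Icc l r) z)).const_mul (fderiv ℝ φ x w)
      simpa using h1
    have hae : ∀ g g' : ℝ → Euc d → Euc d,
        (∀ x ∈ D, ∀ t ∈ Icc l r, HasDerivWithinAt (fun t => g t x) (g' t x) (Icc l r) t) →
        (∀ t ∈ Icc l r, AEStronglyMeasurable (g t) (volume.restrict D)) →
        (∀ t ∈ Icc l r, ∀ᵐ x ∂(volume.restrict D), ‖g t x‖ ≤ B) →
        (∀ t ∈ Icc l r, ∀ᵐ x ∂(volume.restrict D), ‖g' t x‖ ≤ B) →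
        (∀ x ∈ D, ContinuousOn (fun t => g' t x) (Icc l r)) → ∀ t ∈ Icc l r,
        HasDerivWithinAt (fun t => ∫ x in D, fderiv ℝ φ x w * inner ℝ (g t x) z)
          (∫ x in D, fderiv ℝ φ x w * inner ℝ (g' t x) z) (Icc l r) t := by
      intro g g' hgg' hgm hgb hgb' hgc t ht
      have h1 := ae_forall_mem_Icc_norm_le hgb' (hmem.mono hgc)
      refine hasDerivWithinAt_integral_Icc (bound := fun _ => c * (B * ‖z‖))
        (g' := fun t x => fderiv ℝ φ x w * inner ℝ (g' t x) z)
        (fun t ht => hint _ (hgm t ht) (hgb t ht)) ?_ ?_ (integrable_const _) ht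
      · filter_upwards [hmem] with x hx t ht
        exact hder _ (fun t => g' t x) x t ht (hgg' x hx t ht)
      · filter_upwards [h1] with x hx t ht using hbd _ (hx t ht) x
    have := norm_taylor_two_le
      (hae g₀ g₁ h₀₁ hm₀ hb₀ hb₁ fun x hx t ht => (h₁₂ x hx t ht).continuousWithinAt)
      (hae g₁ g₂ h₁₂ hm₁ hb₁ hb₂ hc₂) (fun t ht => hw₂ t ht φ hφ w z) hs ht
    simpa using this
  -- the difference quotients and their spatial derivatives
  let Q : ℝ → Euc d → Euc d := fun t x => (t - s)⁻¹ • (g₀ t x - g₀ s x)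
  have hQc : ∀ t ∈ Icc l r, ContDiffOn ℝ 1 (Q t) D := fun t ht =>
    ((hg₀ t ht).sub (hg₀ s hs)).const_smul _
  have hdiff : ∀ {h : Euc d → Euc d}, ContDiffOn ℝ 1 h D → ∀ x ∈ D, DifferentiableAt ℝ h x :=
    fun hh x hx => (hh.contDiffAt (hD.mem_nhds hx)).differentiableAt (by simp)
  have hQf : ∀ t ∈ Icc l r, ∀ x ∈ D,
      fderiv ℝ (Q t) x = (t - s)⁻¹ • (fderiv ℝ (g₀ t) x - fderiv ℝ (g₀ s) x) := by
    intro t ht x hx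
    have h1 := hdiff (hg₀ t ht) x hx
    have h2 := hdiff (hg₀ s hs) x hx
    exact ((h1.hasFDerivAt.sub h2.hasFDerivAt).const_smul ((t - s)⁻¹)).fderiv
  -- differences of difference quotients have small weak Jacobians, by the Taylor expansion
  have hQw : ∀ t ∈ Icc l r \ {s}, ∀ t' ∈ Icc l r \ {s},
      WeakJacobianBound D (fun x => Q t x - Q t' x) (B * (|t - s| + |t' - s|)) := by
    intro t ht t' ht' φ hφ w z
    have hint : ∀ t ∈ Icc l r,
        Integrable (fun x => fderiv ℝ φ x w * inner ℝ (g₀ t x) z) (volume.restrict D) := by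
      intro t ht
      obtain ⟨c, hc0, hc⟩ := hφ.exists_bound_fderiv w
      refine Integrable.of_bound ((hφ.continuous_fderiv w).aestronglyMeasurable.mul
        ((hm₀ t ht).inner aestronglyMeasurable_const)) (c * (B * ‖z‖)) ?_
      filter_upwards [hb₀ t ht] with x hx
      rw [norm_mul]
      refine mul_le_mul (hc x) ?_ (norm_nonneg _) hc0
      exact (norm_inner_le_norm _ z).trans (mul_le_mul_of_nonneg_right hx (norm_nonneg _))
    set I : ℝ → ℝ := fun t => ∫ x in D, fderiv ℝ φ x w * inner ℝ (g₀ t x) z with hI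
    set I' := ∫ x in D, fderiv ℝ φ x w * inner ℝ (g₁ s x) z with hI'
    set K := B * ‖w‖ * ‖z‖ * ∫ x in D, |φ x| with hK
    have e : ∫ x in D, fderiv ℝ φ x w * inner ℝ (Q t x - Q t' x) z =
        (t - s)⁻¹ * (I t - I s) - (t' - s)⁻¹ * (I t' - I s) := by
      have h1 : ∀ t ∈ Icc l r, Integrable (fun x => fderiv ℝ φ x w * inner ℝ (g₀ t x) z -
          fderiv ℝ φ x w * inner ℝ (g₀ s x) z) (volume.restrict D) :=
        fun t ht => (hint t ht).sub (hint s hs)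
      rw [hI]
      simp only
      rw [← integral_sub (hint t ht.1) (hint s hs), ← integral_sub (hint t' ht'.1) (hint s hs),
        ← integral_const_mul, ← integral_const_mul,
        ← integral_sub ((h1 t ht.1).const_mul _) ((h1 t' ht'.1).const_mul _)]
      congr 1
      ext x
      simp only [Q, inner_sub_left, real_inner_smul_left]
      ring
    have hq : ∀ t ∈ Icc l r \ {s}, |(t - s)⁻¹ * (I t - I s) - I'| ≤ K * |t - s| := by
      intro t ht
      have h0 : t - s ≠ 0 := sub_ne_zero.2 ht.2
      have h0' : 0 < |t - s| := abs_pos.2 h0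
      have h1 := htaylor φ hφ w z t ht.1
      have h2 : (t - s)⁻¹ * (I t - I s) - I' = (t - s)⁻¹ * (I t - I s - (t - s) * I') := by
        field_simp
      rw [h2, abs_mul, abs_inv, inv_mul_le_iff₀ h0']
      calc _ ≤ _ := h1
        _ = _ := by ring
    rw [e]
    have h1 := hq t ht
    have h2 := hq t' ht'
    rw [abs_le] at h1 h2 ⊢
    have h3 : B * (|t - s| + |t' - s|) * ‖w‖ * ‖z‖ * ∫ x in D, |φ x| =
        K * |t - s| + K * |t' - s| := by rw [hK]; ring
    rw [h3]
    constructor <;> linarith [h1.1, h1.2, h2.1, h2.2]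
  have hcauchy : ∀ t ∈ Icc l r \ {s}, ∀ t' ∈ Icc l r \ {s}, ∀ x ∈ D,
      ‖fderiv ℝ (Q t) x - fderiv ℝ (Q t') x‖ ≤ B * (|t - s| + |t' - s|) := by
    intro t ht t' ht' x hx
    have h1 := (hQw t ht t' ht').norm_fderiv_le hD (by positivity)
      ((hQc t ht.1).sub (hQc t' ht'.1)) hx
    rwa [fderiv_fun_sub (hdiff (hQc t ht.1) x hx) (hdiff (hQc t' ht'.1) x hx)] at h1
  -- hence the Jacobians of the difference quotients converge uniformly on `D`
  set L := 𝓝[Icc l r \ {s}] s with hL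
  have hne : L.NeBot := by
    rw [hL, ← accPt_principal_iff_nhdsWithin]
    exact (uniqueDiffOn_Icc hlr s hs).accPt
  have hself : ∀ᶠ t in L, t ∈ Icc l r \ {s} := self_mem_nhdsWithin
  have htend : Filter.Tendsto (fun t => |t - s|) L (𝓝 0) := by
    have : Filter.Tendsto (fun t => |t - s|) (𝓝 s) (𝓝 |s - s|) :=
      ((continuous_id.sub continuous_const).abs).tendsto s
    simp only [sub_self, abs_zero] at this
    exact this.mono_left nhdsWithin_le_nhds
  have hlim : ∀ x ∈ D, ∃ A, Filter.Tendsto (fun t => fderiv ℝ (Q t) x) L (𝓝 A) := by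
    intro x hx
    rw [← cauchy_map_iff_exists_tendsto]
    refine cauchy_map_iff.2 ⟨hne, ?_⟩
    refine Metric.uniformity_basis_dist.tendsto_right_iff.2 fun ε hε => ?_
    have h1 : ∀ᶠ p in L ×ˢ L, B * (|p.1 - s| + |p.2 - s|) < ε := by
      have h2 : Filter.Tendsto (fun p : ℝ × ℝ => B * (|p.1 - s| + |p.2 - s|)) (L ×ˢ L)
          (𝓝 (B * (0 + 0))) := ((htend.comp Filter.tendsto_fst).add
            (htend.comp Filter.tendsto_snd)).const_mul B
      refine h2.eventually (gt_mem_nhds (by simpa using hε))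
    filter_upwards [h1, hself.prod_mk hself] with p hp hp'
    simp only [dist_eq_norm]
    exact (hcauchy _ hp'.1 _ hp'.2 x hx).trans_lt hp
  choose! A hA using hlim
  have hunif : TendstoUniformlyOn (fun t => fderiv ℝ (Q t)) A L D := by
    rw [Metric.tendstoUniformlyOn_iff]
    intro ε hε
    have h1 : ∀ᶠ t in L, B * |t - s| < ε :=
      (htend.const_mul B).eventually (gt_mem_nhds (by simpa using hε))
    filter_upwards [h1, hself] with t ht ht' x hx
    rw [dist_comm, dist_eq_norm]
    refine lt_of_le_of_lt ?_ ht
    have h2 : Filter.Tendsto (fun t' => ‖fderiv ℝ (Q t) x - fderiv ℝ (Q t') x‖) L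
        (𝓝 ‖fderiv ℝ (Q t) x - A x‖) := ((hA x hx).const_sub _).norm
    have h3 : Filter.Tendsto (fun t' => B * (|t - s| + |t' - s|)) L (𝓝 (B * (|t - s| + 0))) :=
      (htend.const_add _).const_mul B
    rw [add_zero] at h3
    exact le_of_tendsto_of_tendsto h2 h3 (hself.mono fun t' ht'' => hcauchy t ht' t' ht'' x hx)
  have hpt : ∀ x ∈ D, Filter.Tendsto (fun t => Q t x) L (𝓝 (g₁ s x)) := fun x hx =>
    hasDerivWithinAt_iff_tendsto_slope.1 (h₀₁ x hx s hs)
  have hfd : ∀ x ∈ D, HasFDerivAt (g₁ s) (A x) x := fun x hx =>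
    hasFDerivAt_of_tendstoUniformlyOnFilter
      (hunif.tendstoUniformlyOnFilter.mono_right (Filter.le_principal_iff.2 (hD.mem_nhds hx)))
      ((hself.prod_mk (hD.eventually_mem hx)).mono fun p hp =>
        (hdiff (hQc p.1 hp.1.1) p.2 hp.2).hasFDerivAt) ((hD.eventually_mem hx).mono hpt)
  have hAc : ContinuousOn A D := hunif.continuousOn
    (hself.mono fun t ht => (hQc t ht.1).continuousOn_fderiv_of_isOpen hD (by simp)).frequently
  refine ⟨?_, fun x hx => ?_⟩
  · rw [show (1 : WithTop ℕ∞) = 0 + 1 by simp, contDiffOn_succ_iff_hasFDerivWithinAt_of_uniqueDiffOn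
      hD.uniqueDiffOn]
    refine ⟨by simp, A, by simpa using hAc, fun x hx => (hfd x hx).hasFDerivWithinAt⟩
  · rw [(hfd x hx).fderiv, hasDerivWithinAt_iff_tendsto_slope]
    refine (hA x hx).congr' (hself.mono fun t ht => ?_)
    rw [hQf t ht.1 x hx]
    rfl

end

lemma neg_half_lt_half : (-(1 / 2) : ℝ) < 1 / 2 := by norm_num

/-- The parameter derivatives of the perturbation field are `C¹` in space, and spatial and parameter
derivatives commute. Hence both the field and its Jacobian are Gevrey regular in the parameter at
every point of the domain. -/
lemma GevreyField.isGevrey {d : ℕ} {D : Set (Euc d)} (hD : IsOpen D) (hDb : Bornology.IsBounded D)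
    {V : (ℕ → ℝ) → Euc d → Euc d} {C β : ℝ} {b : ℕ → ℝ} (hC : 0 ≤ C) (hb : ∀ j, 0 ≤ b j)
    (hV : ∀ y ∈ paramSet, ContDiffOn ℝ 1 (V y) D) (h : GevreyField D V C β b) :
    ∀ x ∈ D, IsGevrey b β C 1 (fun y => V y x) ∧ IsGevrey b β C 1 (fun y => fderiv ℝ (V y) x) := by
  obtain ⟨dV, hfam, hbd⟩ := h
  let Bd : (ℕ →₀ ℕ) → ℝ := fun ν => C * factPow β ν.degree * mpow b ν
  have hBd0 : ∀ ν, 0 ≤ Bd ν := fun ν =>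
    mul_nonneg (mul_nonneg hC (factPow_nonneg _ _)) (mpow_nonneg hb ν)
  have hder : ∀ ν j, ∀ y ∈ paramSet, ∀ x ∈ D, ∀ t ∈ Icc (-(1 / 2) : ℝ) (1 / 2),
      HasDerivWithinAt (fun t => dV ν (Function.update y j t) x)
        (dV (ν + Finsupp.single j 1) (Function.update y j t) x) (Icc (-(1 / 2) : ℝ) (1 / 2)) t := by
    intro ν j y hy x hx t ht
    have h1 := (hfam x hx).2 ν j _ (update_mem_paramSet hy j ht)
    simpa only [Function.update_idem, Function.update_self] using h1
  have hstep : ∀ ν j, (∀ y ∈ paramSet, ContDiffOn ℝ 1 (dV ν y) D) → ∀ y ∈ paramSet,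
      ContDiffOn ℝ 1 (dV (ν + Finsupp.single j 1) y) D ∧ ∀ x ∈ D,
        HasDerivWithinAt (fun t => fderiv ℝ (dV ν (Function.update y j t)) x)
          (fderiv ℝ (dV (ν + Finsupp.single j 1) y) x) (Icc (-(1 / 2) : ℝ) (1 / 2)) (y j) := by
    intro ν j hν y hy
    set μ := ν + Finsupp.single j 1 with hμ
    set κ := μ + Finsupp.single j 1 with hκ
    set B := Bd ν + Bd μ + Bd κ with hB
    have hup : ∀ t ∈ Icc (-(1 / 2) : ℝ) (1 / 2), Function.update y j t ∈ paramSet :=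
      fun t ht => update_mem_paramSet hy j ht
    have hle : ∀ η, Bd η ≤ B → ∀ t ∈ Icc (-(1 / 2) : ℝ) (1 / 2),
        ∀ᵐ x ∂(volume.restrict D), ‖dV η (Function.update y j t) x‖ ≤ B := fun η hη t ht =>
      (hbd η _ (hup t ht)).2.1.mono fun x hx => hx.trans hη
    have h0 := hBd0 ν
    have h1 := hBd0 μ
    have h2 := hBd0 κ
    have := contDiffOn_paramDeriv hD hDb (B := B) (g₀ := fun t => dV ν (Function.update y j t))
      (g₁ := fun t => dV μ (Function.update y j t)) (g₂ := fun t => dV κ (Function.update y j t))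
      (by linarith) (fun x hx t ht => hder ν j y hy x hx t ht)
      (fun x hx t ht => hder μ j y hy x hx t ht)
      (fun t ht => hν _ (hup t ht)) (fun t ht => (hbd μ _ (hup t ht)).1)
      (hle ν (by linarith)) (hle μ (by linarith)) (hle κ (by linarith))
      (fun x hx t ht => (hder κ j y hy x hx t ht).continuousWithinAt)
      (fun t ht φ hφ w z => ((hbd κ _ (hup t ht)).weakJacobianBound hDb φ hφ w z).trans (by
        have h3 : 0 ≤ ∫ x in D, |φ x| := integral_nonneg fun _ => abs_nonneg _
        have h4 : Bd κ ≤ B := by linarith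
        gcongr)) (hy j) neg_half_lt_half
    simpa only [Function.update_eq_self] using this
  have hC1 : ∀ n, ∀ ν : ℕ →₀ ℕ, ν.degree = n → ∀ y ∈ paramSet, ContDiffOn ℝ 1 (dV ν y) D := by
    intro n
    induction n with
    | zero =>
      intro ν hν y hy
      obtain rfl := (Finsupp.degree_eq_zero_iff ν).1 hν
      exact (hV y hy).congr fun x hx => (hfam x hx).1 y hy
    | succ n ih =>
      intro ν hν y hy
      obtain ⟨j, μ, rfl⟩ := exists_eq_add_single (ν := ν) (by rintro rfl; simp at hν)
      rw [degree_add_single] at hν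
      exact (hstep μ j (ih μ (by omega)) y hy).1
  intro x hx
  refine ⟨⟨_, hfam x hx, fun ν y hy => ?_⟩, ⟨fun ν y => fderiv ℝ (dV ν y) x,
    ⟨fun y hy => ?_, fun ν j y hy => (hstep ν j (hC1 _ ν rfl) y hy).2 x hx⟩, fun ν y hy => ?_⟩⟩
  · rw [one_pow, mul_one]
    exact norm_le_of_ae_of_continuousOn hD (hC1 _ ν rfl y hy).continuousOn (hbd ν y hy).2.1 hx
  · refine Filter.EventuallyEq.fderiv_eq ?_
    filter_upwards [hD.mem_nhds hx] with x' hx' using (hfam x' hx').1 y hy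
  · rw [one_pow, mul_one]
    exact ((hbd ν y hy).weakJacobianBound hDb).norm_fderiv_le hD (hBd0 ν) (hC1 _ ν rfl y hy) hx

/-! ### Regularity of the pulled-back coefficient and source -/

section SingularValues

variable {d : ℕ} {T : Euc d →L[ℝ] Euc d} {σmin σmax : ℝ}

lemma norm_sq_eq_sum_singularValues (T : Euc d →L[ℝ] Euc d) (x : Euc d) :
    ‖T x‖ ^ 2 = ∑ i : Fin d, (T : Euc d →ₗ[ℝ] Euc d).singularValues i ^ 2 *
      ((T : Euc d →ₗ[ℝ] Euc d).isSymmetric_adjoint_comp_self.eigenvectorBasis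
        finrank_euclideanSpace_fin).repr x i ^ 2 := by
  set T' : Euc d →ₗ[ℝ] Euc d := (T : Euc d →ₗ[ℝ] Euc d) with hT'
  set e := T'.isSymmetric_adjoint_comp_self.eigenvectorBasis finrank_euclideanSpace_fin with he
  have h1 : ‖T x‖ ^ 2 = inner ℝ ((LinearMap.adjoint T' ∘ₗ T') x) x := by
    rw [LinearMap.comp_apply, LinearMap.adjoint_inner_left, ← real_inner_self_eq_norm_sq]
    rfl
  rw [h1, ← e.repr.inner_map_map, PiLp.inner_apply]
  refine Finset.sum_congr rfl fun i _ => ?_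
  rw [he, LinearMap.IsSymmetric.eigenvectorBasis_apply_self_apply, ← he,
    T'.sq_singularValues_fin finrank_euclideanSpace_fin i]
  simp only [Real.inner_apply, RCLike.ofReal_real_eq_id, id_eq]
  ring

lemma le_norm_apply_of_singularValues (h0 : 0 ≤ σmin)
    (h : ∀ i < d, σmin ≤ (T : Euc d →ₗ[ℝ] Euc d).singularValues i) (x : Euc d) :
    σmin * ‖x‖ ≤ ‖T x‖ := by
  refine le_of_sq_le_sq ?_ (norm_nonneg _)
  rw [norm_sq_eq_sum_singularValues, mul_pow,
    ← ((T : Euc d →ₗ[ℝ] Euc d).isSymmetric_adjoint_comp_self.eigenvectorBasis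
        finrank_euclideanSpace_fin).repr.norm_map x, EuclideanSpace.real_norm_sq_eq, Finset.mul_sum]
  exact Finset.sum_le_sum fun i _ =>
    mul_le_mul_of_nonneg_right (pow_le_pow_left₀ h0 (h i i.2) 2) (sq_nonneg _)

lemma norm_apply_le_of_singularValues (h0 : 0 ≤ σmax)
    (h : ∀ i < d, (T : Euc d →ₗ[ℝ] Euc d).singularValues i ≤ σmax) (x : Euc d) :
    ‖T x‖ ≤ σmax * ‖x‖ := by
  refine le_of_sq_le_sq ?_ (by positivity)
  rw [norm_sq_eq_sum_singularValues, mul_pow,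
    ← ((T : Euc d →ₗ[ℝ] Euc d).isSymmetric_adjoint_comp_self.eigenvectorBasis
        finrank_euclideanSpace_fin).repr.norm_map x, EuclideanSpace.real_norm_sq_eq, Finset.mul_sum]
  exact Finset.sum_le_sum fun i _ => mul_le_mul_of_nonneg_right
    (pow_le_pow_left₀ (LinearMap.singularValues_nonneg _ _) (h i i.2) 2) (sq_nonneg _)

lemma abs_det_eq_prod_singularValues (T : Euc d →L[ℝ] Euc d) :
    |T.det| = ∏ i ∈ Finset.range d, (T : Euc d →ₗ[ℝ] Euc d).singularValues i := by
  have h := LinearMap.normDet_eq_prod_singularValues (T : Euc d →ₗ[ℝ] Euc d)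
  rw [LinearMap.normDet_eq_abs_det, finrank_euclideanSpace_fin] at h
  exact h

lemma pow_le_abs_det (h0 : 0 ≤ σmin)
    (h : ∀ i < d, σmin ≤ (T : Euc d →ₗ[ℝ] Euc d).singularValues i) : σmin ^ d ≤ |T.det| := by
  rw [abs_det_eq_prod_singularValues]
  calc σmin ^ d = ∏ _i ∈ Finset.range d, σmin := by simp
    _ ≤ _ := Finset.prod_le_prod (fun _ _ => h0) fun i hi => h i (by simpa using hi)

/-- An operator with positive singular values is invertible, with a bound for its inverse. -/
lemma exists_inverse_of_singularValues (h0 : 0 < σmin)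
    (h : ∀ i < d, σmin ≤ (T : Euc d →ₗ[ℝ] Euc d).singularValues i) :
    ∃ R : Euc d →L[ℝ] Euc d, T ∘L R = .id ℝ _ ∧ R ∘L T = .id ℝ _ ∧ ‖R‖ ≤ 1 / σmin := by
  have hlb := le_norm_apply_of_singularValues h0.le h
  have hinj : Function.Injective (T : Euc d →ₗ[ℝ] Euc d) := by
    refine (injective_iff_map_eq_zero _).2 fun x hx => ?_
    have h1 := hlb x
    have h2 : T x = 0 := hx
    rw [h2, norm_zero] at h1
    exact norm_le_zero_iff.1 (by nlinarith [norm_nonneg x])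
  let e := (LinearEquiv.ofInjectiveEndo (T : Euc d →ₗ[ℝ] Euc d) hinj).toContinuousLinearEquiv
  have he : ∀ x, e x = T x := fun x => rfl
  have hr : ∀ x, T (e.symm x) = x := fun x => by rw [← he, e.apply_symm_apply]
  refine ⟨e.symm, ContinuousLinearMap.ext fun x => hr x,
    ContinuousLinearMap.ext fun x => e.symm_apply_apply x, ?_⟩
  refine ContinuousLinearMap.opNorm_le_bound _ (by positivity) fun x => ?_
  have h1 := hlb (e.symm x)
  rw [hr] at h1
  rw [one_div, ← div_eq_inv_mul, le_div_iff₀ h0, mul_comm]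
  exact h1

end SingularValues

section Det

variable {d : ℕ}

/-- The determinant of a family of vectors of Euclidean space, as a continuous multilinear map. -/
noncomputable def detMultilinear (d : ℕ) :
    ContinuousMultilinearMap ℝ (fun _ : Fin d => Euc d) ℝ :=
  (EuclideanSpace.basisFun (Fin d) ℝ).toBasis.det.toMultilinearMap.mkContinuous 1 fun v => by
    have : Fact (Module.finrank ℝ (Euc d) = d) := ⟨finrank_euclideanSpace_fin⟩
    let o := (EuclideanSpace.basisFun (Fin d) ℝ).toBasis.orientation
    rw [one_mul, Real.norm_eq_abs]
    have h := o.abs_volumeForm_apply_le v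
    rwa [o.volumeForm_robust' (EuclideanSpace.basisFun (Fin d) ℝ)] at h

/-- The columns of a linear map, with respect to the standard basis. -/
noncomputable def columnsCLM (d : ℕ) : (Euc d →L[ℝ] Euc d) →L[ℝ] (Fin d → Euc d) :=
  ContinuousLinearMap.pi fun i => ContinuousLinearMap.apply ℝ (Euc d)
    (EuclideanSpace.single i (1 : ℝ))

lemma norm_columnsCLM_apply_le (T : Euc d →L[ℝ] Euc d) : ‖columnsCLM d T‖ ≤ ‖T‖ := by
  refine (pi_norm_le_iff_of_nonneg (norm_nonneg _)).2 fun i => ?_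
  have := T.le_opNorm (EuclideanSpace.single i (1 : ℝ))
  simpa [columnsCLM] using this

lemma det_eq_detMultilinear :
    (fun T : Euc d →L[ℝ] Euc d => T.det) = detMultilinear d ∘ columnsCLM d := by
  ext T
  have h := LinearMap.det_toMatrix (EuclideanSpace.basisFun (Fin d) ℝ).toBasis
    (T : Euc d →ₗ[ℝ] Euc d)
  change LinearMap.det (T : Euc d →ₗ[ℝ] Euc d) = _
  rw [← h]
  change _ = (EuclideanSpace.basisFun (Fin d) ℝ).toBasis.det (columnsCLM d T)
  rw [Module.Basis.det_apply]
  congr 1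

lemma contDiff_det : ContDiff ℝ ∞ fun T : Euc d →L[ℝ] Euc d => T.det := by
  rw [det_eq_detMultilinear]
  exact (detMultilinear d).contDiff.comp (columnsCLM d).contDiff

lemma one_le_factPow {β : ℝ} (hβ : 0 ≤ β) (n : ℕ) : 1 ≤ factPow β n :=
  Real.one_le_rpow (by exact_mod_cast n.factorial_pos) hβ

lemma norm_iteratedFDeriv_det_le {β : ℝ} (hβ : 0 ≤ β) {σmax : ℝ} (hσ : 1 ≤ σmax)
    {T : Euc d →L[ℝ] Euc d} (hT : ‖T‖ ≤ σmax) (n : ℕ) :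
    ‖iteratedFDeriv ℝ n (fun T : Euc d →L[ℝ] Euc d => T.det) T‖ ≤
      σmax ^ d * factPow β n * (d : ℝ) ^ n := by
  rw [det_eq_detMultilinear, (columnsCLM d).iteratedFDeriv_comp_right
    ((detMultilinear d).contDiff (n := n)) T le_rfl]
  refine (ContinuousMultilinearMap.norm_compContinuousLinearMap_le _ _).trans ?_
  have h1 : ‖columnsCLM d‖ ≤ 1 := ContinuousLinearMap.opNorm_le_bound _ zero_le_one fun T => by
    simpa using norm_columnsCLM_apply_le T
  have h2 : ∏ _i : Fin n, ‖columnsCLM d‖ ≤ 1 :=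
    Finset.prod_le_one (fun _ _ => norm_nonneg (columnsCLM d)) fun _ _ => h1
  have h3 := (detMultilinear d).norm_iteratedFDeriv_le n (columnsCLM d T)
  have h4 : ‖detMultilinear d‖ ≤ 1 := MultilinearMap.mkContinuous_norm_le _ zero_le_one _
  have h5 : ‖columnsCLM d T‖ ≤ σmax := (norm_columnsCLM_apply_le T).trans hT
  have h6 : ((d.descFactorial n : ℕ) : ℝ) ≤ (d : ℝ) ^ n := by
    exact_mod_cast Nat.descFactorial_le_pow d n
  have h7 : ‖columnsCLM d T‖ ^ (d - n) ≤ σmax ^ d :=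
    (pow_le_pow_left₀ (norm_nonneg _) h5 _).trans (pow_le_pow_right₀ hσ (Nat.sub_le _ _))
  rw [Fintype.card_fin] at h3
  have h8 := one_le_factPow hβ n
  calc _ ≤ ‖iteratedFDeriv ℝ n (detMultilinear d) (columnsCLM d T)‖ * 1 := by gcongr
    _ ≤ (d : ℝ) ^ n * 1 * σmax ^ d * 1 := by
        refine mul_le_mul_of_nonneg_right (h3.trans ?_) zero_le_one
        gcongr
    _ = σmax ^ d * 1 * (d : ℝ) ^ n := by ring
    _ ≤ _ := by gcongr

end Det

section Coefficient

variable {d : ℕ} {b : ℕ → ℝ} {β C σmin σmax : ℝ} {J : (ℕ → ℝ) → Euc d →L[ℝ] Euc d}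

lemma IsGevrey.det (hb : ∀ j, 0 ≤ b j) (hβ : 1 ≤ β) (hC : 0 ≤ C) (hσ : 1 ≤ σmax)
    (hJ : IsGevrey b β C 1 J) (hJn : ∀ y ∈ paramSet, ‖J y‖ ≤ σmax) :
    IsGevrey b β (σmax ^ d) (C * d + 2) (fun y => (J y).det) :=
  IsGevrey.comp (Ω := univ) isOpen_univ hb hβ (fun _ _ => mem_univ _) hC (Nat.cast_nonneg d) hJ
    contDiff_det.contDiffOn (by positivity) fun y hy m =>
      norm_iteratedFDeriv_det_le (by linarith) hσ (hJn y hy) m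

lemma IsGevrey.inverse (hb : ∀ j, 0 ≤ b j) (hβ : 1 ≤ β) (hC : 0 ≤ C) (hσ : 0 < σmin)
    (hJ : IsGevrey b β C 1 J) {R : (ℕ → ℝ) → Euc d →L[ℝ] Euc d}
    (hJR : ∀ y ∈ paramSet, J y ∘L R y = .id ℝ _) (hRJ : ∀ y ∈ paramSet, R y ∘L J y = .id ℝ _)
    (hR : ∀ y ∈ paramSet, ‖R y‖ ≤ 1 / σmin) :
    IsGevrey b β (1 / σmin) (1 + C / σmin) R := by
  have hτ : (0 : ℝ) ≤ 1 / σmin := by positivity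
  have hcomp : ∀ A, ‖ContinuousLinearMap.compL ℝ (Euc d) (Euc d) (Euc d) A‖ ≤ 1 * ‖A‖ := fun A => by
    rw [one_mul]
    exact ContinuousLinearMap.opNorm_le_bound _ (norm_nonneg A) fun M => A.opNorm_comp_le M
  have hT : IsGevrey b β (1 * C) 1
      (fun y => ContinuousLinearMap.compL ℝ (Euc d) (Euc d) (Euc d) (J y)) :=
    hJ.clm _ hcomp zero_le_one
  have h := IsGevrey.solve hb hβ hτ (T := fun y =>
      ContinuousLinearMap.compL ℝ (Euc d) (Euc d) (Euc d) (J y))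
    (F := fun _ => ContinuousLinearMap.id ℝ (Euc d)) (u := R) (fun y hy M => ?_) (fun y hy M => ?_)
    (fun y hy => hJR y hy) (by positivity) zero_le_one zero_le_one le_rfl hT
    (IsGevrey.const β ContinuousLinearMap.norm_id_le)
  · convert h using 1 <;> ring
  · have e : M = R y ∘L (J y ∘L M) := by
      rw [← ContinuousLinearMap.comp_assoc, hRJ y hy, ContinuousLinearMap.id_comp]
    calc ‖M‖ = ‖R y ∘L (J y ∘L M)‖ := by rw [← e]
      _ ≤ _ := ContinuousLinearMap.opNorm_comp_le _ _
      _ ≤ _ := mul_le_mul_of_nonneg_right (hR y hy) (norm_nonneg _)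
  · exact ⟨R y ∘L M, by
      simp only [ContinuousLinearMap.compL_apply]
      rw [← ContinuousLinearMap.comp_assoc, hJR y hy, ContinuousLinearMap.id_comp]⟩

/-- The adjoint, as a continuous real linear map. -/
noncomputable def adjointCLM (d : ℕ) : (Euc d →L[ℝ] Euc d) →L[ℝ] (Euc d →L[ℝ] Euc d) :=
  LinearMap.mkContinuous
    { toFun := fun T => ContinuousLinearMap.adjoint T
      map_add' := fun S T => map_add _ S T
      map_smul' := fun c T => by simp } 1 fun T => by simp

lemma adjointCLM_apply (T : Euc d →L[ℝ] Euc d) :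
    adjointCLM d T = ContinuousLinearMap.adjoint T := rfl

lemma pullbackCoeff_eq {Vy : Euc d → Euc d} {x : Euc d} {R : Euc d →L[ℝ] Euc d}
    (h1 : fderiv ℝ Vy x ∘L R = .id ℝ _) (h2 : R ∘L fderiv ℝ Vy x = .id ℝ _) :
    pullbackCoeff Vy x = (fderiv ℝ Vy x).det • (R ∘L ContinuousLinearMap.adjoint R) := by
  set J := fderiv ℝ Vy x with hJ
  have h3 : ContinuousLinearMap.adjoint J ∘L ContinuousLinearMap.adjoint R = .id ℝ _ := by
    rw [← ContinuousLinearMap.adjoint_comp, h2, ContinuousLinearMap.adjoint_id]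
  have h4 : ContinuousLinearMap.adjoint R ∘L ContinuousLinearMap.adjoint J = .id ℝ _ := by
    rw [← ContinuousLinearMap.adjoint_comp, h1, ContinuousLinearMap.adjoint_id]
  rw [pullbackCoeff, ← hJ]
  congr 1
  refine ContinuousLinearMap.inverse_eq ?_ ?_
  · calc _ = ContinuousLinearMap.adjoint J ∘L (J ∘L R) ∘L ContinuousLinearMap.adjoint R := rfl
      _ = _ := by rw [h1, ContinuousLinearMap.id_comp, h3]
  · calc _ = R ∘L (ContinuousLinearMap.adjoint R ∘L ContinuousLinearMap.adjoint J) ∘L J := rfl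
      _ = _ := by rw [h4, ContinuousLinearMap.id_comp, h2]

lemma isGevrey_pullbackCoeff (hb : ∀ j, 0 ≤ b j) (hβ : 1 ≤ β) (hC : 0 ≤ C) (hσ0 : 0 < σmin)
    (hσ : 1 ≤ σmax) {V : (ℕ → ℝ) → Euc d → Euc d} {x : Euc d}
    (hJ : IsGevrey b β C 1 (fun y => fderiv ℝ (V y) x))
    (hmin : ∀ y ∈ paramSet, ∀ i < d,
      σmin ≤ (fderiv ℝ (V y) x : Euc d →ₗ[ℝ] Euc d).singularValues i)
    (hmax : ∀ y ∈ paramSet, ∀ i < d,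
      (fderiv ℝ (V y) x : Euc d →ₗ[ℝ] Euc d).singularValues i ≤ σmax) :
    IsGevrey b β (σmax ^ d / σmin ^ 2) (C * d + 2 + 2 * (1 + C / σmin))
      (fun y => pullbackCoeff (V y) x) := by
  choose! R hR1 hR2 hR3 using fun y (hy : y ∈ paramSet) =>
    exists_inverse_of_singularValues hσ0 (hmin y hy)
  have hnorm : ∀ y ∈ paramSet, ‖fderiv ℝ (V y) x‖ ≤ σmax := fun y hy =>
    ContinuousLinearMap.opNorm_le_bound _ (by linarith)
      (norm_apply_le_of_singularValues (by linarith) (hmax y hy))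
  have hdet := IsGevrey.det hb hβ hC hσ hJ hnorm
  have hRg := IsGevrey.inverse hb hβ hC hσ0 hJ hR1 hR2 hR3
  have hτ : (0 : ℝ) ≤ 1 / σmin := by positivity
  have hq : (0 : ℝ) ≤ 1 + C / σmin := by positivity
  have hRa : IsGevrey b β (1 * (1 / σmin)) (1 + C / σmin)
      (fun y => ContinuousLinearMap.adjoint (R y)) :=
    hRg.clm (adjointCLM d) (fun T => by rw [adjointCLM_apply]; simp) zero_le_one
  have hRR := IsGevrey.bilin hb hβ (ContinuousLinearMap.compL ℝ (Euc d) (Euc d) (Euc d))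
    (fun S T => S.opNorm_comp_le T) hτ (by positivity) hq hq hRg hRa
  have hA := IsGevrey.bilin hb hβ (ContinuousLinearMap.lsmul ℝ ℝ (E := Euc d →L[ℝ] Euc d))
    (fun c T => by simp [norm_smul]) (by positivity) (by positivity) (by positivity)
    (by positivity) hdet hRR
  have e1 : σmax ^ d * (1 / σmin * (1 * (1 / σmin))) = σmax ^ d / σmin ^ 2 := by field_simp
  have e2 : C * d + 2 + (1 + C / σmin + (1 + C / σmin)) = C * d + 2 + 2 * (1 + C / σmin) := by ring
  rw [e1, e2] at hA
  refine hA.congr fun y hy => ?_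
  simp [pullbackCoeff_eq (hR1 y hy) (hR2 y hy)]

/-- Coercivity of the pulled-back coefficient, up to the sign of the determinant. -/
lemma le_inner_pullbackCoeff (hσ0 : 0 < σmin) {m : ℝ} (hm : 0 < m) {Vy : Euc d → Euc d} {x : Euc d}
    (hmin : ∀ i < d, σmin ≤ (fderiv ℝ Vy x : Euc d →ₗ[ℝ] Euc d).singularValues i)
    (hJ : ‖fderiv ℝ Vy x‖ ≤ m) (ξ : Euc d) :
    σmin ^ d / m ^ 2 * ‖ξ‖ ^ 2 ≤
      SignType.sign (fderiv ℝ Vy x).det * inner ℝ (pullbackCoeff Vy x ξ) ξ := by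
  obtain ⟨R, hR1, hR2, -⟩ := exists_inverse_of_singularValues hσ0 hmin
  have hdet := pow_le_abs_det hσ0.le hmin
  have h3 : ContinuousLinearMap.adjoint (fderiv ℝ Vy x) (ContinuousLinearMap.adjoint R ξ) = ξ := by
    have : ContinuousLinearMap.adjoint (fderiv ℝ Vy x) ∘L ContinuousLinearMap.adjoint R =
        .id ℝ _ := by
      rw [← ContinuousLinearMap.adjoint_comp, hR2, ContinuousLinearMap.adjoint_id]
    exact DFunLike.congr_fun this ξ
  have h4 : ‖ξ‖ ≤ m * ‖ContinuousLinearMap.adjoint R ξ‖ := by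
    calc ‖ξ‖ = ‖ContinuousLinearMap.adjoint (fderiv ℝ Vy x) (ContinuousLinearMap.adjoint R ξ)‖ := by
          rw [h3]
      _ ≤ _ := ContinuousLinearMap.le_opNorm _ _
      _ ≤ _ := by
        rw [LinearIsometryEquiv.norm_map]
        exact mul_le_mul_of_nonneg_right hJ (norm_nonneg _)
  rw [pullbackCoeff_eq hR1 hR2]
  simp only [smul_apply, real_inner_smul_left, ContinuousLinearMap.comp_apply]
  rw [← ContinuousLinearMap.adjoint_inner_right, real_inner_self_eq_norm_sq, ← mul_assoc,
    sign_mul_self]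
  have h5 : ‖ξ‖ ^ 2 ≤ m ^ 2 * ‖ContinuousLinearMap.adjoint R ξ‖ ^ 2 := by
    rw [← mul_pow]; exact pow_le_pow_left₀ (norm_nonneg _) h4 2
  calc _ ≤ σmin ^ d / m ^ 2 * (m ^ 2 * ‖ContinuousLinearMap.adjoint R ξ‖ ^ 2) := by gcongr
    _ = σmin ^ d * ‖ContinuousLinearMap.adjoint R ξ‖ ^ 2 := by field_simp
    _ ≤ _ := by gcongr

end Coefficient

section Source

variable {d : ℕ}

lemma norm_iteratedFDeriv_le_of_mixedPartial {f : Euc d → ℝ} {n : ℕ} {x : Euc d} {K : ℝ}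
    {ρ : Fin d → ℝ} (hK : 0 ≤ K) (hρ : ∀ j, 0 ≤ ρ j)
    (h : ∀ k : Fin n → Fin d, |mixedPartial k f x| ≤ K * ∏ i, ρ (k i)) :
    ‖iteratedFDeriv ℝ n f x‖ ≤ K * (∑ j, ρ j) ^ n := by
  have hρ0 : 0 ≤ ∑ j, ρ j := Finset.sum_nonneg fun j _ => hρ j
  refine ContinuousMultilinearMap.opNorm_le_bound (by positivity) fun w => ?_
  have hw : ∀ v : Euc d, v = ∑ j, v j • EuclideanSpace.single j (1 : ℝ) := fun v => by
    have := (EuclideanSpace.basisFun (Fin d) ℝ).sum_repr v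
    simpa using this.symm
  have e : iteratedFDeriv ℝ n f x w =
      ∑ k : Fin n → Fin d, (∏ i, w i (k i)) * mixedPartial k f x := by
    conv_lhs => rw [show w = fun i => ∑ j, w i j • EuclideanSpace.single j (1 : ℝ) from
      funext fun i => hw (w i)]
    rw [ContinuousMultilinearMap.map_sum]
    refine Finset.sum_congr rfl fun k _ => ?_
    rw [ContinuousMultilinearMap.map_smul_univ]
    rfl
  have hcoord : ∀ (v : Euc d) j, |v j| ≤ ‖v‖ := fun v j => by
    simpa using PiLp.norm_apply_le v j
  rw [e]
  calc _ ≤ ∑ k : Fin n → Fin d, (∏ i, ‖w i‖) * (K * ∏ i, ρ (k i)) := by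
        refine norm_sum_le_of_le _ fun k _ => ?_
        rw [norm_mul, Real.norm_eq_abs, Real.norm_eq_abs, Finset.abs_prod]
        refine mul_le_mul (Finset.prod_le_prod (fun _ _ => abs_nonneg _) fun i _ => hcoord _ _)
          (h k) (abs_nonneg _) (Finset.prod_nonneg fun _ _ => norm_nonneg _)
    _ = K * (∑ k : Fin n → Fin d, ∏ i, ρ (k i)) * ∏ i, ‖w i‖ := by
        rw [← Finset.mul_sum, ← Finset.mul_sum]; ring
    _ = _ := by
        rw [← Fintype.piFinset_univ, ← Finset.prod_univ_sum]
        simp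

lemma sum_le_rhoNorm {β : ℝ} (hβ : 1 ≤ β) {ρ : Fin d → ℝ} (hρ : ∀ j, 0 ≤ ρ j) :
    ∑ j, ρ j ≤ rhoNorm β ρ := by
  have key : ∀ (s : Finset (Fin d)) (a : Fin d → ℝ), (∀ j, 0 ≤ a j) →
      ∑ j ∈ s, a j ^ β ≤ (∑ j ∈ s, a j) ^ β := by
    intro s a ha
    induction s using Finset.induction_on with
    | empty => simp [Real.zero_rpow (by linarith : β ≠ 0)]
    | insert i s hi ih =>
      rw [Finset.sum_insert hi, Finset.sum_insert hi]
      exact (add_le_add_right ih _).trans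
        (Real.add_rpow_le_rpow_add (ha i) (Finset.sum_nonneg fun j _ => ha j) hβ)
  refine le_trans (le_of_eq (Finset.sum_congr rfl fun j _ => ?_))
    (key Finset.univ (fun j => ρ j ^ (1 / β)) fun j => Real.rpow_nonneg (hρ j) _)
  rw [← Real.rpow_mul (hρ j), one_div_mul_cancel (by linarith), Real.rpow_one]

lemma isOpen_holdAll {D : Set (Euc d)} (hD : IsOpen D) {V : (ℕ → ℝ) → Euc d → Euc d}
    (hV : ∀ y ∈ paramSet, ContDiffOn ℝ 1 (V y) D) {σmin : ℝ} (hσ0 : 0 < σmin)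
    (hmin : ∀ x ∈ D, ∀ y ∈ paramSet, ∀ i < d,
      σmin ≤ (fderiv ℝ (V y) x : Euc d →ₗ[ℝ] Euc d).singularValues i) :
    IsOpen (holdAll D V) := by
  refine isOpen_biUnion fun y hy => ?_
  rw [isOpen_iff_mem_nhds]
  rintro _ ⟨x, hx, rfl⟩
  obtain ⟨R, hR1, hR2, -⟩ := exists_inverse_of_singularValues hσ0 (hmin x hx y hy)
  have hs : HasStrictFDerivAt (V y) (fderiv ℝ (V y) x) x :=
    ((hV y hy).contDiffAt (hD.mem_nhds hx)).hasStrictFDerivAt (by simp)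
  have hmap := hs.map_nhds_eq_of_equiv
    (f' := ContinuousLinearEquiv.equivOfInverse' (fderiv ℝ (V y) x) R hR1 hR2)
  rw [← hmap]
  exact Filter.image_mem_map (hD.mem_nhds hx)

lemma isGevrey_pullbackSource {b : ℕ → ℝ} {β C σmax Cf : ℝ} (hb : ∀ j, 0 ≤ b j) (hβ : 1 ≤ β)
    (hC : 0 ≤ C) (hσ : 1 ≤ σmax) (hCf : 0 ≤ Cf) {D : Set (Euc d)} {V : (ℕ → ℝ) → Euc d → Euc d}
    {f : Euc d → ℝ} {ρ : Fin d → ℝ} (hρ : ∀ j, 0 ≤ ρ j) (hΩ : IsOpen (holdAll D V))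
    (hf : GevreySource (holdAll D V) f Cf β ρ) {x : Euc d} (hx : x ∈ D)
    (hV : IsGevrey b β C 1 (fun y => V y x))
    (hJ : IsGevrey b β C 1 (fun y => fderiv ℝ (V y) x))
    (hJn : ∀ y ∈ paramSet, ‖fderiv ℝ (V y) x‖ ≤ σmax) :
    IsGevrey b β (Cf * σmax ^ d) (C * ∑ j, ρ j + 2 + (C * d + 2))
      (fun y => pullbackSource f (V y) x) := by
  have hmem : ∀ y ∈ paramSet, V y x ∈ holdAll D V := fun y hy =>
    mem_biUnion hy (mem_image_of_mem _ hx)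
  have hρ0 : 0 ≤ ∑ j, ρ j := Finset.sum_nonneg fun j _ => hρ j
  have h1 := IsGevrey.comp hΩ hb hβ hmem hC hρ0 hV hf.1 hCf fun y hy m =>
    norm_iteratedFDeriv_le_of_mixedPartial (mul_nonneg hCf (factPow_nonneg _ _)) hρ fun k =>
      hf.2 m k _ (hmem y hy)
  exact IsGevrey.bilin hb hβ (ContinuousLinearMap.mul ℝ ℝ) (fun a c => by simp) hCf
    (by positivity) (by positivity) (by positivity) h1 (IsGevrey.det hb hβ hC hσ hJ hJn)

end Source

/-! ### From pointwise Gevrey regularity to regularity with values in `L^∞` -/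

lemma hasDerivWithinAt_of_norm_sub_le {E : Type*} [NormedAddCommGroup E] [NormedSpace ℝ E]
    {S : Set ℝ} {g : ℝ → E} {g' : E} {s K : ℝ}
    (h : ∀ t ∈ S, ‖g t - g s - (t - s) • g'‖ ≤ K * |t - s| ^ 2) : HasDerivWithinAt g g' S s := by
  rw [hasDerivWithinAt_iff_isLittleO]
  have h1 : (fun t => g t - g s - (t - s) • g') =O[𝓝[S] s] fun t => (t - s) ^ 2 := by
    refine Asymptotics.IsBigO.of_bound K ?_
    filter_upwards [self_mem_nhdsWithin] with t ht
    rw [norm_pow, Real.norm_eq_abs]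
    exact h t ht
  refine h1.trans_isLittleO ?_
  have h2 : Filter.Tendsto (fun t => t - s) (𝓝[S] s) (𝓝 0) := by
    have : Filter.Tendsto (fun t => t - s) (𝓝 s) (𝓝 (s - s)) :=
      (continuous_id.sub continuous_const).tendsto s
    rw [sub_self] at this
    exact this.mono_left nhdsWithin_le_nhds
  simpa [pow_two] using
    (Asymptotics.isLittleO_one_iff ℝ).2 h2 |>.mul_isBigO (Asymptotics.isBigO_refl (fun t => t - s) _)

lemma norm_lp_top_le {α W : Type*} [MeasurableSpace α] {μ : Measure α} [IsFiniteMeasure μ]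
    [NormedAddCommGroup W] (F : Lp W ⊤ μ) {c : ℝ} (hc : 0 ≤ c) (h : ∀ᵐ x ∂μ, ‖F x‖ ≤ c) :
    ‖F‖ ≤ c := by
  have := Lp.norm_le_of_ae_bound hc h
  simpa using this

/-- A function that is Gevrey regular in the parameter at every point, with uniform constants, is
Gevrey regular as a map into `L^∞`: second order Taylor expansion in one parameter shows that the
difference quotients converge uniformly. -/
lemma exists_isGevrey_lp_top {d : ℕ} {D : Set (Euc d)} (hD : IsOpen D)
    (hDb : Bornology.IsBounded D) {W : Type*} [NormedAddCommGroup W] [NormedSpace ℝ W]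
    {b : ℕ → ℝ} (hb : ∀ j, 0 ≤ b j) {β K q : ℝ} (hK : 0 ≤ K) (hq : 0 ≤ q)
    {a : (ℕ → ℝ) → Euc d → W}
    (ha : ∀ x ∈ D, IsGevrey b β K q (fun y => a y x))
    (ham : ∀ y ∈ paramSet, AEStronglyMeasurable (a y) (volume.restrict D)) :
    ∃ A : (ℕ → ℝ) → Lp W ⊤ (volume.restrict D), IsGevrey b β K q A ∧
      ∀ y ∈ paramSet, A y =ᵐ[volume.restrict D] a y := by
  classical
  have hfin := isFiniteMeasure_restrict hDb
  have hmem : ∀ᵐ x ∂(volume.restrict D), x ∈ D := ae_restrict_mem hD.measurableSet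
  choose! G hG hGb using ha
  let Bd : (ℕ →₀ ℕ) → ℝ := fun ν => K * q ^ ν.degree * factPow β ν.degree * mpow b ν
  have hBd0 : ∀ ν, 0 ≤ Bd ν := fun ν =>
    mul_nonneg (mul_nonneg (by positivity) (factPow_nonneg _ _)) (mpow_nonneg hb ν)
  have hder : ∀ x ∈ D, ∀ ν j, ∀ y ∈ paramSet, ∀ t ∈ Icc (-(1 / 2) : ℝ) (1 / 2),
      HasDerivWithinAt (fun t => G x ν (Function.update y j t))
        (G x (ν + Finsupp.single j 1) (Function.update y j t)) (Icc (-(1 / 2) : ℝ) (1 / 2)) t := by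
    intro x hx ν j y hy t ht
    have h1 := (hG x hx).2 ν j _ (update_mem_paramSet hy j ht)
    simpa only [Function.update_idem, Function.update_self] using h1
  -- measurability passes to the derivatives, as limits of difference quotients
  have hmeas : ∀ n, ∀ ν : ℕ →₀ ℕ, ν.degree = n → ∀ y ∈ paramSet,
      AEStronglyMeasurable (fun x => G x ν y) (volume.restrict D) := by
    intro n
    induction n with
    | zero =>
      intro ν hν y hy
      obtain rfl := (Finsupp.degree_eq_zero_iff ν).1 hν
      refine (ham y hy).congr ?_
      filter_upwards [hmem] with x hx using ((hG x hx).1 y hy).symm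
    | succ n ih =>
      intro ν hν y hy
      obtain ⟨j, μ, rfl⟩ := exists_eq_add_single (ν := ν) (by rintro rfl; simp at hν)
      rw [degree_add_single] at hν
      have hne : (𝓝[Icc (-(1 / 2) : ℝ) (1 / 2) \ {y j}] (y j)).NeBot := by
        rw [← accPt_principal_iff_nhdsWithin]
        exact (uniqueDiffOn_Icc neg_half_lt_half _ (hy j)).accPt
      have hcl : y j ∈ closure (Icc (-(1 / 2) : ℝ) (1 / 2) \ {y j}) :=
        mem_closure_iff_nhdsWithin_neBot.2 hne
      obtain ⟨τ, hτ, hτl⟩ := mem_closure_iff_seq_limit.1 hcl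
      have hτ' : Filter.Tendsto τ Filter.atTop (𝓝[Icc (-(1 / 2) : ℝ) (1 / 2) \ {y j}] (y j)) :=
        tendsto_nhdsWithin_iff.2 ⟨hτl, Filter.Eventually.of_forall hτ⟩
      refine aestronglyMeasurable_of_tendsto_ae Filter.atTop
        (f := fun n x => slope (fun t => G x μ (Function.update y j t)) (y j) (τ n))
        (fun n => ?_) ?_
      · simp only [slope_def_module, Function.update_eq_self]
        exact ((ih μ (by omega) _ (update_mem_paramSet hy j (hτ n).1)).sub
          (ih μ (by omega) y hy)).const_smul _
      · filter_upwards [hmem] with x hx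
        have := hasDerivWithinAt_iff_tendsto_slope.1 ((hG x hx).2 μ j y hy)
        exact this.comp hτ'
  have hbdd : ∀ ν, ∀ y ∈ paramSet, ∀ᵐ x ∂(volume.restrict D), ‖G x ν y‖ ≤ Bd ν := fun ν y hy =>
    hmem.mono fun x hx => hGb x hx ν y hy
  have hLp : ∀ ν, ∀ y ∈ paramSet, MemLp (fun x => G x ν y) ⊤ (volume.restrict D) := fun ν y hy =>
    memLp_top_of_bound (hmeas _ ν rfl y hy) _ (hbdd ν y hy)
  -- off the parameter set the value is irrelevant
  let A : (ℕ →₀ ℕ) → (ℕ → ℝ) → Lp W ⊤ (volume.restrict D) := fun ν y =>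
    if hy : y ∈ paramSet then (hLp ν y hy).toLp else 0
  have hA : ∀ ν, ∀ y ∈ paramSet, A ν y =ᵐ[volume.restrict D] fun x => G x ν y := by
    intro ν y hy
    simp only [A, dif_pos hy]
    exact MemLp.coeFn_toLp _
  refine ⟨A 0, ⟨A, ⟨fun _ _ => rfl, fun ν j y hy => ?_⟩, fun ν y hy => ?_⟩, fun y hy => ?_⟩
  · refine hasDerivWithinAt_of_norm_sub_le
      (K := Bd (ν + Finsupp.single j 1 + Finsupp.single j 1)) fun t ht => ?_
    rw [Function.update_eq_self]
    refine norm_lp_top_le _ (mul_nonneg (hBd0 _) (sq_nonneg _)) ?_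
    have hy' := update_mem_paramSet hy j ht
    filter_upwards [Lp.coeFn_sub (A ν (Function.update y j t) - A ν y)
      ((t - y j) • A (ν + Finsupp.single j 1) y), Lp.coeFn_sub (A ν (Function.update y j t)) (A ν y),
      Lp.coeFn_smul (t - y j) (A (ν + Finsupp.single j 1) y), hA ν _ hy', hA ν y hy,
      hA (ν + Finsupp.single j 1) y hy, hmem] with x h1 h2 h3 h4 h5 h6 hx
    rw [h1, Pi.sub_apply, h2, Pi.sub_apply, h3, Pi.smul_apply, h4, h5, h6]
    have := norm_taylor_two_le (hder x hx ν j y hy) (hder x hx (ν + Finsupp.single j 1) j y hy)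
      (fun t ht => hGb x hx _ _ (update_mem_paramSet hy j ht)) (hy j) ht
    simpa only [Function.update_eq_self] using this
  · refine norm_lp_top_le _ (hBd0 ν) ?_
    filter_upwards [hA ν y hy, hbdd ν y hy] with x h1 h2
    rw [h1]; exact h2
  · filter_upwards [hA 0 y hy, hmem] with x h1 hx
    rw [h1]; exact (hG x hx).1 y hy

/-! ### The Poincaré inequality and the gradient on `H_0^1(D)` -/

section H01

variable {d : ℕ} {D : Set (Euc d)}

/-- The pairs `(φ, ∇φ)`, `φ ∈ C_c^∞(D)`; their span is dense in `H_0^1(D)`. -/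
def testPairs (D : Set (Euc d)) : Set (L2Pair D) :=
  {p : L2Pair D | ∃ φ : Euc d → ℝ, IsTestFunction D φ ∧
    p.fst =ᵐ[volume.restrict D] φ ∧ p.snd =ᵐ[volume.restrict D] gradient φ}

lemma norm_gradient (φ : Euc d → ℝ) (x : Euc d) : ‖gradient φ x‖ = ‖fderiv ℝ φ x‖ := by
  simp [gradient]

/-- The set of the pairs `(φ, ∇φ)` is already a subspace. -/
lemma mem_testPairs_of_mem_span {p : L2Pair D} (hp : p ∈ Submodule.span ℝ (testPairs D)) :
    p ∈ testPairs D := by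
  induction hp using Submodule.span_induction with
  | mem p hp => exact hp
  | zero =>
    refine ⟨0, ⟨contDiff_const, HasCompactSupport.zero, by simp⟩, ?_, ?_⟩
    · exact Lp.coeFn_zero _ _ _
    · have : gradient (0 : Euc d → ℝ) = 0 := by
        ext1 x
        simp [gradient]
      rw [this]
      exact Lp.coeFn_zero _ _ _
  | add p q _ _ hp hq =>
    obtain ⟨φ, hφ, h1, h2⟩ := hp
    obtain ⟨ψ, hψ, h3, h4⟩ := hq
    refine ⟨φ + ψ, ⟨hφ.1.add hψ.1, hφ.2.1.add hψ.2.1, ?_⟩, ?_, ?_⟩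
    · exact (tsupport_add φ ψ).trans (union_subset hφ.2.2 hψ.2.2)
    · exact (Lp.coeFn_add _ _).trans (h1.add h3)
    · refine (Lp.coeFn_add _ _).trans ((h2.add h4).trans (Filter.Eventually.of_forall fun x => ?_))
      have e1 := (hφ.1.differentiable (by simp)) x
      have e2 := (hψ.1.differentiable (by simp)) x
      simp [gradient, fderiv_add e1 e2]
  | smul c p _ hp =>
    obtain ⟨φ, hφ, h1, h2⟩ := hp
    refine ⟨c • φ, ⟨hφ.1.const_smul c, hφ.2.1.smul_left (f := fun _ => c), ?_⟩, ?_, ?_⟩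
    · exact (tsupport_smul_subset_right (fun _ => c) φ).trans hφ.2.2
    · exact (Lp.coeFn_smul _ _).trans (h1.const_smul c)
    · refine (Lp.coeFn_smul _ _).trans
        ((h2.const_smul c).trans (Filter.Eventually.of_forall fun x => ?_))
      have e1 := (hφ.1.differentiable (by simp)) x
      simp [gradient, fderiv_const_smul e1]

/-- The Poincaré inequality for test functions, from integrating the derivative of `x ↦ x_i φ(x)²`
in the direction `e_i`. -/
lemma IsTestFunction.integral_sq_le {φ : Euc d → ℝ} (hφ : IsTestFunction D φ) (i : Fin d) {R : ℝ}
    (hR : D ⊆ Metric.ball 0 R) :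
    ∫ x in D, φ x ^ 2 ≤ (2 * R) ^ 2 * ∫ x in D, ‖gradient φ x‖ ^ 2 := by
  have hz : ∀ x ∉ D, φ x = 0 := fun x hx => image_eq_zero_of_notMem_tsupport fun h => hx (hφ.2.2 h)
  have hz' : ∀ x ∉ D, ‖gradient φ x‖ = 0 := fun x hx => by
    rw [norm_gradient, norm_eq_zero]
    exact image_eq_zero_of_notMem_tsupport fun h => hx (hφ.2.2 (tsupport_fderiv_subset ℝ h))
  rw [setIntegral_eq_integral_of_forall_compl_eq_zero (fun x hx => by simp [hz x hx]),
    setIntegral_eq_integral_of_forall_compl_eq_zero (fun x hx => by simp [hz' x hx])]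
  have hcoord : ContDiff ℝ ∞ fun x : Euc d => x i := by fun_prop
  let ψ : Euc d → ℝ := fun x => x i * (φ x * φ x)
  have hψ : ContDiff ℝ ∞ ψ := hcoord.mul (hφ.1.mul hφ.1)
  have hψc : HasCompactSupport ψ := (hφ.2.1.mul_left (f := φ)).mul_left
  have h0 := integral_fderiv_apply_eq_zero (hψ.of_le (by exact_mod_cast le_top)) hψc
    (EuclideanSpace.single i (1 : ℝ))
  have hd : Differentiable ℝ φ := hφ.1.differentiable (by simp)
  have hder : ∀ x, fderiv ℝ ψ x (EuclideanSpace.single i (1 : ℝ)) =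
      φ x ^ 2 + 2 * x i * φ x * fderiv ℝ φ x (EuclideanSpace.single i (1 : ℝ)) := by
    intro x
    have e1 : HasFDerivAt (fun x : Euc d => x i) (EuclideanSpace.proj i : Euc d →L[ℝ] ℝ) x :=
      (EuclideanSpace.proj i : Euc d →L[ℝ] ℝ).hasFDerivAt
    have e2 := e1.mul ((hd x).hasFDerivAt.mul (hd x).hasFDerivAt)
    have e3 : fderiv ℝ ψ x = _ := e2.fderiv
    rw [e3]
    simp
    ring
  have hc1 : Continuous fun x => fderiv ℝ ψ x (EuclideanSpace.single i (1 : ℝ)) :=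
    (hψ.continuous_fderiv (by simp)).clm_apply continuous_const
  have hs1 : HasCompactSupport fun x => fderiv ℝ ψ x (EuclideanSpace.single i (1 : ℝ)) :=
    hψc.fderiv_apply (𝕜 := ℝ) _
  have hi1 := hc1.integrable_of_hasCompactSupport (μ := volume) hs1
  have hi2 : Integrable fun x => φ x ^ 2 := by
    refine (hφ.1.continuous.pow 2).integrable_of_hasCompactSupport ?_
    simpa [pow_two] using (hφ.2.1.mul_left (f := φ))
  have hi3 : Integrable fun x => ‖gradient φ x‖ ^ 2 := by
    simp only [norm_gradient]
    refine ((hφ.1.continuous_fderiv (by simp)).norm.pow 2).integrable_of_hasCompactSupport ?_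
    have h1 : HasCompactSupport fun x => ‖fderiv ℝ φ x‖ := (hφ.2.1.fderiv (𝕜 := ℝ)).norm
    simpa only [pow_two] using h1.mul_left (f := fun x => ‖fderiv ℝ φ x‖)
  -- `φ² + 2 x_i φ ∂_i φ ≥ φ² / 2 - 2 (x_i ∂_i φ)²`, and `|x_i| ≤ R` on the support of `φ`
  have key : ∫ x, (1 / 2 * φ x ^ 2 - 2 * R ^ 2 * ‖gradient φ x‖ ^ 2) ≤
      ∫ x, fderiv ℝ ψ x (EuclideanSpace.single i (1 : ℝ)) := by
    refine integral_mono ((hi2.const_mul _).sub (hi3.const_mul _)) hi1 fun x => ?_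
    simp only [hder]
    by_cases hx : x ∈ D
    · have hxR : ‖x‖ < R := by simpa using hR hx
      have hR0 : 0 ≤ R := (norm_nonneg x).trans hxR.le
      have hxi : |x i| ≤ R := (by simpa using PiLp.norm_apply_le x i : |x i| ≤ ‖x‖).trans hxR.le
      have hg : |fderiv ℝ φ x (EuclideanSpace.single i (1 : ℝ))| ≤ ‖gradient φ x‖ := by
        rw [norm_gradient]
        simpa using (fderiv ℝ φ x).le_opNorm (EuclideanSpace.single i (1 : ℝ))
      have h1 : (x i * fderiv ℝ φ x (EuclideanSpace.single i (1 : ℝ))) ^ 2 ≤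
          (R * ‖gradient φ x‖) ^ 2 := by
        rw [← sq_abs, abs_mul]
        gcongr
      nlinarith [sq_nonneg (φ x + 2 * (x i * fderiv ℝ φ x (EuclideanSpace.single i (1 : ℝ))))]
    · simp [hz x hx, hz' x hx]
  rw [h0, integral_sub (hi2.const_mul _) (hi3.const_mul _), integral_const_mul,
    integral_const_mul] at key
  linarith

lemma norm_sq_lp_two_eq_integral {α E : Type*} [MeasurableSpace α] {μ : Measure α}
    [NormedAddCommGroup E] [InnerProductSpace ℝ E] (g : Lp E 2 μ) : ‖g‖ ^ 2 = ∫ x, ‖g x‖ ^ 2 ∂μ := by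
  rw [← real_inner_self_eq_norm_sq, L2.inner_def]
  simp

lemma exists_norm_h01Val_le (hd : 0 < d) (hDb : Bornology.IsBounded D) :
    ∃ c, 0 ≤ c ∧ ∀ v : H01 D, ‖h01Val v‖ ≤ c * h01Norm v := by
  obtain ⟨R, hR0, hR⟩ := hDb.subset_ball_lt 0 0
  refine ⟨2 * R, by positivity, fun v => ?_⟩
  have hcl : IsClosed {p : L2Pair D | ‖p.fst‖ ≤ 2 * R * ‖p.snd‖} :=
    isClosed_le (by fun_prop) (by fun_prop)
  refine closure_minimal ?_ hcl v.2
  intro p hp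
  obtain ⟨φ, hφ, h1, h2⟩ := mem_testPairs_of_mem_span hp
  have h3 := hφ.integral_sq_le ⟨0, hd⟩ hR
  change ‖p.fst‖ ≤ 2 * R * ‖p.snd‖
  refine (pow_le_pow_iff_left₀ (by positivity) (by positivity) two_ne_zero).1 ?_
  rw [mul_pow, norm_sq_lp_two_eq_integral, norm_sq_lp_two_eq_integral]
  calc ∫ x in D, ‖p.fst x‖ ^ 2 = ∫ x in D, φ x ^ 2 := by
        refine integral_congr_ae ?_
        filter_upwards [h1] with x hx
        simp [hx]
    _ ≤ _ := h3
    _ = _ := by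
        congr 1
        refine integral_congr_ae ?_
        filter_upwards [h2] with x hx
        simp [hx]

lemma poincareConst_nonneg (D : Set (Euc d)) : 0 ≤ poincareConst D :=
  Real.sInf_nonneg fun _ hc => hc.1

lemma norm_h01Val_le (hd : 0 < d) (hDb : Bornology.IsBounded D) (v : H01 D) :
    ‖h01Val v‖ ≤ poincareConst D * h01Norm v := by
  obtain ⟨c, hc0, hc⟩ := exists_norm_h01Val_le hd hDb
  have hv0 : 0 ≤ h01Norm v := norm_nonneg _
  rcases hv0.eq_or_lt with h0 | h0
  · have := hc v
    rwa [← h0, mul_zero] at this ⊢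
  · rw [← div_le_iff₀ h0]
    refine le_csInf ⟨c, hc0, hc⟩ fun c' hc' => ?_
    rw [div_le_iff₀ h0]
    exact hc'.2 v

/-- The weak gradient `H_0^1(D) → L²(D; ℝ^d)` as a bounded operator for the `H^1`-norm. -/
noncomputable def gradCLM (D : Set (Euc d)) : H01 D →L[ℝ] Lp (Euc d) 2 (volume.restrict D) :=
  (WithLp.sndL 2 ℝ (Lp ℝ 2 (volume.restrict D)) (Lp (Euc d) 2 (volume.restrict D))).comp
    (H01 D).subtypeL

/-- The embedding `H_0^1(D) → L²(D)` as a bounded operator for the `H^1`-norm. -/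
noncomputable def valCLM (D : Set (Euc d)) : H01 D →L[ℝ] Lp ℝ 2 (volume.restrict D) :=
  (WithLp.fstL 2 ℝ (Lp ℝ 2 (volume.restrict D)) (Lp (Euc d) 2 (volume.restrict D))).comp
    (H01 D).subtypeL

/-- By the Poincaré inequality the gradient controls the full `H^1`-norm. -/
lemma norm_le_norm_h01Grad (hd : 0 < d) (hDb : Bornology.IsBounded D) (v : H01 D) :
    ‖v‖ ≤ (poincareConst D + 1) * ‖h01Grad v‖ := by
  have h1 := norm_h01Val_le hd hDb v
  have h0 := poincareConst_nonneg D
  refine (pow_le_pow_iff_left₀ (by positivity) (by positivity) two_ne_zero).1 ?_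
  have h2 : ‖v‖ ^ 2 = ‖h01Val v‖ ^ 2 + ‖h01Grad v‖ ^ 2 := WithLp.prod_norm_sq_eq_of_L2 (v : L2Pair D)
  have h3 : ‖h01Val v‖ ^ 2 ≤ (poincareConst D * ‖h01Grad v‖) ^ 2 := by gcongr; exact h1
  nlinarith [mul_nonneg h0 (sq_nonneg ‖h01Grad v‖)]

lemma completeSpace_h01 : CompleteSpace (H01 D) :=
  (Submodule.isClosed_topologicalClosure _).completeSpace_coe

lemma antilipschitz_gradCLM (hd : 0 < d) (hDb : Bornology.IsBounded D) :
    AntilipschitzWith (Real.toNNReal (poincareConst D + 1)) (gradCLM D) :=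
  AddMonoidHomClass.antilipschitz_of_bound _ fun v => by
    rw [Real.coe_toNNReal _ (by linarith [poincareConst_nonneg D])]
    exact norm_le_norm_h01Grad hd hDb v

lemma isClosed_range_gradCLM (hd : 0 < d) (hDb : Bornology.IsBounded D) :
    IsClosed (range (gradCLM D)) :=
  have := completeSpace_h01 (D := D)
  (antilipschitz_gradCLM hd hDb).isClosed_range (gradCLM D).uniformContinuous

/-- The space of the weak gradients of `H_0^1(D)`, with the norm of `L²(D; ℝ^d)`. By the Poincaré
inequality it is an isometric copy of `H_0^1(D)` with the norm `‖∇v‖_{L²(D)}`. -/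
def GradSpace (D : Set (Euc d)) : Type := (gradCLM D).range

noncomputable instance (D : Set (Euc d)) : NormedAddCommGroup (GradSpace D) :=
  inferInstanceAs (NormedAddCommGroup (gradCLM D).range)

noncomputable instance (D : Set (Euc d)) : InnerProductSpace ℝ (GradSpace D) :=
  inferInstanceAs (InnerProductSpace ℝ (gradCLM D).range)

/-- The inclusion of the space of gradients into `L²(D; ℝ^d)`. -/
noncomputable def gradIncl (D : Set (Euc d)) :
    GradSpace D →L[ℝ] Lp (Euc d) 2 (volume.restrict D) :=
  (gradCLM D).range.subtypeL

lemma norm_gradIncl (g : GradSpace D) : ‖gradIncl D g‖ = ‖g‖ := rfl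

lemma exists_gradIncl_eq (v : H01 D) : ∃ g : GradSpace D, gradIncl D g = h01Grad v :=
  ⟨(⟨h01Grad v, v, rfl⟩ : (gradCLM D).range), rfl⟩

lemma exists_h01Grad_eq (g : GradSpace D) : ∃ v : H01 D, h01Grad v = gradIncl D g :=
  g.2

lemma completeSpace_gradSpace (hd : 0 < d) (hDb : Bornology.IsBounded D) :
    CompleteSpace (GradSpace D) :=
  (isClosed_range_gradCLM hd hDb).completeSpace_coe

/-- The identification of `H_0^1(D)` with the space of gradients. -/
noncomputable def gradEquiv (hd : 0 < d) (hDb : Bornology.IsBounded D) : H01 D ≃L[ℝ] GradSpace D :=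
  have := completeSpace_h01 (D := D)
  (gradCLM D).equivRange (antilipschitz_gradCLM hd hDb).injective (isClosed_range_gradCLM hd hDb)

lemma gradIncl_gradEquiv (hd : 0 < d) (hDb : Bornology.IsBounded D) (v : H01 D) :
    gradIncl D (gradEquiv hd hDb v) = h01Grad v := rfl

lemma h01Norm_gradEquiv_symm (hd : 0 < d) (hDb : Bornology.IsBounded D) (g : GradSpace D) :
    h01Norm ((gradEquiv hd hDb).symm g) = ‖g‖ := by
  rw [h01Norm, ← gradIncl_gradEquiv hd hDb, norm_gradIncl, ContinuousLinearEquiv.apply_symm_apply]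

/-! ### Locally constant multipliers of `H_0^1(D)` -/

lemma IsTestFunction.locallyConst_mul {s : Euc d → ℝ}
    (hs : ∀ x ∈ D, ∀ᶠ z in 𝓝 x, s z = s x) {φ : Euc d → ℝ} (hφ : IsTestFunction D φ) :
    IsTestFunction D (fun x => s x * φ x) ∧
      ∀ x ∈ D, gradient (fun x => s x * φ x) x = s x • gradient φ x := by
  have hloc : ∀ x ∈ D, (fun z => s z * φ z) =ᶠ[𝓝 x] s x • φ := fun x hx => by
    filter_upwards [hs x hx] with z hz
    simp [hz]
  refine ⟨⟨?_, hφ.2.1.mul_left, (tsupport_mul_subset_right).trans hφ.2.2⟩, fun x hx => ?_⟩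
  · rw [contDiff_iff_contDiffAt]
    intro x
    by_cases hx : x ∈ D
    · exact (hφ.1.const_smul (s x)).contDiffAt.congr_of_eventuallyEq (hloc x hx)
    · have h0 : φ =ᶠ[𝓝 x] 0 := notMem_tsupport_iff_eventuallyEq.1 fun h => hx (hφ.2.2 h)
      refine (contDiffAt_const (c := (0 : ℝ))).congr_of_eventuallyEq ?_
      filter_upwards [h0] with z hz
      simp [hz]
  · have e1 := (hφ.1.differentiable (by simp)) x
    rw [gradient, (hloc x hx).fderiv_eq, fderiv_const_smul e1, gradient]
    simp

/-- A bounded function that is locally constant on `D` maps `H_0^1(D)` into itself by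
multiplication, and commutes with the weak gradient. -/
lemma exists_h01Grad_eq_locallyConst_smul (hD : IsOpen D) (hDb : Bornology.IsBounded D)
    {s : Euc d → ℝ}
    (hs : ∀ x ∈ D, ∀ᶠ z in 𝓝 x, s z = s x) (hs1 : ∀ x, |s x| ≤ 1) (v : H01 D) :
    ∃ v' : H01 D, h01Grad v' =ᵐ[volume.restrict D] fun x => s x • h01Grad v x := by
  have hfin := isFiniteMeasure_restrict hDb
  have hsm : AEStronglyMeasurable s (volume.restrict D) := by
    refine ContinuousOn.aestronglyMeasurable (fun x hx => ?_) hD.measurableSet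
    exact (continuousAt_const.congr (Filter.EventuallyEq.symm (hs x hx))).continuousWithinAt
  have hsL : MemLp s ⊤ (volume.restrict D) := memLp_top_of_bound hsm 1 (.of_forall hs1)
  let m₁ := (ContinuousLinearMap.lsmul ℝ ℝ : ℝ →L[ℝ] ℝ →L[ℝ] ℝ).holderL (volume.restrict D) ⊤ 2 2
    (hsL.toLp s)
  let m₂ := (ContinuousLinearMap.lsmul ℝ ℝ : ℝ →L[ℝ] Euc d →L[ℝ] Euc d).holderL
    (volume.restrict D) ⊤ 2 2 (hsL.toLp s)
  have hm₁ : ∀ g, m₁ g =ᵐ[volume.restrict D] fun x => s x • g x := fun g => by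
    filter_upwards [ContinuousLinearMap.coeFn_holder (r := 2)
      (ContinuousLinearMap.lsmul ℝ ℝ : ℝ →L[ℝ] ℝ →L[ℝ] ℝ) (hsL.toLp s) g, hsL.coeFn_toLp] with x h1 h2
    rw [h2] at h1
    exact h1
  have hm₂ : ∀ g, m₂ g =ᵐ[volume.restrict D] fun x => s x • g x := fun g => by
    filter_upwards [ContinuousLinearMap.coeFn_holder (r := 2)
      (ContinuousLinearMap.lsmul ℝ ℝ : ℝ →L[ℝ] Euc d →L[ℝ] Euc d) (hsL.toLp s) g,
      hsL.coeFn_toLp] with x h1 h2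
    rw [h2] at h1
    exact h1
  let Φ : L2Pair D → L2Pair D := fun p => WithLp.toLp 2 (m₁ p.fst, m₂ p.snd)
  have hΦ : Continuous Φ := by fun_prop
  have hmaps : MapsTo Φ (Submodule.span ℝ (testPairs D)) (Submodule.span ℝ (testPairs D)) := by
    intro p hp
    obtain ⟨φ, hφ, h1, h2⟩ := mem_testPairs_of_mem_span hp
    obtain ⟨h3, h4⟩ := hφ.locallyConst_mul hs
    refine Submodule.subset_span ⟨_, h3, ?_, ?_⟩
    · filter_upwards [hm₁ p.fst, h1] with x e1 e2
      rw [e2] at e1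
      exact e1
    · filter_upwards [hm₂ p.snd, h2, ae_restrict_mem hD.measurableSet] with x e1 e2 hx
      rw [e2] at e1
      exact e1.trans (h4 x hx).symm
  exact ⟨⟨Φ v, map_mem_closure hΦ v.2 hmaps⟩, hm₂ _⟩

end H01

/-! ### The weak formulation as an operator equation -/

/-- Invertibility from an inf-sup condition and its transpose, without positivity of `T`. -/
lemma norm_le_and_surjective_of_coercive {X : Type*} [NormedAddCommGroup X] [InnerProductSpace ℝ X]
    [CompleteSpace X] {T : X →L[ℝ] X} {c : ℝ} (hc : 0 < c)
    (h₁ : ∀ g, ∃ g', ‖g'‖ ≤ ‖g‖ ∧ c * ‖g‖ ^ 2 ≤ inner ℝ (T g) g')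
    (h₂ : ∀ w, ∃ g, c * ‖w‖ ^ 2 ≤ inner ℝ (T g) w) :
    (∀ g, ‖g‖ ≤ c⁻¹ * ‖T g‖) ∧ Function.Surjective T := by
  have hb : ∀ g, ‖g‖ ≤ c⁻¹ * ‖T g‖ := by
    intro g
    obtain ⟨g', hg', h⟩ := h₁ g
    have h3 : c * ‖g‖ ^ 2 ≤ ‖T g‖ * ‖g‖ :=
      (h.trans (real_inner_le_norm _ _)).trans (by gcongr)
    rcases (norm_nonneg g).eq_or_lt with h0 | h0
    · rw [← h0]
      positivity
    · rw [inv_mul_eq_div, le_div_iff₀ hc]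
      nlinarith
  refine ⟨hb, ?_⟩
  have hcl : IsClosed (T.range : Set X) := by
    have : AntilipschitzWith (Real.toNNReal c⁻¹) T :=
      AddMonoidHomClass.antilipschitz_of_bound _ fun v => by
        rw [Real.coe_toNNReal _ (by positivity)]
        exact hb v
    have h := this.isClosed_range T.uniformContinuous
    exact h
  have := hcl.completeSpace_coe
  refine LinearMap.range_eq_top.1 ((Submodule.orthogonal_eq_bot_iff (K := T.range)).1 ?_)
  rw [Submodule.eq_bot_iff]
  intro w hw
  obtain ⟨g, hg⟩ := h₂ w
  have h4 : inner ℝ (T g) w = 0 := hw _ ⟨g, rfl⟩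
  rw [h4] at hg
  have : ‖w‖ ^ 2 ≤ 0 := by
    by_contra hlt
    push Not at hlt
    nlinarith
  simpa using this

/-- The map `M ↦ ι† M ι`. -/
noncomputable def compressCLM {X H : Type*} [NormedAddCommGroup X] [InnerProductSpace ℝ X]
    [CompleteSpace X] [NormedAddCommGroup H] [InnerProductSpace ℝ H] [CompleteSpace H]
    (ι : X →L[ℝ] H) : (H →L[ℝ] H) →L[ℝ] X →L[ℝ] X :=
  (ContinuousLinearMap.compL ℝ X H X (ContinuousLinearMap.adjoint ι)).comp
    ((ContinuousLinearMap.compL ℝ X H H).flip ι)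

section Compress

variable {E X H K : Type*} [NormedAddCommGroup E] [NormedSpace ℝ E]
  [NormedAddCommGroup X] [InnerProductSpace ℝ X]
  [CompleteSpace X] [NormedAddCommGroup H] [InnerProductSpace ℝ H] [CompleteSpace H]
  [NormedAddCommGroup K] [InnerProductSpace ℝ K] [CompleteSpace K]

lemma inner_compressCLM (ι : X →L[ℝ] H) (M : H →L[ℝ] H) (g h : X) :
    inner ℝ (compressCLM ι M g) h = inner ℝ (M (ι g)) (ι h) :=
  ContinuousLinearMap.adjoint_inner_left ι h (M (ι g))

lemma norm_compressCLM_le {ι : X →L[ℝ] H} (hι : ∀ g, ‖ι g‖ = ‖g‖) (M : H →L[ℝ] H) :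
    ‖compressCLM ι M‖ ≤ ‖M‖ := by
  have h1 : ‖ι‖ ≤ 1 := ContinuousLinearMap.opNorm_le_bound _ zero_le_one fun g => by simp [hι]
  have h2 : ‖ContinuousLinearMap.adjoint ι‖ ≤ 1 := by rwa [LinearIsometryEquiv.norm_map]
  refine ContinuousLinearMap.opNorm_le_bound _ (norm_nonneg M) fun g => ?_
  calc _ ≤ 1 * ‖M (ι g)‖ := ContinuousLinearMap.le_of_opNorm_le _ h2 (M (ι g))
    _ ≤ ‖M‖ * ‖ι g‖ := by rw [one_mul]; exact M.le_opNorm _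
    _ = _ := by rw [hι]

lemma compressCLM_norm_le_and_surjective {ι : X →L[ℝ] H} (hι : ∀ g, ‖ι g‖ = ‖g‖)
    {M : H →L[ℝ] H} {c : ℝ} (hc : 0 < c)
    (h₁ : ∀ g, ∃ g', ‖ι g'‖ ≤ ‖ι g‖ ∧ c * ‖ι g‖ ^ 2 ≤ inner ℝ (M (ι g)) (ι g'))
    (h₂ : ∀ w, ∃ g, c * ‖ι w‖ ^ 2 ≤ inner ℝ (M (ι g)) (ι w)) :
    (∀ g, ‖g‖ ≤ c⁻¹ * ‖compressCLM ι M g‖) ∧ Function.Surjective (compressCLM ι M) := by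
  simp only [hι, ← inner_compressCLM] at h₁ h₂
  exact norm_le_and_surjective_of_coercive hc h₁ h₂

/-- A variational equation on `E`, transported to a Hilbert space `X` isomorphic to `E`. -/
lemma compressCLM_eq_iff (e : E ≃L[ℝ] X) (ι : X →L[ℝ] H) (M : H →L[ℝ] H) (L : E →L[ℝ] K) (k : K)
    (u : E) :
    compressCLM ι M (e u) = ContinuousLinearMap.adjoint (L.comp (e.symm : X →L[ℝ] E)) k ↔
      ∀ v : E, inner ℝ (M (ι (e u))) (ι (e v)) = inner ℝ k (L v) := by
  have h1 : ∀ v : E, inner ℝ (ContinuousLinearMap.adjoint (L.comp (e.symm : X →L[ℝ] E)) k) (e v) =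
      inner ℝ k (L v) := fun v => by
    rw [ContinuousLinearMap.adjoint_inner_left]
    simp
  constructor
  · intro h v
    rw [← inner_compressCLM, h, h1]
  · intro h
    refine ext_inner_right ℝ fun g => ?_
    obtain ⟨v, rfl⟩ := e.surjective g
    rw [inner_compressCLM, h1, h]

end Compress

section Operators

variable {d : ℕ} {D : Set (Euc d)}

lemma integral_le_integral_inner_lp {α E : Type*} [MeasurableSpace α] {μ : Measure α}
    [NormedAddCommGroup E] [InnerProductSpace ℝ E] {c : ℝ} {g p q : Lp E 2 μ}
    (h : ∀ᵐ x ∂μ, c * ‖g x‖ ^ 2 ≤ inner ℝ (p x) (q x)) : c * ‖g‖ ^ 2 ≤ inner ℝ p q := by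
  rw [norm_sq_lp_two_eq_integral, L2.inner_def, ← integral_const_mul]
  refine integral_mono_ae (Integrable.const_mul ?_ c) (L2.integrable_inner p q) h
  simpa using L2.integrable_inner (𝕜 := ℝ) g g

/-- Multiplication of an `L²` vector field by an `L^∞` matrix field. -/
noncomputable def mulCLM (D : Set (Euc d)) :
    Lp (Euc d →L[ℝ] Euc d) ⊤ (volume.restrict D) →L[ℝ]
      Lp (Euc d) 2 (volume.restrict D) →L[ℝ] Lp (Euc d) 2 (volume.restrict D) :=
  (ContinuousLinearMap.id ℝ (Euc d →L[ℝ] Euc d)).holderL (volume.restrict D) ⊤ 2 2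

lemma coeFn_mulCLM (a : Lp (Euc d →L[ℝ] Euc d) ⊤ (volume.restrict D))
    (g : Lp (Euc d) 2 (volume.restrict D)) :
    mulCLM D a g =ᵐ[volume.restrict D] fun x => a x (g x) :=
  ContinuousLinearMap.coeFn_holder (r := 2) (ContinuousLinearMap.id ℝ (Euc d →L[ℝ] Euc d)) a g

lemma norm_mulCLM_apply_le (a : Lp (Euc d →L[ℝ] Euc d) ⊤ (volume.restrict D)) :
    ‖mulCLM D a‖ ≤ ‖a‖ := by
  have h1 := (mulCLM D).le_opNorm a
  have h2 : ‖mulCLM D‖ ≤ 1 :=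
    (ContinuousLinearMap.norm_holderL_le _).trans ContinuousLinearMap.norm_id_le
  calc _ ≤ _ := h1
    _ ≤ 1 * ‖a‖ := by gcongr
    _ = _ := one_mul _

/-- The operator `g ↦ P (a g)` on the space of gradients, `P` being the orthogonal projection onto
it, as a function of the coefficient `a ∈ L^∞`. -/
noncomputable def coeffCLM (D : Set (Euc d)) [CompleteSpace (GradSpace D)] :
    Lp (Euc d →L[ℝ] Euc d) ⊤ (volume.restrict D) →L[ℝ] GradSpace D →L[ℝ] GradSpace D :=
  (compressCLM (gradIncl D)).comp (mulCLM D)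

lemma coeffCLM_apply [CompleteSpace (GradSpace D)]
    (a : Lp (Euc d →L[ℝ] Euc d) ⊤ (volume.restrict D)) :
    coeffCLM D a = compressCLM (gradIncl D) (mulCLM D a) := rfl

lemma norm_coeffCLM_apply_le [CompleteSpace (GradSpace D)]
    (a : Lp (Euc d →L[ℝ] Euc d) ⊤ (volume.restrict D)) : ‖coeffCLM D a‖ ≤ 1 * ‖a‖ := by
  rw [coeffCLM_apply]
  exact ((norm_compressCLM_le (ι := gradIncl D) norm_gradIncl (mulCLM D a)).trans
    (norm_mulCLM_apply_le a)).trans_eq (one_mul _).symm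

/-- The inclusion `L^∞(D) → L²(D)`. -/
noncomputable def lpInclCLM (D : Set (Euc d)) [IsFiniteMeasure (volume.restrict D)] :
    Lp ℝ ⊤ (volume.restrict D) →L[ℝ] Lp ℝ 2 (volume.restrict D) :=
  ((ContinuousLinearMap.lsmul ℝ ℝ : ℝ →L[ℝ] ℝ →L[ℝ] ℝ).holderL
    (volume.restrict D) ⊤ 2 2).flip (Lp.const 2 (volume.restrict D) 1)

lemma coeFn_lpInclCLM [IsFiniteMeasure (volume.restrict D)] (r : Lp ℝ ⊤ (volume.restrict D)) :
    lpInclCLM D r =ᵐ[volume.restrict D] r := by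
  filter_upwards [ContinuousLinearMap.coeFn_holder (r := 2)
    (ContinuousLinearMap.lsmul ℝ ℝ : ℝ →L[ℝ] ℝ →L[ℝ] ℝ) r (Lp.const 2 (volume.restrict D) 1),
    Lp.coeFn_const (p := 2) (μ := volume.restrict D) (1 : ℝ)] with x h1 h2
  rw [h2] at h1
  refine h1.trans ?_
  simp

lemma norm_lpInclCLM_apply_le [IsFiniteMeasure (volume.restrict D)]
    (r : Lp ℝ ⊤ (volume.restrict D)) : ‖lpInclCLM D r‖ ≤ √(volume.real D) * ‖r‖ := by
  have h1 : ∀ᵐ x ∂(volume.restrict D), ‖lpInclCLM D r x‖ ≤ ‖r‖ := by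
    have h2 : ∀ᵐ x ∂(volume.restrict D), ‖r x‖ₑ ≤ eLpNormEssSup r (volume.restrict D) :=
      ae_le_eLpNormEssSup
    filter_upwards [coeFn_lpInclCLM r, h2] with x e1 e2
    rw [e1, Lp.norm_def, ← toReal_enorm (r x), eLpNorm_exponent_top]
    refine ENNReal.toReal_mono ?_ e2
    rw [← eLpNorm_exponent_top]
    exact Lp.eLpNorm_ne_top r
  refine (Lp.norm_le_of_ae_bound (norm_nonneg r) h1).trans (le_of_eq ?_)
  congr 1
  rw [Real.sqrt_eq_rpow]
  simp [measureUnivNNReal, Measure.real]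
  rfl

/-- The Riesz representative in the space of gradients of the functional `v ↦ ∫_D r v`, as a
function of `r ∈ L^∞(D)`. -/
noncomputable def sourceCLM (hd : 0 < d) (hDb : Bornology.IsBounded D)
    [CompleteSpace (GradSpace D)] [IsFiniteMeasure (volume.restrict D)] :
    Lp ℝ ⊤ (volume.restrict D) →L[ℝ] GradSpace D :=
  (ContinuousLinearMap.adjoint ((valCLM D).comp
    ((gradEquiv hd hDb).symm : GradSpace D →L[ℝ] H01 D))).comp (lpInclCLM D)

lemma norm_sourceCLM_apply_le (hd : 0 < d) (hDb : Bornology.IsBounded D)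
    [CompleteSpace (GradSpace D)] [IsFiniteMeasure (volume.restrict D)]
    (r : Lp ℝ ⊤ (volume.restrict D)) :
    ‖sourceCLM hd hDb r‖ ≤ poincareConst D * √(volume.real D) * ‖r‖ := by
  have h0 := poincareConst_nonneg D
  have h1 : ‖ContinuousLinearMap.adjoint ((valCLM D).comp
      ((gradEquiv hd hDb).symm : GradSpace D →L[ℝ] H01 D))‖ ≤ poincareConst D := by
    rw [LinearIsometryEquiv.norm_map]
    refine ContinuousLinearMap.opNorm_le_bound _ h0 fun g => ?_
    have := norm_h01Val_le hd hDb ((gradEquiv hd hDb).symm g)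
    rwa [h01Norm_gradEquiv_symm] at this
  calc _ ≤ poincareConst D * ‖lpInclCLM D r‖ := ContinuousLinearMap.le_of_opNorm_le _ h1 _
    _ ≤ poincareConst D * (√(volume.real D) * ‖r‖) := by
        gcongr
        exact norm_lpInclCLM_apply_le r
    _ = _ := by ring

lemma IsGevrey.coeffCLM [CompleteSpace (GradSpace D)] {b : ℕ → ℝ} {β K q : ℝ}
    {A : (ℕ → ℝ) → Lp (Euc d →L[ℝ] Euc d) ⊤ (volume.restrict D)} (hA : IsGevrey b β K q A) :
    IsGevrey b β (1 * K) q (fun y => coeffCLM D (A y)) :=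
  IsGevrey.clm (DomainUQ.coeffCLM D) (norm_coeffCLM_apply_le (D := D)) zero_le_one hA

lemma IsGevrey.sourceCLM (hd : 0 < d) (hDb : Bornology.IsBounded D)
    [CompleteSpace (GradSpace D)] [IsFiniteMeasure (volume.restrict D)] {b : ℕ → ℝ} {β K q : ℝ}
    {r : (ℕ → ℝ) → Lp ℝ ⊤ (volume.restrict D)} (hr : IsGevrey b β K q r) :
    IsGevrey b β (poincareConst D * √(volume.real D) * K) q (fun y => sourceCLM hd hDb (r y)) :=
  IsGevrey.clm (DomainUQ.sourceCLM hd hDb) (norm_sourceCLM_apply_le hd hDb)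
    (mul_nonneg (poincareConst_nonneg D) (Real.sqrt_nonneg _)) hr

lemma isPullbackSolution_iff (hd : 0 < d) (hDb : Bornology.IsBounded D)
    [CompleteSpace (GradSpace D)] [IsFiniteMeasure (volume.restrict D)]
    {f : Euc d → ℝ} {Vy : Euc d → Euc d} {a : Lp (Euc d →L[ℝ] Euc d) ⊤ (volume.restrict D)}
    {r : Lp ℝ ⊤ (volume.restrict D)} (ha : a =ᵐ[volume.restrict D] pullbackCoeff Vy)
    (hr : r =ᵐ[volume.restrict D] pullbackSource f Vy) (u : H01 D) :
    IsPullbackSolution D f Vy u ↔ coeffCLM D a (gradEquiv hd hDb u) = sourceCLM hd hDb r := by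
  have h1 : ∀ v : H01 D, inner ℝ (mulCLM D a (h01Grad u)) (h01Grad v) =
      ∫ x in D, inner ℝ (pullbackCoeff Vy x (h01Grad u x)) (h01Grad v x) := fun v => by
    rw [L2.inner_def]
    refine integral_congr_ae ?_
    filter_upwards [coeFn_mulCLM a (h01Grad u), ha] with x e1 e2
    rw [e1, e2]
  have h2 : ∀ v : H01 D, inner ℝ (lpInclCLM D r) (h01Val v) =
      ∫ x in D, pullbackSource f Vy x * h01Val v x := fun v => by
    rw [L2.inner_def]
    refine integral_congr_ae ?_
    filter_upwards [coeFn_lpInclCLM r, hr] with x e1 e2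
    rw [e1, e2]
    simp [mul_comm]
  have h3 : IsPullbackSolution D f Vy u ↔ ∀ v : H01 D,
      inner ℝ (mulCLM D a (h01Grad u)) (h01Grad v) = inner ℝ (lpInclCLM D r) (h01Val v) :=
    forall_congr' fun v => by rw [h1 v, h2 v]
  exact h3.trans (compressCLM_eq_iff (gradEquiv hd hDb) (gradIncl D) (mulCLM D a)
    (valCLM D) (lpInclCLM D r) u).symm

/-- Well-posedness. The coefficient may be negative definite on some components of `D`; testing with
`s ∇v` for the locally constant sign `s` of the coefficient restores coercivity. -/
lemma coeffCLM_norm_le_and_surjective (hD : IsOpen D) (hDb : Bornology.IsBounded D)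
    [CompleteSpace (GradSpace D)] {s : Euc d → ℝ} (hs : ∀ x ∈ D, ∀ᶠ z in 𝓝 x, s z = s x)
    (hs1 : ∀ x, |s x| ≤ 1) {c : ℝ} (hc : 0 < c) {A : Euc d → Euc d →L[ℝ] Euc d}
    (hA : ∀ x ∈ D, ∀ ξ, c * ‖ξ‖ ^ 2 ≤ s x * inner ℝ (A x ξ) ξ)
    {a : Lp (Euc d →L[ℝ] Euc d) ⊤ (volume.restrict D)} (ha : a =ᵐ[volume.restrict D] A) :
    (∀ g, ‖g‖ ≤ c⁻¹ * ‖coeffCLM D a g‖) ∧ Function.Surjective (coeffCLM D a) := by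
  have htwist : ∀ g : GradSpace D, ∃ g' : GradSpace D,
      (gradIncl D) g' =ᵐ[volume.restrict D]
        fun x => s x • (gradIncl D) g x := by
    intro g
    obtain ⟨v, hv⟩ := exists_h01Grad_eq g
    obtain ⟨v', hv'⟩ := exists_h01Grad_eq_locallyConst_smul hD hDb hs hs1 v
    obtain ⟨g', hg'⟩ := exists_gradIncl_eq v'
    exact ⟨g', by rw [hg', ← hv]; exact hv'⟩
  have hmem : ∀ᵐ x ∂(volume.restrict D), x ∈ D := ae_restrict_mem hD.measurableSet
  have key : ∀ G G' : Lp (Euc d) 2 (volume.restrict D),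
      G' =ᵐ[volume.restrict D] (fun x => s x • G x) → ‖G'‖ ≤ ‖G‖ ∧
        c * ‖G‖ ^ 2 ≤ inner ℝ (mulCLM D a G) G' ∧ c * ‖G‖ ^ 2 ≤ inner ℝ (mulCLM D a G') G := by
    intro G G' hG
    refine ⟨Lp.norm_le_norm_of_ae_le ?_, integral_le_integral_inner_lp ?_,
      integral_le_integral_inner_lp ?_⟩
    · filter_upwards [hG] with x hx
      refine ((congrArg norm hx).trans (norm_smul (s x) (G x))).trans_le ?_
      exact mul_le_of_le_one_left (norm_nonneg _) (hs1 x)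
    · filter_upwards [hG, coeFn_mulCLM a G, ha, hmem] with x e1 e2 e3 e4
      rw [e1, e2, e3, real_inner_smul_right]
      exact hA x e4 _
    · filter_upwards [hG, coeFn_mulCLM a G', ha, hmem] with x e1 e2 e3 e4
      rw [e2, e1, e3, map_smul, real_inner_smul_left]
      exact hA x e4 _
  choose tw htw using htwist
  exact compressCLM_norm_le_and_surjective (ι := gradIncl D) (M := mulCLM D a)
    norm_gradIncl hc (fun g => ⟨tw g, (key _ _ (htw g)).1, (key _ _ (htw g)).2.1⟩)
    fun w => ⟨tw w, (key _ _ (htw w)).2.2⟩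

end Operators

/-! ### Measurability and sign of the pulled-back data -/

section Data

variable {d : ℕ} {D : Set (Euc d)} {σmin : ℝ}

lemma continuousOn_fderiv_of_contDiffOn (hD : IsOpen D) {Vy : Euc d → Euc d}
    (hV : ContDiffOn ℝ 2 Vy D) : ContinuousOn (fderiv ℝ Vy) D :=
  hV.continuousOn_fderiv_of_isOpen hD (by norm_num)

/-- The continuity of the coefficient on `D`, which is needed for its measurability. -/
lemma continuousOn_pullbackCoeff (hD : IsOpen D) {Vy : Euc d → Euc d} (hV : ContDiffOn ℝ 2 Vy D)
    (hσ0 : 0 < σmin)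
    (hmin : ∀ x ∈ D, ∀ i < d, σmin ≤ (fderiv ℝ Vy x : Euc d →ₗ[ℝ] Euc d).singularValues i) :
    ContinuousOn (pullbackCoeff Vy) D := by
  intro x hx
  have hJ : ContinuousAt (fderiv ℝ Vy) x :=
    (continuousOn_fderiv_of_contDiffOn hD hV).continuousAt (hD.mem_nhds hx)
  refine ContinuousAt.continuousWithinAt ?_
  obtain ⟨R, h1, h2, -⟩ := exists_inverse_of_singularValues hσ0 (hmin x hx)
  have h3 : ContinuousLinearMap.adjoint (fderiv ℝ Vy x) ∘L ContinuousLinearMap.adjoint R =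
      .id ℝ _ := by
    rw [← ContinuousLinearMap.adjoint_comp, h2, ContinuousLinearMap.adjoint_id]
  have h4 : ContinuousLinearMap.adjoint R ∘L ContinuousLinearMap.adjoint (fderiv ℝ Vy x) =
      .id ℝ _ := by
    rw [← ContinuousLinearMap.adjoint_comp, h1, ContinuousLinearMap.adjoint_id]
  let e := (ContinuousLinearEquiv.equivOfInverse' (fderiv ℝ Vy x) R h1 h2).trans
    (ContinuousLinearEquiv.equivOfInverse' (ContinuousLinearMap.adjoint (fderiv ℝ Vy x))
      (ContinuousLinearMap.adjoint R) h3 h4)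
  have he : ContinuousAt (ContinuousLinearMap.inverse : (Euc d →L[ℝ] Euc d) → Euc d →L[ℝ] Euc d)
      ((ContinuousLinearMap.adjoint (fderiv ℝ Vy x)).comp (fderiv ℝ Vy x)) :=
    (contDiffAt_map_inverse (n := 0) e).continuousAt
  have hin : ContinuousAt
      (fun z => (ContinuousLinearMap.adjoint (fderiv ℝ Vy z)).comp (fderiv ℝ Vy z)) x :=
    ((ContinuousLinearMap.adjoint.continuous.continuousAt).comp hJ).clm_comp hJ
  exact ((contDiff_det.continuous.continuousAt).comp hJ).smul
    (ContinuousAt.comp (f := fun z =>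
      (ContinuousLinearMap.adjoint (fderiv ℝ Vy z)).comp (fderiv ℝ Vy z)) he hin)

lemma continuousOn_pullbackSource (hD : IsOpen D) {Vy : Euc d → Euc d} (hV : ContDiffOn ℝ 2 Vy D)
    {f : Euc d → ℝ} {Ω : Set (Euc d)} (hf : ContinuousOn f Ω) (hΩ : MapsTo Vy D Ω) :
    ContinuousOn (pullbackSource f Vy) D :=
  (hf.comp hV.continuousOn hΩ).mul
    (contDiff_det.continuous.comp_continuousOn (continuousOn_fderiv_of_contDiffOn hD hV))

lemma eventually_sign_det_eq (hD : IsOpen D) {Vy : Euc d → Euc d} (hV : ContDiffOn ℝ 2 Vy D)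
    (hσ0 : 0 < σmin)
    (hmin : ∀ x ∈ D, ∀ i < d, σmin ≤ (fderiv ℝ Vy x : Euc d →ₗ[ℝ] Euc d).singularValues i) :
    ∀ x ∈ D, ∀ᶠ z in 𝓝 x, ((SignType.sign (fderiv ℝ Vy z).det : ℝ)) =
      SignType.sign (fderiv ℝ Vy x).det := by
  intro x hx
  have hJ : ContinuousAt (fun z => (fderiv ℝ Vy z).det) x :=
    (contDiff_det.continuous.continuousAt).comp
      ((continuousOn_fderiv_of_contDiffOn hD hV).continuousAt (hD.mem_nhds hx))
  have h0 : (fderiv ℝ Vy x).det ≠ 0 := by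
    have h1 := pow_le_abs_det hσ0.le (hmin x hx)
    exact abs_pos.1 ((pow_pos hσ0 d).trans_le h1)
  rcases lt_or_gt_of_ne h0 with h | h
  · filter_upwards [hJ.eventually_lt_const h] with z hz
    rw [sign_neg hz, sign_neg h]
  · filter_upwards [hJ.eventually_const_lt h] with z hz
    rw [sign_pos hz, sign_pos h]

lemma abs_sign_le_one (t : ℝ) : |(SignType.sign t : ℝ)| ≤ 1 := by
  rcases lt_trichotomy t 0 with h | h | h
  · simp [sign_neg h]
  · simp [h]
  · simp [sign_pos h]

end Data

/-! ### Comparison of the constants -/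

section Constants

variable {d : ℕ}

lemma two_rpow_cu2_exponent (β : ℝ) (d : ℕ) :
    (2 : ℝ) ^ (β * ((d : ℝ) ^ 2 + 1) + 1) = 2 * ((2 : ℝ) ^ β) ^ (d ^ 2 + 1) := by
  rw [Real.rpow_add two_pos, Real.rpow_one, ← Real.rpow_natCast ((2 : ℝ) ^ β), ← Real.rpow_mul two_pos.le]
  push_cast
  ring

/-- The Gevrey rate produced by differentiating the pulled-back equation, with `m` a bound of the
Jacobian, is at most `2^{-β}` times the rate `Cu2`. -/
lemma two_rpow_mul_rate_le {D : Set (Euc d)} (hd : d = 1 ∨ d = 2 ∨ d = 3)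
    {σmin σmax C β Cf m : ℝ} {ρ : Fin d → ℝ} (hσ0 : 0 < σmin) (hσ1 : σmin ≤ 1) (hσ2 : 1 ≤ σmax)
    (hC : 1 ≤ C) (hβ : 1 ≤ β) (hρ : ∀ j, 0 ≤ ρ j) (hm1 : 1 ≤ m) (hmC : m ≤ C) :
    2 ^ β * (C * ∑ j, ρ j + 2 + (C * d + 2) +
      (1 + m ^ 2 / σmin ^ d * (1 * (σmax ^ d / σmin ^ 2))) *
        (C * d + 2 + 2 * (1 + C / σmin))) ≤ Cu2 D σmin σmax β C Cf ρ := by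
  have hw2 : (2 : ℝ) ≤ 2 ^ β := by
    calc (2 : ℝ) = 2 ^ (1 : ℝ) := (Real.rpow_one 2).symm
      _ ≤ 2 ^ β := Real.rpow_le_rpow_of_exponent_le one_le_two hβ
  have h4 : (4 : ℝ) ^ β = (2 ^ β) ^ 2 := by
    rw [pow_two, ← Real.mul_rpow two_pos.le two_pos.le]
    norm_num
  set w : ℝ := 2 ^ β with hw
  have hw1 : 1 ≤ w := by linarith
  have hF : 1 ≤ factPow β (d ^ 2) := one_le_factPow (by linarith) _
  set F := factPow β (d ^ 2) with hFdef
  set P := max 1 (rhoNorm β ρ) with hP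
  have hP1 : 1 ≤ P := le_max_left _ _
  have hPs : ∑ j, ρ j ≤ P := (sum_le_rhoNorm hβ hρ).trans (le_max_right _ _)
  rw [Cu2, two_rpow_cu2_exponent, ← hw, ← hFdef]
  set M := max (max (cZero d σmin σmax β) (cOne σmin β C))
      (max (cTildeZero D σmin σmax β Cf) (cTildeOne σmin β C ρ)) with hM
  have hM0 : cZero d σmin σmax β ≤ M := (le_max_left _ _).trans (le_max_left _ _)
  have hM1 : cOne σmin β C ≤ M := (le_max_right _ _).trans (le_max_left _ _)
  have hM2 : cTildeOne σmin β C ρ ≤ M := (le_max_right _ _).trans (le_max_right _ _)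
  have hdpos : (0 : ℝ) ≤ d := Nat.cast_nonneg d
  -- `d + 6 ≤ 2^(d² + 2)` absorbs the dimension, and `w ≥ 2` since `β ≥ 1`
  have hd1 : (d : ℝ) + 6 ≤ w ^ (d ^ 2 + 2) := by
    have : (2 : ℝ) ^ (d ^ 2 + 2) ≤ w ^ (d ^ 2 + 2) := by gcongr
    refine le_trans ?_ this
    rcases hd with rfl | rfl | rfl <;> norm_num
  have hκ : C ≤ C / σmin := by
    rw [le_div_iff₀ hσ0]
    nlinarith
  set κ := C / σmin with hκdef
  have hκ1 : 1 ≤ κ := hC.trans hκ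
  -- the source contributes at most half of the rate
  have hA : w * (C * ∑ j, ρ j + 2 + (C * d + 2)) ≤ M ^ 2 * F * w ^ (d ^ 2 + 1) := by
    have hCP : 1 ≤ C * P := one_le_mul_of_one_le_of_one_le hC hP1
    have e1 : cTildeOne σmin β C ρ = w ^ 2 * (C * κ * P) := by
      rw [cTildeOne, Cfref2, ← hw, ← hP, hκdef]
      ring
    have e2 : w ^ 2 * (C * P) ≤ M := by
      refine le_trans ?_ hM2
      rw [e1]
      have : C * P * 1 ≤ C * P * κ := by gcongr
      have h5 : 0 ≤ w ^ 2 := sq_nonneg w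
      nlinarith
    have e3 : 1 ≤ w ^ 2 * (C * P) := one_le_mul_of_one_le_of_one_le (one_le_pow₀ hw1) hCP
    have e4 : w ^ 2 * (C * P) ≤ M ^ 2 := by nlinarith
    have e5 : C * ∑ j, ρ j + 2 + (C * d + 2) ≤ (d + 6) * (C * P) := by
      have f1 : C * ∑ j, ρ j ≤ C * P := by gcongr
      have f2 : C * d ≤ (C * P) * d := by
        gcongr
        nlinarith
      nlinarith
    calc w * (C * ∑ j, ρ j + 2 + (C * d + 2)) ≤ w * ((d + 6) * (C * P)) := by gcongr
      _ ≤ w * (w ^ (d ^ 2 + 2) * (C * P)) := by gcongr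
      _ = (w ^ 2 * (C * P)) * 1 * w ^ (d ^ 2 + 1) := by ring
      _ ≤ M ^ 2 * F * w ^ (d ^ 2 + 1) := by gcongr
  -- the coefficient contributes at most the other half
  have hB : w * ((1 + m ^ 2 / σmin ^ d * (1 * (σmax ^ d / σmin ^ 2))) *
        (C * d + 2 + 2 * (1 + κ))) ≤ M ^ 2 * F * w ^ (d ^ 2 + 1) := by
    -- here the bound `m ≤ C` of the Jacobian is the one that matches `cOne`, which contains `C³`
    set S := C ^ 2 / σmin ^ d * (σmax ^ d / σmin ^ 2) with hS
    have g1 : m ^ 2 / σmin ^ d * (1 * (σmax ^ d / σmin ^ 2)) ≤ S := by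
      rw [one_mul, hS]
      gcongr
    have g2 : 1 ≤ S := by
      have k1 : 1 ≤ C ^ 2 / σmin ^ d := by
        rw [one_le_div (by positivity)]
        exact (pow_le_one₀ hσ0.le hσ1).trans (one_le_pow₀ hC)
      have k2 : 1 ≤ σmax ^ d / σmin ^ 2 := by
        rw [one_le_div (by positivity)]
        exact (pow_le_one₀ hσ0.le hσ1).trans (one_le_pow₀ hσ2)
      exact one_le_mul_of_one_le_of_one_le k1 k2
    have g3 : C * d + 2 + 2 * (1 + κ) ≤ (d + 6) * κ := by nlinarith
    have e0 : 0 ≤ cZero d σmin σmax β := by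
      rw [cZero, CA1, ← hFdef]
      positivity
    have e1 : cZero d σmin σmax β * cOne σmin β C * F = 2 * w ^ 3 * (S * κ) / σmin ^ 2 := by
      have hF0 : F ≠ 0 := by positivity
      rw [cZero, CA1, cOne, CA2, CdetJ, h4, ← hw, ← hFdef, hS, hκdef]
      field_simp
    have e2 : cZero d σmin σmax β * cOne σmin β C ≤ M ^ 2 := by
      rw [pow_two]
      exact mul_le_mul hM0 hM1 (by rw [cOne, CA2, CdetJ, h4, ← hw]; positivity) (e0.trans hM0)
    have e3 : 2 * w ^ 3 * (S * κ) ≤ M ^ 2 * F := by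
      calc 2 * w ^ 3 * (S * κ) ≤ 2 * w ^ 3 * (S * κ) / σmin ^ 2 := by
            rw [le_div_iff₀ (by positivity)]
            exact mul_le_of_le_one_right (by positivity) (pow_le_one₀ hσ0.le hσ1)
        _ = cZero d σmin σmax β * cOne σmin β C * F := e1.symm
        _ ≤ _ := by gcongr
    calc _ ≤ w * ((S + S) * ((d + 6) * κ)) := by gcongr
      _ ≤ w * ((S + S) * (w ^ (d ^ 2 + 2) * κ)) := by gcongr
      _ = 2 * w ^ 2 * (S * κ) * w ^ (d ^ 2 + 1) := by ring
      _ ≤ 2 * w ^ 3 * (S * κ) * w ^ (d ^ 2 + 1) := by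
          gcongr
          norm_num
      _ ≤ _ := by gcongr
  calc _ = w * (C * ∑ j, ρ j + 2 + (C * d + 2)) +
        w * ((1 + m ^ 2 / σmin ^ d * (1 * (σmax ^ d / σmin ^ 2))) *
        (C * d + 2 + 2 * (1 + κ))) := by ring
    _ ≤ M ^ 2 * F * w ^ (d ^ 2 + 1) + M ^ 2 * F * w ^ (d ^ 2 + 1) := add_le_add hA hB
    _ = _ := by ring

/-- The passage from the rate `Q ≤ 2^{-β} q` to the constants of the theorem: for `n ≥ 1` one factor
`2^{-β}` is available for the leading constant. -/
lemma mul_pow_le_of_two_rpow_mul_le {β K K' Q q : ℝ} {n : ℕ} (hβ : 0 ≤ β) (hn : n ≠ 0)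
    (hK : K ≤ K') (hK' : 0 ≤ K') (hQ : 0 ≤ Q) (h : 2 ^ β * Q ≤ q) :
    K * Q ^ n ≤ (1 + K' * 2 ^ (-β)) * q ^ n := by
  have hw : (1 : ℝ) ≤ 2 ^ β := Real.one_le_rpow one_le_two hβ
  have hw0 : (0 : ℝ) < 2 ^ β := by positivity
  have hq : 0 ≤ q := (by positivity : 0 ≤ 2 ^ β * Q).trans h
  have h1 : 2 ^ β * Q ^ n ≤ q ^ n := by
    calc (2 : ℝ) ^ β * Q ^ n ≤ (2 ^ β) ^ n * Q ^ n := by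
          gcongr
          exact le_self_pow₀ hw hn
      _ = (2 ^ β * Q) ^ n := (mul_pow _ _ _).symm
      _ ≤ q ^ n := by gcongr
  rw [Real.rpow_neg two_pos.le]
  calc K * Q ^ n ≤ K' * Q ^ n := by gcongr
    _ = K' * (2 ^ β)⁻¹ * (2 ^ β * Q ^ n) := by field_simp
    _ ≤ K' * (2 ^ β)⁻¹ * q ^ n := by gcongr
    _ ≤ (1 + K' * (2 ^ β)⁻¹) * q ^ n := by
        gcongr
        linarith

end Constants

/-! ### Well-posedness and Gevrey regularity of the pullback solution -/

/-- The coefficient and the source of the pulled-back problem as Gevrey regular maps into `L^∞(D)`,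
and the coercivity of the coefficient up to the sign of the Jacobian determinant. -/
lemma exists_gevrey_data {d : ℕ}
    {D : Set (Euc d)} (hDo : IsOpen D) (hDb : Bornology.IsBounded D)
    {V : (ℕ → ℝ) → Euc d → Euc d}
    {σmin σmax C β Cf : ℝ} {b : ℕ → ℝ} {ρ : Fin d → ℝ} {f : Euc d → ℝ}
    (hσ0 : 0 < σmin) (hσ2 : 1 ≤ σmax) (hC : 1 ≤ C) (hβ : 1 ≤ β) (hb : ∀ j, 0 ≤ b j)
    (hCf : 0 < Cf) (hρ : ∀ j, 0 ≤ ρ j)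
    (hVd : ∀ y ∈ paramSet, ContDiffOn ℝ 2 (V y) D)
    (hVσ : JacobianSingularValueBounds D V σmin σmax)
    (hVG : GevreyField D V C β b) (hf : GevreySource (holdAll D V) f Cf β ρ) :
    ∃ (A : (ℕ → ℝ) → Lp (Euc d →L[ℝ] Euc d) ⊤ (volume.restrict D))
      (r : (ℕ → ℝ) → Lp ℝ ⊤ (volume.restrict D)),
      IsGevrey b β (σmax ^ d / σmin ^ 2) (C * d + 2 + 2 * (1 + C / σmin)) A ∧
      IsGevrey b β (Cf * σmax ^ d) (C * ∑ j, ρ j + 2 + (C * d + 2)) r ∧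
      ∀ y ∈ paramSet, A y =ᵐ[volume.restrict D] pullbackCoeff (V y) ∧
        r y =ᵐ[volume.restrict D] pullbackSource f (V y) ∧
        ∀ x ∈ D, ∀ ξ, σmin ^ d / (min σmax C) ^ 2 * ‖ξ‖ ^ 2 ≤
          SignType.sign (fderiv ℝ (V y) x).det * inner ℝ (pullbackCoeff (V y) x ξ) ξ := by
  have hV1 : ∀ y ∈ paramSet, ContDiffOn ℝ 1 (V y) D := fun y hy =>
    (hVd y hy).of_le (by norm_num)
  have hmin : ∀ x ∈ D, ∀ y ∈ paramSet, ∀ i < d,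
      σmin ≤ (fderiv ℝ (V y) x : Euc d →ₗ[ℝ] Euc d).singularValues i := fun x hx y hy i hi =>
    (hVσ x hx y hy i hi).1
  have hmax : ∀ x ∈ D, ∀ y ∈ paramSet, ∀ i < d,
      (fderiv ℝ (V y) x : Euc d →ₗ[ℝ] Euc d).singularValues i ≤ σmax := fun x hx y hy i hi =>
    (hVσ x hx y hy i hi).2
  have hJσ : ∀ x ∈ D, ∀ y ∈ paramSet, ‖fderiv ℝ (V y) x‖ ≤ σmax := fun x hx y hy =>
    ContinuousLinearMap.opNorm_le_bound _ (by linarith)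
      (norm_apply_le_of_singularValues (by linarith) (hmax x hx y hy))
  have hG := GevreyField.isGevrey hDo hDb (by linarith) hb hV1 hVG
  -- besides `σmax`, the Gevrey bound of order zero also bounds the Jacobian, by `C`
  have hJm : ∀ x ∈ D, ∀ y ∈ paramSet, ‖fderiv ℝ (V y) x‖ ≤ min σmax C := by
    intro x hx y hy
    refine le_min (hJσ x hx y hy) ?_
    obtain ⟨G, hG1, hG2⟩ := (hG x hx).2
    have h0 := hG2 0 y hy
    rw [hG1.1 y hy] at h0
    simpa [factPow, mpow] using h0
  have hΩ := isOpen_holdAll hDo hV1 hσ0 hmin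
  have hdp : (0 : ℝ) ≤ d := Nat.cast_nonneg d
  have hσmax0 : 0 < σmax := by linarith
  have hC0 : 0 < C := by linarith
  have hρ0 : 0 ≤ ∑ j, ρ j := Finset.sum_nonneg fun j _ => hρ j
  obtain ⟨A, hA, hAe⟩ := exists_isGevrey_lp_top hDo hDb hb (by positivity) (by positivity)
    (fun x hx => isGevrey_pullbackCoeff hb hβ hC0.le hσ0 hσ2 (hG x hx).2 (hmin x hx) (hmax x hx))
    fun y hy => (continuousOn_pullbackCoeff hDo (hVd y hy) hσ0 fun x hx =>
      hmin x hx y hy).aestronglyMeasurable hDo.measurableSet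
  obtain ⟨r, hr, hre⟩ := exists_isGevrey_lp_top hDo hDb hb (by positivity) (by positivity)
    (fun x hx => isGevrey_pullbackSource hb hβ hC0.le hσ2 hCf.le hρ hΩ hf hx (hG x hx).1 (hG x hx).2
      (hJσ x hx))
    fun y hy => (continuousOn_pullbackSource hDo (hVd y hy) hf.1.continuousOn
      fun x hx => mem_biUnion hy (mem_image_of_mem _ hx)).aestronglyMeasurable hDo.measurableSet
  exact ⟨A, r, hA, hr, fun y hy => ⟨hAe y hy, hre y hy, fun x hx =>
    le_inner_pullbackCoeff hσ0 (lt_min hσmax0 hC0) (hmin x hx y hy) (hJm x hx y hy)⟩⟩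

/-- The pulled-back Poisson problems as a Gevrey regular family of uniformly invertible linear
equations on the space of gradients. -/
lemma exists_gevrey_operator_equation {d : ℕ} (hd : 0 < d)
    {D : Set (Euc d)} (hDo : IsOpen D) (hDb : Bornology.IsBounded D)
    [CompleteSpace (GradSpace D)] {V : (ℕ → ℝ) → Euc d → Euc d}
    {σmin σmax C β Cf : ℝ} {b : ℕ → ℝ} {ρ : Fin d → ℝ} {f : Euc d → ℝ}
    (hσ0 : 0 < σmin) (hσ2 : 1 ≤ σmax) (hC : 1 ≤ C) (hβ : 1 ≤ β) (hb : ∀ j, 0 ≤ b j)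
    (hCf : 0 < Cf) (hρ : ∀ j, 0 ≤ ρ j)
    (hV2 : IsUniformC2Family D V) (hVσ : JacobianSingularValueBounds D V σmin σmax)
    (hVG : GevreyField D V C β b) (hf : GevreySource (holdAll D V) f Cf β ρ) :
    ∃ (T : (ℕ → ℝ) → GradSpace D →L[ℝ] GradSpace D) (F : (ℕ → ℝ) → GradSpace D),
      IsGevrey b β (1 * (σmax ^ d / σmin ^ 2)) (C * d + 2 + 2 * (1 + C / σmin)) T ∧
      IsGevrey b β (poincareConst D * √(volume.real D) * (Cf * σmax ^ d))
        (C * ∑ j, ρ j + 2 + (C * d + 2)) F ∧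
      ∀ y ∈ paramSet, (∀ g, ‖g‖ ≤ min σmax C ^ 2 / σmin ^ d * ‖T y g‖) ∧ Function.Surjective (T y) ∧
        ∀ u : H01 D, IsPullbackSolution D f (V y) u ↔ T y (gradEquiv hd hDb u) = F y := by
  have := isFiniteMeasure_restrict hDb
  have hVd : ∀ y ∈ paramSet, ContDiffOn ℝ 2 (V y) D := by
    obtain ⟨⟨B, hB⟩, -⟩ := hV2
    exact fun y hy => (hB y hy).2.1
  have hm0 : 0 < min σmax C := lt_min (by linarith) (by linarith)
  obtain ⟨A, r, hA, hr, hAr⟩ := exists_gevrey_data hDo hDb hσ0 hσ2 hC hβ hb hCf hρ hVd hVσ hVG hf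
  refine ⟨fun y => coeffCLM D (A y), fun y => sourceCLM hd hDb (r y), IsGevrey.coeffCLM hA,
    IsGevrey.sourceCLM hd hDb hr, fun y hy => ?_⟩
  obtain ⟨hAe, hre, hcoer⟩ := hAr y hy
  have hwp := coeffCLM_norm_le_and_surjective hDo hDb
    (eventually_sign_det_eq hDo (hVd y hy) hσ0 fun x hx i hi => (hVσ x hx y hy i hi).1)
    (fun x => abs_sign_le_one _) (c := σmin ^ d / min σmax C ^ 2) (by positivity) hcoer hAe
  have hc : (σmin ^ d / min σmax C ^ 2)⁻¹ = min σmax C ^ 2 / σmin ^ d := inv_div _ _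
  exact ⟨fun g => hc ▸ hwp.1 g, hwp.2, isPullbackSolution_iff hd hDb hAe hre⟩

end DomainUQ

open DomainUQ in
theorem mainTheorem1
    (d : ℕ) (hd : d = 1 ∨ d = 2 ∨ d = 3)
    (D : Set (DomainUQ.Euc d)) (hDo : IsOpen D) (hDb : Bornology.IsBounded D) (hDne : D.Nonempty)
    (V : (ℕ → ℝ) → DomainUQ.Euc d → DomainUQ.Euc d)
    (σmin σmax C β Cf : ℝ) (b : ℕ → ℝ) (ρ : Fin d → ℝ) (f : DomainUQ.Euc d → ℝ)
    (hσ0 : 0 < σmin) (hσ1 : σmin ≤ 1) (hσ2 : 1 ≤ σmax)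
    (hC : 1 ≤ C) (hβ : 1 ≤ β) (hb : ∀ j, 0 ≤ b j) (hCf : 0 < Cf) (hρ : ∀ j, 0 ≤ ρ j)
    (hV2 : DomainUQ.IsUniformC2Family D V)
    (hVσ : DomainUQ.JacobianSingularValueBounds D V σmin σmax)
    (hVG : DomainUQ.GevreyField D V C β b)
    (hf : DomainUQ.GevreySource (DomainUQ.holdAll D V) f Cf β ρ) :
    (∀ y ∈ DomainUQ.paramSet,
      ∃! u : DomainUQ.H01 D, DomainUQ.IsPullbackSolution D f (V y) u) ∧
    ∀ u : (ℕ → ℝ) → DomainUQ.H01 D,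
      (∀ y ∈ DomainUQ.paramSet, DomainUQ.IsPullbackSolution D f (V y) (u y)) →
      ∃ du : (ℕ →₀ ℕ) → (ℕ → ℝ) → DomainUQ.H01 D,
        DomainUQ.IsParamDerivFamily u du ∧
        (∀ y ∈ DomainUQ.paramSet,
          DomainUQ.h01Norm (du 0 y) ≤
            1 + σmax ^ 2 / σmin ^ d * √(MeasureTheory.volume.real D) * DomainUQ.poincareConst D *
              (σmax ^ d * Cf)) ∧
        ∀ ν : ℕ →₀ ℕ, ν ≠ 0 → ∀ y ∈ DomainUQ.paramSet,
          DomainUQ.h01Norm (du ν y) ≤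
            DomainUQ.Cu1 D σmin σmax β Cf * DomainUQ.Cu2 D σmin σmax β C Cf ρ ^ ν.degree *
              DomainUQ.factPow β ν.degree * DomainUQ.mpow b ν := by
  have hd0 : 0 < d := by omega
  have := completeSpace_gradSpace hd0 hDb
  obtain ⟨T, F, hT, hF, hTF⟩ := exists_gevrey_operator_equation hd0 hDo hDb hσ0 hσ2 hC hβ hb hCf hρ
    hV2 hVσ hVG hf
  set m := min σmax C with hm
  have hm1 : 1 ≤ m := le_min hσ2 hC
  have hmσ : m ≤ σmax := min_le_left _ _
  have hmC : m ≤ C := min_le_right _ _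
  have hσmax0 : 0 < σmax := by linarith
  have hC0 : 0 < C := by linarith
  have hρ0 : 0 ≤ ∑ j, ρ j := Finset.sum_nonneg fun j _ => hρ j
  have hdp : (0 : ℝ) ≤ d := Nat.cast_nonneg d
  have hP0 := poincareConst_nonneg D
  have hτ0 : 0 ≤ m ^ 2 / σmin ^ d := by positivity
  have hinj : ∀ y ∈ paramSet, Function.Injective (T y) := fun y hy => by
    refine (injective_iff_map_eq_zero (T y)).2 fun g hg => ?_
    have h := (hTF y hy).1 g
    rw [hg, norm_zero, mul_zero] at h
    exact norm_le_zero_iff.1 h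
  refine ⟨fun y hy => ?_, fun u hu => ?_⟩
  · obtain ⟨g, hg⟩ := (hTF y hy).2.1 (F y)
    obtain ⟨u, rfl⟩ := (gradEquiv hd0 hDb).surjective g
    refine ⟨u, ((hTF y hy).2.2 u).2 hg, fun v hv => ?_⟩
    exact (gradEquiv hd0 hDb).injective (hinj y hy ((((hTF y hy).2.2 v).1 hv).trans hg.symm))
  · have hsol := IsGevrey.solve hb hβ hτ0 (fun y hy => (hTF y hy).1) (fun y hy => (hTF y hy).2.1)
      (u := fun y => gradEquiv hd0 hDb (u y)) (fun y hy => ((hTF y hy).2.2 (u y)).1 (hu y hy))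
      (by positivity) (by positivity) (by positivity) (by positivity) hT hF
    obtain ⟨G, hG, hGb⟩ := hsol
    -- the leading constant only uses the bound `m ≤ σmax`
    have hK : m ^ 2 / σmin ^ d * (poincareConst D * √(volume.real D) * (Cf * σmax ^ d)) ≤
        σmax ^ 2 / σmin ^ d * √(volume.real D) * poincareConst D * (σmax ^ d * Cf) := by
      calc _ ≤ σmax ^ 2 / σmin ^ d * (poincareConst D * √(volume.real D) * (Cf * σmax ^ d)) := by
            gcongr
        _ = _ := by ring
    refine ⟨fun ν y => (gradEquiv hd0 hDb).symm (G ν y), ?_, fun y hy => ?_, fun ν hν y hy => ?_⟩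
    · refine (hG.clm ((gradEquiv hd0 hDb).symm : GradSpace D →L[ℝ] H01 D)).congr fun y _ => ?_
      simp
    · rw [h01Norm_gradEquiv_symm]
      have h0 := hGb 0 y hy
      simp only [map_zero, pow_zero, mul_one, factPow_zero] at h0
      have h1 : mpow b 0 = 1 := by simp [mpow]
      rw [h1, mul_one] at h0
      linarith
    · rw [h01Norm_gradEquiv_symm]
      refine (hGb ν y hy).trans ?_
      have hν0 : ν.degree ≠ 0 := fun h => hν ((Finsupp.degree_eq_zero_iff ν).1 h)
      have hQ := two_rpow_mul_rate_le (D := D) (Cf := Cf) hd hσ0 hσ1 hσ2 hC hβ hρ hm1 hmC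
      have hle := mul_pow_le_of_two_rpow_mul_le (by linarith : (0 : ℝ) ≤ β) hν0 hK (by positivity)
        (by positivity) hQ
      have e1 : Cu1 D σmin σmax β Cf = 1 + σmax ^ 2 / σmin ^ d * √(volume.real D) *
          poincareConst D * (σmax ^ d * Cf) * 2 ^ (-β) := by
        rw [Cu1, Cfref1]
        ring
      rw [e1]
      exact mul_le_mul_of_nonneg_right (mul_le_mul_of_nonneg_right hle (factPow_nonneg _ _))
        (mpow_nonneg hb ν)
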